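/- Let $f\colon\widehat{\mathbb C}\to\widehat{\mathbb C}$ be a rational map of degree at least $2$ whose postcritical set $\operatorname{post}(f)=\{f^n(c): c \text{ a critical point of } f,\ n\ge 1\}$ is finite. Let $\mathcal C\subset\widehat{\mathbb C}$ be an oriented Jordan curve with $\operatorname{post}(f)\subset\mathcal C$, and put $\mathcal C^1:=f^{-1}(\mathcal C)$ and $V^1:=f^{-1}(\operatorname{post}(f))$. The closures of the components of $\mathcal C^1\setminus V^1$ are called $1$-edges; each $1$-edge $E^1$ is mapped by $f$ homeomorphically onto an arc $E^0\subset\mathcal C$. The closures of the two components of $\widehat{\mathbb C}\setminus\mathcal C$ are the $0$-tiles; one of them is colored white, the other black. The closures of the components of $\widehat{\mathbb C}\setminus\mathcal C^1$ are the $1$-tiles; each is mapped by $f$ homeomorphically onto a $0$-tile, and it gets the color of that $0$-tile. Let $H\colon\widehat{\mathbb C}\times[0,1]\to\widehat{\mathbb C}$, $H_t=H(\cdot,t)$, be an elementary pseudo-isotopic deformation of $\mathcal C$ to $\mathcal C^1$ rel. $\operatorname{post}(f)$. That is, $H$ is continuous, $H_0=\mathrm{id}$, $H_t$ is a homeomorphism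 of $\widehat{\mathbb C}$ for every $t\in[0,1)$, $H_t(p)=p$ for all $p\in\operatorname{post}(f)$ and $t\in[0,1]$, and moreover $H_1(\mathcal C)=\mathcal C^1$, the set $W:=H_1^{-1}(V^1)\cap\mathcal C$ is finite, and $H_1\colon\mathcal C\setminus W\to\mathcal C^1\setminus V^1$ is a homeomorphism. Thus for each $1$-edge $E^1$ there is exactly one arc $A\subset\mathcal C$ that is the closure of a component of $\mathcal C\setminus W$ and is mapped by $H_1$ homeomorphically onto $E^1$. Call $H$ orientation-preserving (respectively orientation-reversing) if for every $1$-edge $E^1$ the two orientations on $E^1$ induced from the orientation of $\mathcal C$ by $H_1\colon A\to E^1$ and by $f\colon E^1\to E^0$ agree (respectively are opposite). Then the following hold. 1. $H$ is either orientation-preserving or orientation-reversing (and not both). 2. Let $x,y\in\widehat{\mathbb C}\setminus H_1^{-1}(\mathcal C^1)$. Let $X^0\ni x$ and $Y^0\ni y$ be the $0$-tiles containing $x$ and $y$, and let $X^1\ni H_1(x)$ and $Y^1\ni H_1(y)$ be the $1$-tiles containing $H_1(x)$ and $H_1(y)$. Then $X^0$ and $Y^0$ have the same color if and only if $X^1$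 and $Y^1$ have the same color. 3. For $x$, $X^0$, $X^1$ as in 2, the tiles $X^0$ and $X^1$ have the same color if and only if $H$ is orientation-preserving. -/

import Mathlib

open Set Topology Polynomial unitInterval

/-- The Riemann sphere `ℂ ∪ {∞}`. -/
abbrev RSphere : Type := OnePoint ℂ

/-- `f` is a rational map of degree `d`: `f = p / q` with `p`, `q` coprime polynomials and
`d = max (deg p) (deg q)`; its value at `∞` is the limit, read off from the coefficients of
degree `d`. -/
def IsRationalMapOfDegree (f : RSphere → RSphere) (d : ℕ) : Prop :=
  ∃ p q : ℂ[X], IsCoprime p q ∧ d = max p.natDegree q.natDegree ∧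
    (∀ z : ℂ, (q.eval z ≠ 0 → f (z : RSphere) = ((p.eval z / q.eval z : ℂ) : RSphere)) ∧
      (q.eval z = 0 → f (z : RSphere) = OnePoint.infty)) ∧
    (q.coeff d ≠ 0 → f OnePoint.infty = ((p.coeff d / q.coeff d : ℂ) : RSphere)) ∧
    (q.coeff d = 0 → f OnePoint.infty = OnePoint.infty)

/-- A critical point: a point at which `f` is not locally injective (local degree at least 2). -/
def IsCriticalPoint (f : RSphere → RSphere) (c : RSphere) : Prop :=
  ¬ ∃ U ∈ 𝓝 c, InjOn f U

/-- The postcritical set: all `f^n(c)` with `c` critical and `n ≥ 1`. -/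
def postcriticalSet (f : RSphere → RSphere) : Set RSphere :=
  {x | ∃ c, IsCriticalPoint f c ∧ ∃ n : ℕ, 1 ≤ n ∧ f^[n] c = x}

/-- `γ` parametrizes the Jordan curve `C`. It also fixes an orientation of `C`, namely the one in
which the parameter increases. -/
structure IsOrientedJordanCurve (C : Set RSphere) (γ : UnitAddCircle → RSphere) : Prop where
  continuous : Continuous γ
  injective : Function.Injective γ
  range_eq : range γ = C

/-- `U` is a connected component of the subset `F` of the sphere. -/
def IsComponentOf (F U : Set RSphere) : Prop :=
  ∃ x ∈ F, U = connectedComponentIn F x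

/-- `X` is the closure of a component of the complement of `K`. The `0`-tiles are obtained for
`K = C`, the `1`-tiles for `K = f⁻¹(C)`. -/
def IsTile (K X : Set RSphere) : Prop :=
  ∃ U, IsComponentOf Kᶜ U ∧ X = closure U

inductive TileColor : Type
  | white : TileColor
  | black : TileColor

open Classical in
/-- The color of a `0`-tile, where `Xw` is the `0`-tile chosen to be white. -/
noncomputable def zeroTileColor (Xw X : Set RSphere) : TileColor :=
  if X = Xw then TileColor.white else TileColor.black

/-- The color of a `1`-tile is the color of the `0`-tile onto which `f` maps it. -/
noncomputable def oneTileColor (f : RSphere → RSphere) (Xw X : Set RSphere) : TileColor :=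
  zeroTileColor Xw (f '' X)

/-- The `1`-vertices: the preimages of the postcritical points. -/
def oneVertices (f : RSphere → RSphere) : Set RSphere := f ⁻¹' postcriticalSet f

/-- The `1`-edges: closures of the components of `f⁻¹(C)` minus the `1`-vertices. -/
def IsOneEdge (f : RSphere → RSphere) (C E : Set RSphere) : Prop :=
  ∃ U, IsComponentOf (f ⁻¹' C \ oneVertices f) U ∧ E = closure U

/-- `H` is a pseudo-isotopy rel. `P` of the sphere, starting at the identity. -/
structure IsPseudoIsotopyRel (P : Set RSphere) (H : RSphere × I → RSphere) : Prop where
  continuous : Continuous H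
  homeo : ∀ t : I, t < 1 → IsHomeomorph fun x => H (x, t)
  start : ∀ x, H (x, 0) = x
  rel : ∀ x ∈ P, ∀ t : I, H (x, t) = x

/-- The end `H₁` of a pseudo-isotopy. -/
def endMap (H : RSphere × I → RSphere) : RSphere → RSphere := fun x => H (x, 1)

/-- The points of `C` that are deformed to `1`-vertices. -/
def vertexPreimages (f : RSphere → RSphere) (C : Set RSphere) (H : RSphere × I → RSphere) :
    Set RSphere :=
  endMap H ⁻¹' oneVertices f ∩ C

/-- `H` is an elementary pseudo-isotopic deformation of `C` to `f⁻¹(C)` rel. `post(f)`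
(with no condition on orientations). -/
structure IsElementaryDeformation (f : RSphere → RSphere) (C : Set RSphere)
    (H : RSphere × I → RSphere) : Prop where
  pseudoIsotopy : IsPseudoIsotopyRel (postcriticalSet f) H
  image_eq : endMap H '' C = f ⁻¹' C
  finite : (vertexPreimages f C H).Finite
  homeo : ∃ e : ↥(C \ vertexPreimages f C H) ≃ₜ ↥(f ⁻¹' C \ oneVertices f),
    ∀ x, (e x : RSphere) = endMap H x

/-- The arcs into which `C` is divided by the points that are deformed to `1`-vertices. -/
def IsDeformedArc (f : RSphere → RSphere) (C : Set RSphere) (H : RSphere × I → RSphere)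
    (A : Set RSphere) : Prop :=
  ∃ U, IsComponentOf (C \ vertexPreimages f C H) U ∧ A = closure U

/-- `β` is a parametrization of the arc `A` by the unit interval. -/
structure ParametrizesArc (A : Set RSphere) (β : I → RSphere) : Prop where
  continuous : Continuous β
  injective : Function.Injective β
  range_eq : range β = A

/-- The orientation of an arc `A` contained in the Jordan curve parametrized by `γ`. An orientation
of an arc is represented by the set of its positively oriented parametrizations, here those that
run through `A` in the direction of `γ`. -/
def curveOrientation (γ : UnitAddCircle → RSphere) (A : Set RSphere) : Set (I → RSphere) :=
  {α | ParametrizesArc A α ∧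
    ∃ τ : I → ℝ, Continuous τ ∧ StrictMono τ ∧ ∀ s, α s = γ (τ s : UnitAddCircle)}

/-- The orientation on `h(A)` induced by `h : A → h(A)` and the orientation of `A`. -/
def pushOrientation (γ : UnitAddCircle → RSphere) (h : RSphere → RSphere) (A : Set RSphere) :
    Set (I → RSphere) :=
  {β | ∃ α ∈ curveOrientation γ A, β = h ∘ α}

/-- The orientation on `E` induced by `f : E → f(E)` and the orientation of `f(E)`. -/
def pullOrientation (γ : UnitAddCircle → RSphere) (f : RSphere → RSphere) (E : Set RSphere) :
    Set (I → RSphere) :=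
  {β | ParametrizesArc E β ∧ f ∘ β ∈ curveOrientation γ (f '' E)}

/-- The opposite orientation of an arc. -/
def oppositeOrientation (o : Set (I → RSphere)) : Set (I → RSphere) :=
  {β | β ∘ unitInterval.symm ∈ o}

/-- For every `1`-edge `E`, with corresponding arc `A` in `C`, the orientations on `E` induced by
`H₁ : A → E` and by `f : E → f(E)` agree. -/
def IsOrientationPreservingDeformation (f : RSphere → RSphere) (C : Set RSphere)
    (γ : UnitAddCircle → RSphere) (H : RSphere × I → RSphere) : Prop :=
  ∀ E A, IsOneEdge f C E → IsDeformedArc f C H A → endMap H '' A = E →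
    pushOrientation γ (endMap H) A = pullOrientation γ f E

/-- For every `1`-edge `E`, with corresponding arc `A` in `C`, the orientations on `E` induced by
`H₁ : A → E` and by `f : E → f(E)` are opposite. -/
def IsOrientationReversingDeformation (f : RSphere → RSphere) (C : Set RSphere)
    (γ : UnitAddCircle → RSphere) (H : RSphere × I → RSphere) : Prop :=
  ∀ E A, IsOneEdge f C E → IsDeformedArc f C H A → endMap H '' A = E →
    pushOrientation γ (endMap H) A = oppositeOrientation (pullOrientation γ f E)

/-!
For two points `x`, `y` off a closed curve, compare the winding of the curve around `x` and around
`y` by the variation of `log ((z - x) / (z - y))` along it. For a Jordan curve this number is zero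
exactly when `x` and `y` lie on the same side, and it is invariant under homotopy; hence it is the
same for `γ`, `x`, `y` as for the loop `H₁ ∘ γ` and the points `H₁ x`, `H₁ y`. When a point crosses
a `1`-edge, the conformal map `f` carries the jump of the winding of `H₁ ∘ γ` to the jump of the
winding of `γ` across the image of the edge, up to a sign which says whether `H₁` and `f` induce
the same orientation on the edge. Consequently, whether `x` and `f (H₁ x)` lie on the same side of
`C` does not change when `H₁ x` crosses a `1`-edge. As the complement of the finite set of
`1`-vertices is connected, it does not depend on `x` at all, while comparing the signs shows that it
holds exactly when the orientations on any given `1`-edge agree.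
-/

/-! ### Variation of the logarithm along a path -/

theorem exists_continuous_exp_eq {X : Type*} [TopologicalSpace X] [SimplyConnectedSpace X]
    [LocallyPathConnectedSpace X] {F : X → ℂ} (hF : Continuous F) (h0 : ∀ x, F x ≠ 0) :
    ∃ G : X → ℂ, Continuous G ∧ ∀ x, Complex.exp (G x) = F x := by
  obtain ⟨x₀⟩ : Nonempty X := inferInstance
  obtain ⟨G, ⟨-, hG⟩, -⟩ := Complex.isCoveringMapOn_exp.existsUnique_continuousMap_lifts
    (⟨F, hF⟩ : C(X, ℂ)) (a₀ := x₀) (e₀ := Complex.log (F x₀))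
    (by simp [Complex.exp_log (h0 x₀)]) (by simpa using h0)
  exact ⟨G, G.continuous, fun x => congrFun hG x⟩

theorem eq_of_continuousOn_of_exp_eq {Z : Type*} [TopologicalSpace Z] {s : Set Z}
    (hs : IsPreconnected s) {L : Z → ℂ} (hL : ContinuousOn L s) {c : ℂ}
    (he : ∀ z ∈ s, Complex.exp (L z) = c) {x y : Z} (hx : x ∈ s) (hy : y ∈ s) : L x = L y :=
  Complex.isCoveringMap_exp.isSeparatedMap.constOn_of_comp
    Complex.isCoveringMap_exp.isLocalHomeomorph.isLocallyInjective hs hL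
    (fun z hz w hw => Subtype.ext ((he z hz).trans (he w hw).symm)) hx hy

theorem exp_sub_add_period {X : Type*} [Add X] {φ : X → ℂ} {T : X} (hφ : Function.Periodic φ T)
    {g : X → ℂ} (he : ∀ x, Complex.exp (g x) = φ x) (x : X) :
    Complex.exp (g (x + T) - g x) = 1 := by
  rw [Complex.exp_sub, he, he, hφ, div_self (he x ▸ Complex.exp_ne_zero _)]

/-- `L` is the variation from `a` to `b` of a continuous logarithm of `φ`. -/
def IsLogVariation (φ : ℝ → ℂ) (a b : ℝ) (L : ℂ) : Prop :=
  ∃ g : ℝ → ℂ, ContinuousOn g (uIcc a b) ∧ (∀ t ∈ uIcc a b, Complex.exp (g t) = φ t) ∧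
    g b - g a = L

theorem exists_continuous_isLogVariation {φ : ℝ → ℂ} (hφ : Continuous φ) (h0 : ∀ t, φ t ≠ 0) :
    ∃ g : ℝ → ℂ, Continuous g ∧ (∀ t, Complex.exp (g t) = φ t) ∧
      ∀ a b, IsLogVariation φ a b (g b - g a) := by
  obtain ⟨g, hg, he⟩ := exists_continuous_exp_eq hφ h0
  exact ⟨g, hg, he, fun a b => ⟨g, hg.continuousOn, fun t _ => he t, rfl⟩⟩

namespace IsLogVariation

variable {φ ψ : ℝ → ℂ} {a b c : ℝ} {L M : ℂ}

theorem congr (h : IsLogVariation φ a b L) (he : EqOn φ ψ (uIcc a b)) :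
    IsLogVariation ψ a b L := by
  obtain ⟨g, hg, hx, hL⟩ := h
  exact ⟨g, hg, fun t ht => (hx t ht).trans (he ht), hL⟩

theorem mul (h : IsLogVariation φ a b L) (h' : IsLogVariation ψ a b M) :
    IsLogVariation (fun t => φ t * ψ t) a b (L + M) := by
  obtain ⟨g, hg, hx, rfl⟩ := h
  obtain ⟨g', hg', hx', rfl⟩ := h'
  refine ⟨fun t => g t + g' t, hg.add hg', fun t ht => ?_, by ring⟩
  rw [Complex.exp_add, hx t ht, hx' t ht]

theorem symm (h : IsLogVariation φ a b L) : IsLogVariation φ b a (-L) := by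
  obtain ⟨g, hg, hx, rfl⟩ := h
  rw [uIcc_comm] at hg hx
  exact ⟨g, hg, hx, (neg_sub _ _).symm⟩

theorem inv (h : IsLogVariation φ a b L) : IsLogVariation (fun t => (φ t)⁻¹) a b (-L) := by
  obtain ⟨g, hg, hx, rfl⟩ := h
  refine ⟨fun t => - g t, hg.neg, fun t ht => ?_, by ring⟩
  rw [Complex.exp_neg, hx t ht]

theorem zpow (h : IsLogVariation φ a b L) (n : ℤ) :
    IsLogVariation (fun t => φ t ^ n) a b (n * L) := by
  obtain ⟨g, hg, hx, rfl⟩ := h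
  refine ⟨fun t => n * g t, continuousOn_const.mul hg, fun t ht => ?_, by ring⟩
  rw [Complex.exp_int_mul, hx t ht]

theorem comp {θ : ℝ → ℝ} (h : IsLogVariation φ (θ a) (θ b) L) (hθ : ContinuousOn θ (uIcc a b))
    (hm : MapsTo θ (uIcc a b) (uIcc (θ a) (θ b))) :
    IsLogVariation (fun t => φ (θ t)) a b L := by
  obtain ⟨g, hg, hx, rfl⟩ := h
  exact ⟨fun t => g (θ t), hg.comp hθ hm, fun t ht => hx _ (hm ht), rfl⟩

theorem exp_mul (h : IsLogVariation φ a b L) : Complex.exp L * φ a = φ b := by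
  obtain ⟨g, -, hx, rfl⟩ := h
  rw [← hx a left_mem_uIcc, ← hx b right_mem_uIcc, ← Complex.exp_add, sub_add_cancel]

theorem ne_zero (h : IsLogVariation φ a b L) {t : ℝ} (ht : t ∈ uIcc a b) : φ t ≠ 0 := by
  obtain ⟨g, -, hx, -⟩ := h
  exact hx t ht ▸ Complex.exp_ne_zero _

theorem unique (h : IsLogVariation φ a b L) (h' : IsLogVariation φ a b M) : L = M := by
  have h0 (t) (ht : t ∈ uIcc a b) : φ t ≠ 0 := h.ne_zero ht
  obtain ⟨g, hg, hx, rfl⟩ := h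
  obtain ⟨g', hg', hx', rfl⟩ := h'
  have hconst : g b - g' b = g a - g' a :=
    eq_of_continuousOn_of_exp_eq isPreconnected_uIcc (hg.sub hg') (c := 1)
      (fun t ht => by
        rw [Pi.sub_apply, Complex.exp_sub, hx t ht, hx' t ht, div_self (h0 t ht)])
      right_mem_uIcc left_mem_uIcc
  linear_combination hconst

theorem trans (hφ : Continuous φ) (h0 : ∀ t, φ t ≠ 0) (h : IsLogVariation φ a b L)
    (h' : IsLogVariation φ b c M) : IsLogVariation φ a c (L + M) := by
  obtain ⟨g, -, -, hg⟩ := exists_continuous_isLogVariation hφ h0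
  rw [h.unique (hg a b), h'.unique (hg b c), sub_add_sub_cancel']
  exact hg a c

theorem norm_le_of_norm_sub_one_le (h : IsLogVariation φ a b L) {ε : ℝ} (hε : ε ≤ 1 / 2)
    (hs : ∀ t ∈ uIcc a b, ‖φ t - 1‖ ≤ ε) : ‖L‖ ≤ 3 * ε := by
  obtain ⟨g, hg, hx, rfl⟩ := h
  have hslit (t) (ht : t ∈ uIcc a b) : φ t ∈ Complex.slitPlane := by
    simpa using Complex.mem_slitPlane_of_norm_lt_one
      (show ‖φ t - 1‖ < 1 by linarith [hs t ht])
  have hφ : ContinuousOn φ (uIcc a b) :=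
    (Complex.continuous_exp.comp_continuousOn hg).congr fun t ht => (hx t ht).symm
  have hlog : IsLogVariation φ a b (Complex.log (φ b) - Complex.log (φ a)) :=
    ⟨_, hφ.clog hslit, fun t ht => Complex.exp_log (Complex.slitPlane_ne_zero (hslit t ht)), rfl⟩
  have hbound (t) (ht : t ∈ uIcc a b) : ‖Complex.log (φ t)‖ ≤ 3 / 2 * ε := by
    have := Complex.norm_log_one_add_half_le_self ((hs t ht).trans hε)
    rw [add_sub_cancel] at this
    linarith [hs t ht]
  rw [IsLogVariation.unique ⟨g, hg, hx, rfl⟩ hlog]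
  calc ‖Complex.log (φ b) - Complex.log (φ a)‖
      ≤ ‖Complex.log (φ b)‖ + ‖Complex.log (φ a)‖ := norm_sub_le _ _
    _ ≤ 3 / 2 * ε + 3 / 2 * ε := add_le_add (hbound b right_mem_uIcc) (hbound a left_mem_uIcc)
    _ = 3 * ε := by ring

end IsLogVariation

theorem exists_isLogVariation {φ : ℝ → ℂ} {a b : ℝ} (hφ : ContinuousOn φ (uIcc a b))
    (h0 : ∀ t ∈ uIcc a b, φ t ≠ 0) : ∃ L, IsLogVariation φ a b L := by
  let clamp : ℝ → Icc (min a b) (max a b) := projIcc _ _ min_le_max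
  obtain ⟨g, -, -, hg⟩ := exists_continuous_isLogVariation (φ := fun t => φ (clamp t))
    (hφ.comp_continuous (continuous_subtype_val.comp continuous_projIcc) fun t => (clamp t).2)
    (fun t => h0 _ (clamp t).2)
  refine ⟨_, (hg a b).congr fun t ht => ?_⟩
  simp only [clamp, projIcc_of_mem min_le_max ht]

theorem continuousAt_of_isLogVariation {Z : Type*} [TopologicalSpace Z] {Φ : Z → ℝ → ℂ} {a b : ℝ}
    {L : Z → ℂ} {z₀ : Z} (hc : ∀ s ∈ uIcc a b, ContinuousAt (fun p : Z × ℝ => Φ p.1 p.2) (z₀, s))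
    (hL : ∀ᶠ z in 𝓝 z₀, IsLogVariation (Φ z) a b (L z)) : ContinuousAt L z₀ := by
  have hL₀ := hL.self_of_nhds
  have hclose {δ : ℝ} (hδ : 0 < δ) :
      ∀ᶠ z in 𝓝 z₀, ∀ s ∈ uIcc a b, ‖Φ z s * (Φ z₀ s)⁻¹ - 1‖ < δ := by
    refine isCompact_uIcc.eventually_forall_of_forall_eventually fun s hs => ?_
    have h₀ : Φ z₀ s ≠ 0 := hL₀.ne_zero hs
    have hslice : ContinuousAt (fun p : Z × ℝ => Φ z₀ p.2) (z₀, s) :=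
      ContinuousAt.comp (f := fun p : Z × ℝ => (z₀, p.2)) (g := fun p : Z × ℝ => Φ p.1 p.2)
        (hc s hs) (by fun_prop)
    have hnorm : ContinuousAt (fun p : Z × ℝ => ‖Φ p.1 p.2 * (Φ z₀ p.2)⁻¹ - 1‖) (z₀, s) :=
      (((hc s hs).mul (hslice.inv₀ h₀)).sub continuousAt_const).norm
    exact hnorm.eventually_lt_const (by simpa [h₀] using hδ)
  rw [ContinuousAt, Metric.tendsto_nhds]
  intro ε hε
  filter_upwards [hclose (δ := min (1 / 2) (ε / 6)) (by positivity), hL] with z hz hLz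
  have := (hLz.mul hL₀.inv).norm_le_of_norm_sub_one_le (min_le_left _ _) fun t ht => (hz t ht).le
  rw [dist_eq_norm, sub_eq_add_neg]
  linarith [min_le_right (1 / 2 : ℝ) (ε / 6)]

/-! ### Coordinates on the Riemann sphere -/

/-- The finite part of a point of the sphere, with junk value `0` at `∞`. -/
noncomputable def finitePart (z : RSphere) : ℂ := OnePoint.elim z 0 id

@[simp] theorem finitePart_coe (z : ℂ) : finitePart (z : RSphere) = z := rfl

theorem coe_finitePart {z : RSphere} (hz : z ≠ OnePoint.infty) : (finitePart z : RSphere) = z := by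
  induction z using OnePoint.rec with
  | infty => exact absurd rfl hz
  | coe z => rfl

theorem continuousAt_finitePart {z : RSphere} (hz : z ≠ OnePoint.infty) :
    ContinuousAt finitePart z := by
  induction z using OnePoint.rec with
  | infty => exact absurd rfl hz
  | coe z =>
    rw [OnePoint.continuousAt_coe]
    exact continuousAt_id

theorem tendsto_coe_cobounded :
    Filter.Tendsto ((↑) : ℂ → RSphere) (Bornology.cobounded ℂ) (𝓝 OnePoint.infty) := by
  rw [Metric.cobounded_eq_cocompact, ← Filter.coclosedCompact_eq_cocompact]
  exact OnePoint.tendsto_coe_infty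

theorem continuousAt_infty_of_tendsto_cobounded {Y : Type*} [TopologicalSpace Y] {h : RSphere → Y}
    (hh : Filter.Tendsto (fun z : ℂ => h z) (Bornology.cobounded ℂ) (𝓝 (h OnePoint.infty))) :
    ContinuousAt h OnePoint.infty := by
  rwa [OnePoint.continuousAt_infty', Filter.coclosedCompact_eq_cocompact,
    ← Metric.cobounded_eq_cocompact]

/-- The function underlying the inversion `sphereInv` of the sphere. -/
noncomputable def sphereInvFun (z : RSphere) : RSphere :=
  OnePoint.elim z ((0 : ℂ) : RSphere)
    (fun w : ℂ => if w = 0 then OnePoint.infty else ((w⁻¹ : ℂ) : RSphere))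

@[simp] theorem sphereInvFun_infty : sphereInvFun OnePoint.infty = ((0 : ℂ) : RSphere) := rfl

@[simp] theorem sphereInvFun_zero : sphereInvFun ((0 : ℂ) : RSphere) = OnePoint.infty := by
  simp [sphereInvFun]

theorem sphereInvFun_coe {z : ℂ} (hz : z ≠ 0) :
    sphereInvFun (z : RSphere) = ((z⁻¹ : ℂ) : RSphere) := by
  simp [sphereInvFun, hz]

theorem involutive_sphereInvFun : Function.Involutive sphereInvFun := by
  intro z
  induction z using OnePoint.rec with
  | infty => simp
  | coe z =>
    rcases eq_or_ne z 0 with rfl | hz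
    · simp
    · rw [sphereInvFun_coe hz, sphereInvFun_coe (inv_ne_zero hz), inv_inv]

theorem continuous_sphereInvFun : Continuous sphereInvFun := by
  rw [continuous_iff_continuousAt]
  intro z
  induction z using OnePoint.rec with
  | infty =>
    refine continuousAt_infty_of_tendsto_cobounded <|
      ((OnePoint.continuous_coe.tendsto (0 : ℂ)).comp Filter.tendsto_inv₀_cobounded).congr' ?_
    filter_upwards [Bornology.eventually_ne_cobounded (0 : ℂ)] with z hz
    exact (sphereInvFun_coe hz).symm
  | coe z =>
    rw [OnePoint.continuousAt_coe]
    rcases eq_or_ne z 0 with rfl | hz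
    · rw [continuousAt_iff_punctured_nhds]
      simp only [Function.comp_apply, sphereInvFun_zero]
      refine (tendsto_coe_cobounded.comp Filter.tendsto_inv₀_nhdsNE_zero).congr' ?_
      filter_upwards [self_mem_nhdsWithin] with z hz
      exact (sphereInvFun_coe hz).symm
    · refine (OnePoint.continuous_coe.continuousAt.comp (continuousAt_inv₀ hz)).congr ?_
      filter_upwards [isOpen_ne.mem_nhds hz] with w hw
      exact (sphereInvFun_coe hw).symm

/-- The inversion `z ↦ 1 / z` of the sphere. -/
noncomputable def sphereInv : RSphere ≃ₜ RSphere where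
  toEquiv := involutive_sphereInvFun.toPerm
  continuous_toFun := continuous_sphereInvFun
  continuous_invFun := continuous_sphereInvFun

@[simp] theorem sphereInv_symm : sphereInv.symm = sphereInv := rfl

@[simp] theorem sphereInv_infty : sphereInv OnePoint.infty = ((0 : ℂ) : RSphere) := rfl

@[simp] theorem sphereInv_zero : sphereInv ((0 : ℂ) : RSphere) = OnePoint.infty :=
  sphereInvFun_zero

theorem sphereInv_coe {z : ℂ} (hz : z ≠ 0) : sphereInv (z : RSphere) = ((z⁻¹ : ℂ) : RSphere) :=
  sphereInvFun_coe hz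

@[simp] theorem sphereInv_sphereInv (z : RSphere) : sphereInv (sphereInv z) = z :=
  involutive_sphereInvFun z

theorem sphereInv_ne_infty {z : RSphere} (hz : z ≠ ((0 : ℂ) : RSphere)) :
    sphereInv z ≠ OnePoint.infty := by
  rw [← sphereInv_zero]
  exact sphereInv.injective.ne hz

/-- The translation `z ↦ z + a` of the sphere. -/
noncomputable def sphereTranslate (a : ℂ) : RSphere ≃ₜ RSphere :=
  (Homeomorph.addRight a).onePointCongr

@[simp] theorem sphereTranslate_infty (a : ℂ) :
    sphereTranslate a OnePoint.infty = OnePoint.infty := rfl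

@[simp] theorem sphereTranslate_coe (a z : ℂ) :
    sphereTranslate a (z : RSphere) = ((z + a : ℂ) : RSphere) := rfl

theorem sphereTranslate_symm (a : ℂ) : (sphereTranslate a).symm = sphereTranslate (-a) := by
  ext z
  rw [Homeomorph.symm_apply_eq]
  induction z using OnePoint.rec with
  | infty => simp
  | coe z => simp

open Classical in
/-- A Möbius transformation that maps `q` to `∞`: the identity if `q = ∞`, and
`z ↦ 1 / (z - q)` otherwise. -/
noncomputable def coordAt (q : RSphere) : RSphere ≃ₜ RSphere :=
  if q = OnePoint.infty then Homeomorph.refl _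
  else (sphereTranslate (-finitePart q)).trans sphereInv

@[simp] theorem coordAt_self (q : RSphere) : coordAt q q = OnePoint.infty := by
  by_cases hq : q = OnePoint.infty
  · simp [coordAt, hq]
  · obtain ⟨z, rfl⟩ : ∃ z : ℂ, (z : RSphere) = q := ⟨_, coe_finitePart hq⟩
    simp [coordAt]

theorem coordAt_ne_infty {q z : RSphere} (h : z ≠ q) : coordAt q z ≠ OnePoint.infty := by
  rw [← coordAt_self q]
  exact (coordAt q).injective.ne h

theorem coordAt_coe_symm_coe (y : ℂ) {ζ : ℂ} (hζ : ζ ≠ 0) :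
    (coordAt (y : RSphere)).symm (ζ : RSphere) = ((ζ⁻¹ + y : ℂ) : RSphere) := by
  simp [coordAt, Homeomorph.symm_apply_eq, hζ, sphereInv_coe]

theorem exists_isPreconnected_nhds_subset_of_isOpenEmbedding {X Y : Type*} [TopologicalSpace X]
    [LocallyConnectedSpace X] [TopologicalSpace Y] {e : X → Y} (he : IsOpenEmbedding e) (x : X)
    {U : Set Y} (hU : U ∈ 𝓝 (e x)) : ∃ V ∈ 𝓝 (e x), IsPreconnected V ∧ V ⊆ U := by
  obtain ⟨V, hV, hpre, hVU⟩ := locallyConnectedSpace_iff_connected_subsets.1 ‹_› x _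
    (he.continuous.continuousAt.preimage_mem_nhds hU)
  exact ⟨e '' V, he.isOpenMap.image_mem_nhds hV, hpre.image _ he.continuous.continuousOn,
    image_subset_iff.2 hVU⟩

instance : LocallyConnectedSpace RSphere := by
  rw [locallyConnectedSpace_iff_connected_subsets]
  intro z U hU
  induction z using OnePoint.rec with
  | coe z =>
    exact exists_isPreconnected_nhds_subset_of_isOpenEmbedding OnePoint.isOpenEmbedding_coe z hU
  | infty =>
    rw [← sphereInv_zero] at hU ⊢
    exact exists_isPreconnected_nhds_subset_of_isOpenEmbedding
      (sphereInv.isOpenEmbedding.comp OnePoint.isOpenEmbedding_coe) 0 hU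

/-! ### The function with zero `x` and pole `y` -/

/-- The function `z ↦ (z - x) / (z - y)` on the sphere, with its limit `1` as value at `∞`, whose
logarithm measures the winding about `x` relative to the winding about `y`. -/
noncomputable def ratio (z : RSphere) (x y : ℂ) : ℂ :=
  OnePoint.elim z 1 (fun w : ℂ => (w - x) / (w - y))

@[simp] theorem ratio_infty (x y : ℂ) : ratio OnePoint.infty x y = 1 := rfl

@[simp] theorem ratio_coe (z x y : ℂ) : ratio (z : RSphere) x y = (z - x) / (z - y) := rfl

theorem ratio_ne_zero {z : RSphere} {x y : ℂ} (hx : z ≠ x) (hy : z ≠ y) : ratio z x y ≠ 0 := by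
  induction z using OnePoint.rec with
  | infty => simp
  | coe z =>
    exact div_ne_zero (sub_ne_zero.2 fun h => hx (h ▸ rfl)) (sub_ne_zero.2 fun h => hy (h ▸ rfl))

theorem ratio_mul_ratio {z : RSphere} {x y v : ℂ} (hy : z ≠ y) :
    ratio z x y * ratio z y v = ratio z x v := by
  induction z using OnePoint.rec with
  | infty => simp
  | coe z =>
    have : z - y ≠ 0 := sub_ne_zero.2 fun h => hy (h ▸ rfl)
    simp only [ratio_coe]
    field_simp

theorem ratio_eq_of_ne_zero {z : RSphere} (hz : z ≠ (0 : ℂ)) (x y : ℂ) :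
    ratio z x y = (1 - x * finitePart (sphereInv z)) / (1 - y * finitePart (sphereInv z)) := by
  induction z using OnePoint.rec with
  | infty => simp
  | coe z =>
    have hz' : z ≠ 0 := fun h => hz (h ▸ rfl)
    rw [sphereInv_coe hz', finitePart_coe, ratio_coe, ← mul_div_mul_left _ _ (inv_ne_zero hz')]
    congr 1 <;> field_simp

theorem ratio_eq_of_ne_infty {z : RSphere} (hz : z ≠ OnePoint.infty) (x y : ℂ) :
    ratio z x y = (finitePart z - x) / (finitePart z - y) := by
  rw [← ratio_coe, coe_finitePart hz]

theorem continuousAt_ratio {Z : Type*} [TopologicalSpace Z] {u : Z → RSphere} {x y : Z → ℂ}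
    {z₀ : Z} (hu : ContinuousAt u z₀) (hx : ContinuousAt x z₀) (hy : ContinuousAt y z₀)
    (h : u z₀ ≠ y z₀) : ContinuousAt (fun z => ratio (u z) (x z) (y z)) z₀ := by
  by_cases hinf : u z₀ = OnePoint.infty
  · have h0 : u z₀ ≠ ((0 : ℂ) : RSphere) := hinf ▸ OnePoint.infty_ne_coe 0
    have hfin : ContinuousAt (fun z => finitePart (sphereInv (u z))) z₀ :=
      ContinuousAt.comp (g := finitePart) (continuousAt_finitePart (sphereInv_ne_infty h0))
        (sphereInv.continuous.continuousAt.comp hu)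
    have hnum := (continuousAt_const (y := (1 : ℂ))).sub (hx.mul hfin)
    have hden := (continuousAt_const (y := (1 : ℂ))).sub (hy.mul hfin)
    refine (hnum.div hden (by simp [hinf])).congr ?_
    filter_upwards [hu.eventually_ne h0] with z hz
    exact (ratio_eq_of_ne_zero hz _ _).symm
  · have hfin : ContinuousAt (fun z => finitePart (u z)) z₀ :=
      ContinuousAt.comp (g := finitePart) (continuousAt_finitePart hinf) hu
    have hsub : finitePart (u z₀) - y z₀ ≠ 0 :=
      sub_ne_zero.2 fun e => h (by rw [← e, coe_finitePart hinf])
    refine ((hfin.sub hx).div (hfin.sub hy) hsub).congr ?_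
    filter_upwards [hu.eventually_ne hinf] with z hz
    exact (ratio_eq_of_ne_infty hz _ _).symm

/-! ### Obstructions to logarithms -/

theorem closure_connectedComponentIn_inter_subset {α : Type*} [TopologicalSpace α] {F : Set α}
    {x : α} (hx : x ∈ F) :
    closure (connectedComponentIn F x) ∩ F ⊆ connectedComponentIn F x :=
  (isPreconnected_connectedComponentIn.subset_closure
    (subset_inter subset_closure (connectedComponentIn_subset F x))
    inter_subset_left).subset_connectedComponentIn
    ⟨subset_closure (mem_connectedComponentIn hx), hx⟩ inter_subset_right

theorem frontier_connectedComponentIn_compl_subset {α : Type*} [TopologicalSpace α]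
    [LocallyConnectedSpace α] {K : Set α} (hK : IsClosed K) {x : α} (hx : x ∉ K) :
    frontier (connectedComponentIn Kᶜ x) ⊆ K := fun z hz => by
  rw [hK.isOpen_compl.connectedComponentIn.frontier_eq] at hz
  by_contra hzK
  exact hz.2 (closure_connectedComponentIn_inter_subset hx ⟨hz.1, hzK⟩)

theorem eq_zero_of_exp_eq_mul_zpow_on_sphere {c K : ℂ} {r : ℝ} (hr : 0 < r) {G : ℂ → ℂ}
    (hG : ContinuousOn G (Metric.sphere c r)) {k : ℤ}
    (he : ∀ z ∈ Metric.sphere c r, Complex.exp (G z) = K * (z - c) ^ k) : k = 0 := by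
  have hmem (t : ℝ) : circleMap c r t ∈ Metric.sphere c r := circleMap_mem_sphere c hr.le t
  have hcont : Continuous fun t : ℝ => G (circleMap c r t) - k * (t * Complex.I) :=
    (hG.comp_continuous (continuous_circleMap c r) hmem).sub (by fun_prop)
  have hexp (t : ℝ) :
      Complex.exp (G (circleMap c r t) - k * (t * Complex.I)) = K * (r : ℂ) ^ k := by
    rw [Complex.exp_sub, he _ (hmem t), Complex.exp_int_mul, circleMap, add_sub_cancel_left,
      mul_zpow, ← mul_assoc, mul_div_cancel_right₀ _ (zpow_ne_zero _ (Complex.exp_ne_zero _))]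
  have hends := eq_of_continuousOn_of_exp_eq isPreconnected_univ hcont.continuousOn
    (fun t _ => hexp t) (mem_univ (2 * Real.pi)) (mem_univ 0)
  have hperiod : circleMap c r (2 * Real.pi) = circleMap c r 0 := by
    simpa using periodic_circleMap c r 0
  simpa [hperiod, Real.pi_ne_zero] using hends

theorem eq_zero_of_eventually_eq_ratio_zpow {x y : ℂ} (hxy : x ≠ y) {F : RSphere → ℂ}
    (hF : ContinuousOn F {(y : RSphere)}ᶜ) (h0 : ∀ z ≠ (y : RSphere), F z ≠ 0) {k : ℤ}
    (he : ∀ᶠ z in 𝓝[≠] (y : RSphere), F z = ratio z x y ^ k) : k = 0 := by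
  let ψ : ℂ → RSphere := fun ζ => (coordAt (y : RSphere)).symm ζ
  have hψc : Continuous ψ := (coordAt (y : RSphere)).symm.continuous.comp OnePoint.continuous_coe
  have hψy (ζ) : ψ ζ ≠ y := fun e => by simpa using (Homeomorph.symm_apply_eq _).1 e
  have hψt : Filter.Tendsto ψ (Bornology.cobounded ℂ) (𝓝[≠] (y : RSphere)) := by
    refine tendsto_nhdsWithin_iff.2 ⟨?_, Filter.Eventually.of_forall hψy⟩
    have := ((coordAt (y : RSphere)).symm.continuous.tendsto OnePoint.infty).comp
      tendsto_coe_cobounded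
    rwa [(Homeomorph.symm_apply_eq _).2 (coordAt_self (y : RSphere)).symm] at this
  obtain ⟨G, hGc, hG⟩ :=
    exists_continuous_exp_eq (hF.comp_continuous hψc hψy) fun ζ => h0 _ (hψy ζ)
  have hd : y - x ≠ 0 := sub_ne_zero.2 hxy.symm
  let c : ℂ := -(y - x)⁻¹
  have hlarge : ∀ᶠ ζ in Bornology.cobounded ℂ,
      Complex.exp (G ζ) = (y - x) ^ k * (ζ - c) ^ k := by
    filter_upwards [hψt.eventually he, Bornology.eventually_ne_cobounded (0 : ℂ)] with ζ hζ hζ0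
    rw [hG, Function.comp_apply, hζ, ← mul_zpow]
    simp only [ψ, c, coordAt_coe_symm_coe y hζ0, ratio_coe]
    congr 1
    field_simp
    ring
  obtain ⟨R, -, hR⟩ := (Metric.hasBasis_cobounded_compl_closedBall c).eventually_iff.1 hlarge
  refine eq_zero_of_exp_eq_mul_zpow_on_sphere (r := max R 0 + 1) (by positivity)
    hGc.continuousOn fun ζ hζ => hR ?_
  rw [mem_compl_iff, Metric.mem_closedBall, Metric.mem_sphere.1 hζ]
  linarith [le_max_left R 0]

/-- A logarithm on `K` would glue to a nonvanishing continuous function off `y` that behaves like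
a `k`-th power at `y`. -/
theorem eq_zero_of_ratio_zpow_mul_eq_exp {K : Set RSphere} (hK : IsClosed K) {x y : ℂ}
    (hx : (x : RSphere) ∉ K) (hy : (y : RSphere) ∉ K)
    (hyU : (y : RSphere) ∉ connectedComponentIn Kᶜ x) {h : RSphere → ℂ}
    (hh : ContinuousOn h (closure (connectedComponentIn Kᶜ (x : RSphere))))
    (h0 : ∀ z ∈ closure (connectedComponentIn Kᶜ (x : RSphere)), h z ≠ 0)
    {g : RSphere → ℂ} (hg : Continuous g) {k : ℤ}
    (he : ∀ z ∈ K, ratio z x y ^ k * h z = Complex.exp (g z)) : k = 0 := by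
  classical
  set U := connectedComponentIn Kᶜ (x : RSphere)
  have hxU : (x : RSphere) ∈ U := mem_connectedComponentIn hx
  have hUo : IsOpen U := hK.isOpen_compl.connectedComponentIn
  have hyU' : (y : RSphere) ∉ closure U := fun hc =>
    hyU (closure_connectedComponentIn_inter_subset hx ⟨hc, hy⟩)
  let F : RSphere → ℂ := U.piecewise (fun z => Complex.exp (g z) / h z) (fun z => ratio z x y ^ k)
  have hratio {z : RSphere} (hzU : z ∉ U) (hzy : z ≠ y) : ratio z x y ≠ 0 :=
    ratio_ne_zero (fun e => hzU (e ▸ hxU)) hzy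
  have hFc : ContinuousOn F {(y : RSphere)}ᶜ := by
    refine ContinuousOn.piecewise (fun z hz => ?_) ?_ fun z hz => ?_
    · rw [← he z (frontier_connectedComponentIn_compl_subset hK hx hz.2),
        mul_div_cancel_right₀ _ (h0 z hz.2.1)]
    · exact (Complex.continuous_exp.comp hg).continuousOn.div (hh.mono inter_subset_right)
        fun z hz => h0 z hz.2
    · rw [hUo.isClosed_compl.closure_eq] at hz
      exact ((continuousAt_ratio continuousAt_id continuousAt_const continuousAt_const hz.1).zpow₀ k
        (Or.inl (hratio hz.2 hz.1))).continuousWithinAt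
  refine eq_zero_of_eventually_eq_ratio_zpow (fun e => hyU (by rwa [← e])) hFc (fun z hz => ?_) ?_
  · by_cases hzU : z ∈ U
    · simpa only [F, piecewise_eq_of_mem _ _ _ hzU] using
        div_ne_zero (Complex.exp_ne_zero _) (h0 z (subset_closure hzU))
    · simpa only [F, piecewise_eq_of_notMem _ _ _ hzU] using zpow_ne_zero k (hratio hzU hz)
  · filter_upwards [nhdsWithin_le_nhds (isClosed_closure.isOpen_compl.mem_nhds hyU')] with z hz
    exact piecewise_eq_of_notMem _ _ _ fun hzU => hz (subset_closure hzU)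

/-! ### Winding of a loop relative to two points -/

open Classical in
/-- The variation of the logarithm of `(z - x) / (z - y)` along the loop `c`: this is `2πi` times
the difference of the winding numbers around `x` and `y`. It has the junk value `0` if no
continuous logarithm exists. -/
noncomputable def loopVar (c : UnitAddCircle → RSphere) (x y : ℂ) : ℂ :=
  if h : ∃ L, IsLogVariation (fun t => ratio (c t) x y) 0 1 L then h.choose else 0

section LoopVar

variable {c : UnitAddCircle → RSphere} {x y v : ℂ}

theorem continuous_comp_coe_unitAddCircle {Y : Type*} [TopologicalSpace Y] {c : UnitAddCircle → Y}
    (hc : Continuous c) : Continuous fun t : ℝ => c t :=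
  hc.comp (AddCircle.continuous_mk' 1)

theorem continuous_ratio_loop (hc : Continuous c) (hy : (y : RSphere) ∉ range c) :
    Continuous fun t : ℝ => ratio (c t) x y :=
  continuous_iff_continuousAt.2 fun _ => continuousAt_ratio
    (continuous_comp_coe_unitAddCircle hc).continuousAt continuousAt_const continuousAt_const
    fun h => hy ⟨_, h⟩

theorem ratio_loop_ne_zero (hx : (x : RSphere) ∉ range c) (hy : (y : RSphere) ∉ range c)
    (s : UnitAddCircle) : ratio (c s) x y ≠ 0 :=
  ratio_ne_zero (fun h => hx ⟨_, h⟩) (fun h => hy ⟨_, h⟩)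

theorem isLogVariation_loopVar (hc : Continuous c) (hx : (x : RSphere) ∉ range c)
    (hy : (y : RSphere) ∉ range c) :
    IsLogVariation (fun t => ratio (c t) x y) 0 1 (loopVar c x y) := by
  have h := exists_isLogVariation (a := 0) (b := 1)
    (continuous_ratio_loop (x := x) hc hy).continuousOn fun t _ => ratio_loop_ne_zero hx hy t
  rw [loopVar, dif_pos h]
  exact h.choose_spec

theorem unitAddCircle_coe_one : ((1 : ℝ) : UnitAddCircle) = 0 := AddCircle.coe_period 1

theorem exp_loopVar (hc : Continuous c) (hx : (x : RSphere) ∉ range c)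
    (hy : (y : RSphere) ∉ range c) : Complex.exp (loopVar c x y) = 1 := by
  have h := (isLogVariation_loopVar hc hx hy).exp_mul
  rw [unitAddCircle_coe_one, AddCircle.coe_zero] at h
  exact mul_right_cancel₀ (ratio_loop_ne_zero hx hy 0) (h.trans (one_mul _).symm)

theorem sub_add_one_eq_of_exp_eq {φ : UnitAddCircle → ℂ} {g : ℝ → ℂ} (hg : Continuous g)
    (he : ∀ t : ℝ, Complex.exp (g t) = φ t) (a b : ℝ) : g (a + 1) - g a = g (b + 1) - g b :=
  eq_of_continuousOn_of_exp_eq (L := fun t => g (t + 1) - g t) (c := 1) isPreconnected_univ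
    (by fun_prop)
    (fun t _ => exp_sub_add_period (φ := fun t : ℝ => φ t) (T := 1) (fun t => by simp) he t)
    (mem_univ a) (mem_univ b)

theorem isLogVariation_loopVar_period (hc : Continuous c) (hx : (x : RSphere) ∉ range c)
    (hy : (y : RSphere) ∉ range c) (a : ℝ) :
    IsLogVariation (fun t => ratio (c t) x y) a (a + 1) (loopVar c x y) := by
  obtain ⟨g, hgc, hg, hvar⟩ :=
    exists_continuous_isLogVariation (continuous_ratio_loop (x := x) hc hy)
    fun t => ratio_loop_ne_zero hx hy t
  have hperiod := sub_add_one_eq_of_exp_eq (φ := fun s => ratio (c s) x y) hgc hg 0 a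
  rw [zero_add] at hperiod
  rw [(isLogVariation_loopVar hc hx hy).unique (hvar 0 1), hperiod]
  exact hvar a (a + 1)

theorem loopVar_add (hc : Continuous c) (hx : (x : RSphere) ∉ range c)
    (hy : (y : RSphere) ∉ range c) (hv : (v : RSphere) ∉ range c) :
    loopVar c x y + loopVar c y v = loopVar c x v :=
  (((isLogVariation_loopVar hc hx hy).mul (isLogVariation_loopVar hc hy hv)).congr fun _ _ =>
    ratio_mul_ratio fun h => hy ⟨_, h⟩).unique (isLogVariation_loopVar hc hx hv)

theorem loopVar_self (hc : Continuous c) (hx : (x : RSphere) ∉ range c) : loopVar c x x = 0 := by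
  simpa using loopVar_add hc hx hx hx

theorem loopVar_eq_of_homotopy {c : I → UnitAddCircle → RSphere} {x y : I → ℂ}
    (hc : Continuous fun p : I × UnitAddCircle => c p.1 p.2) (hx : Continuous x) (hy : Continuous y)
    (hxc : ∀ t, (x t : RSphere) ∉ range (c t)) (hyc : ∀ t, (y t : RSphere) ∉ range (c t)) :
    loopVar (c 0) (x 0) (y 0) = loopVar (c 1) (x 1) (y 1) := by
  have hct (t) : Continuous (c t) := hc.comp (by fun_prop : Continuous fun s => (t, s))
  refine eq_of_continuousOn_of_exp_eq (L := fun t => loopVar (c t) (x t) (y t)) (c := 1)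
    isPreconnected_univ (continuous_iff_continuousAt.2 fun t => ?_).continuousOn
    (fun t _ => exp_loopVar (hct t) (hxc t) (hyc t)) (mem_univ 0) (mem_univ 1)
  refine continuousAt_of_isLogVariation (Φ := fun t s => ratio (c t s) (x t) (y t)) (a := 0)
    (b := 1) (fun s _ => continuousAt_ratio ?_ (by fun_prop) (by fun_prop) fun h => hyc t ⟨_, h⟩)
    (Filter.Eventually.of_forall fun t => isLogVariation_loopVar (hct t) (hxc t) (hyc t))
  exact (hc.comp (continuous_fst.prodMk ((AddCircle.continuous_mk' 1).comp
    continuous_snd))).continuousAt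

theorem loopVar_eq_of_isPreconnected (hc : Continuous c) (hy : (y : RSphere) ∉ range c)
    {s : Set RSphere} (hs : IsPreconnected s) (hsc : ∀ z ∈ s, z ∉ range c)
    (hsi : OnePoint.infty ∉ s) {z w : RSphere} (hz : z ∈ s) (hw : w ∈ s) :
    loopVar c (finitePart z) y = loopVar c (finitePart w) y := by
  have hfin (z) (hz : z ∈ s) : z ≠ OnePoint.infty := fun h => hsi (h ▸ hz)
  refine eq_of_continuousOn_of_exp_eq hs (L := fun z => loopVar c (finitePart z) y) (c := 1)
    (fun z hz => ContinuousAt.continuousWithinAt ?_)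
    (fun z hz => exp_loopVar hc (by rw [coe_finitePart (hfin z hz)]; exact hsc z hz) hy) hz hw
  refine continuousAt_of_isLogVariation (Φ := fun z s => ratio (c s) (finitePart z) y) (a := 0)
    (b := 1) (fun s _ => continuousAt_ratio
      ((continuous_comp_coe_unitAddCircle hc).comp continuous_snd).continuousAt
      (ContinuousAt.comp (g := finitePart) (continuousAt_finitePart (hfin z hz))
        continuous_fst.continuousAt) continuousAt_const fun h => hy ⟨_, h⟩) ?_
  filter_upwards [(isCompact_range hc).isClosed.isOpen_compl.mem_nhds (hsc z hz),
    isOpen_ne.mem_nhds (hfin z hz)] with w hw hwi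
  exact isLogVariation_loopVar hc (by rwa [coe_finitePart hwi]) hy

end LoopVar

/-! ### Complementary components of a Jordan curve -/

theorem unitAddCircle_coe_eq_iff {s t : ℝ} :
    (s : UnitAddCircle) = t ↔ ∃ n : ℤ, s = t + n := by
  simp only [← sub_eq_zero (b := (t : UnitAddCircle)), ← AddCircle.coe_sub,
    AddCircle.coe_eq_zero_iff, zsmul_eq_mul, mul_one, eq_sub_iff_add_eq', eq_comm (a := s)]

theorem unitAddCircle_exists_coe_eq (a : ℝ) (s : UnitAddCircle) :
    ∃ t ∈ Ico a (a + 1), (t : UnitAddCircle) = s := by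
  have : Fact ((0 : ℝ) < 1) := ⟨one_pos⟩
  exact ⟨_, (AddCircle.equivIco 1 a s).2, AddCircle.coe_equivIco⟩

theorem int_eq_zero_of_abs_cast_lt_one {n : ℤ} (h : |(n : ℝ)| < 1) : n = 0 :=
  Int.abs_lt_one_iff.1 (by exact_mod_cast h)

theorem isClosed_image_Icc {Y : Type*} [TopologicalSpace Y] [T2Space Y] {γ : UnitAddCircle → Y}
    (hγ : Continuous γ) (a b : ℝ) : IsClosed ((fun t : ℝ => γ t) '' Icc a b) :=
  (isCompact_Icc.image (continuous_comp_coe_unitAddCircle hγ)).isClosed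

theorem isPreconnected_compl_of_finite {V : Set RSphere} (hV : V.Finite) : IsPreconnected Vᶜ := by
  let V' : Set ℂ := (↑) ⁻¹' V
  have hV' : V'.Countable := (hV.preimage OnePoint.coe_injective.injOn).countable
  have hpre : IsPreconnected V'ᶜ := (hV'.isConnected_compl_of_one_lt_rank (by simp)).isPreconnected
  have hdense : Dense ((↑) '' V'ᶜ : Set RSphere) :=
    OnePoint.denseRange_coe.dense_image OnePoint.continuous_coe (hV'.dense_compl ℝ)
  refine (hpre.image ((↑) : ℂ → RSphere) OnePoint.continuous_coe.continuousOn).subset_closure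
    (image_subset_iff.2 fun z hz => hz) ?_
  rw [hdense.closure_eq]
  exact subset_univ _

namespace IsOrientedJordanCurve

variable {C : Set RSphere} {γ : UnitAddCircle → RSphere}

theorem eq_iff (h : IsOrientedJordanCurve C γ) {s t : ℝ} :
    γ (s : UnitAddCircle) = γ (t : UnitAddCircle) ↔ ∃ n : ℤ, s = t + n := by
  rw [h.injective.eq_iff, unitAddCircle_coe_eq_iff]

theorem exists_eq (h : IsOrientedJordanCurve C γ) (a : ℝ) {z : RSphere} (hz : z ∈ C) :
    ∃ t ∈ Ico a (a + 1), γ (t : UnitAddCircle) = z := by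
  rw [← h.range_eq] at hz
  obtain ⟨s, rfl⟩ := hz
  obtain ⟨t, ht, rfl⟩ := unitAddCircle_exists_coe_eq a s
  exact ⟨t, ht, rfl⟩

theorem mem (h : IsOrientedJordanCurve C γ) (t : UnitAddCircle) : γ t ∈ C :=
  h.range_eq ▸ mem_range_self t

theorem isClosed (h : IsOrientedJordanCurve C γ) : IsClosed C :=
  h.range_eq ▸ (isCompact_range h.continuous).isClosed

theorem isClosedEmbedding (h : IsOrientedJordanCurve C γ) : IsClosedEmbedding γ :=
  h.continuous.isClosedEmbedding h.injective

theorem continuous_lift (h : IsOrientedJordanCurve C γ) : Continuous fun t : ℝ => γ t :=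
  continuous_comp_coe_unitAddCircle h.continuous

theorem notMem_range (h : IsOrientedJordanCurve C γ) {z : RSphere} (hz : z ∉ C) : z ∉ range γ := by
  rwa [h.range_eq]

theorem injOn_lift (h : IsOrientedJordanCurve C γ) {a b : ℝ} (hab : b - a < 1) :
    InjOn (fun t : ℝ => γ t) (Icc a b) := by
  intro s hs t ht hst
  obtain ⟨n, hn⟩ := h.eq_iff.1 hst
  have : n = 0 := int_eq_zero_of_abs_cast_lt_one
    (abs_lt.2 ⟨by linarith [hs.1, ht.2], by linarith [hs.2, ht.1]⟩)
  simpa [this] using hn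

theorem ne_of_mem_Ioo (h : IsOrientedJordanCurve C γ) {s t : ℝ} (ht : t ∈ Ioo s (s + 1)) :
    γ (t : UnitAddCircle) ≠ γ (s : UnitAddCircle) := fun heq => by
  obtain ⟨n, rfl⟩ := h.eq_iff.1 heq
  have h0 : 0 < n := by exact_mod_cast (lt_add_iff_pos_right s).1 ht.1
  have h1 : n < 1 := by exact_mod_cast (add_lt_add_iff_left s).1 ht.2
  omega

theorem comp_homeomorph (h : IsOrientedJordanCurve C γ) (κ : RSphere ≃ₜ RSphere) :
    IsOrientedJordanCurve (κ '' C) (κ ∘ γ) :=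
  ⟨κ.continuous.comp h.continuous, κ.injective.comp h.injective, by rw [range_comp, h.range_eq]⟩

theorem exists_continuous_exp_eq_of_isLogVariation_zero (h : IsOrientedJordanCurve C γ)
    {φ : RSphere → ℂ} (hφ : Continuous fun t : ℝ => φ (γ t)) (h0 : ∀ t : ℝ, φ (γ t) ≠ 0)
    (hv : IsLogVariation (fun t => φ (γ t)) 0 1 0) :
    ∃ g : RSphere → ℂ, Continuous g ∧ ∀ z ∈ C, Complex.exp (g z) = φ z := by
  obtain ⟨g, hgc, hg, hgv⟩ := exists_continuous_isLogVariation hφ h0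
  have hper : Function.Periodic g 1 := fun t => by
    have hconst := sub_add_one_eq_of_exp_eq (φ := φ ∘ γ) hgc hg t 0
    rw [zero_add, (hgv 0 1).unique hv] at hconst
    exact sub_eq_zero.1 hconst
  obtain ⟨G, hG⟩ := ContinuousMap.exists_extension' h.isClosedEmbedding
    (⟨hper.lift, continuous_quot_lift _ hgc⟩ : C(UnitAddCircle, ℂ))
  refine ⟨G, G.continuous, fun z hz => ?_⟩
  obtain ⟨t, -, rfl⟩ := h.exists_eq 0 hz
  have hGt : G (γ t) = g t := congrFun hG (t : UnitAddCircle)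
  rw [hGt, hg]

theorem mem_connectedComponentIn_of_loopVar_eq_zero (h : IsOrientedJordanCurve C γ) {x y : ℂ}
    (hx : (x : RSphere) ∉ C) (hy : (y : RSphere) ∉ C) (hv : loopVar γ x y = 0) :
    (y : RSphere) ∈ connectedComponentIn Cᶜ (x : RSphere) := by
  by_contra hyU
  have hxr := h.notMem_range hx
  have hyr := h.notMem_range hy
  obtain ⟨g, hgc, hg⟩ := h.exists_continuous_exp_eq_of_isLogVariation_zero
    (φ := fun z => ratio z x y) (continuous_ratio_loop h.continuous hyr)
    (fun t => ratio_loop_ne_zero hxr hyr t) (hv ▸ isLogVariation_loopVar h.continuous hxr hyr)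
  have := eq_zero_of_ratio_zpow_mul_eq_exp h.isClosed hx hy hyU (h := fun _ => 1)
    continuousOn_const (fun _ _ => one_ne_zero) hgc (k := 1)
    fun z hz => by simp [hg z hz]
  omega

/-- If `x` is in neither component, the winding differences are `2πim` for `x, y` and `2πin` for
`y, v`, so `((z - x) / (z - y)) ^ n * ((z - y) / (z - v)) ^ (-m)` has a logarithm on the curve,
which forces `n = 0`. -/
theorem mem_connectedComponentIn_of_notMem (h : IsOrientedJordanCurve C γ) {x y v : ℂ}
    (hx : (x : RSphere) ∉ C) (hy : (y : RSphere) ∉ C) (hv : (v : RSphere) ∉ C)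
    (hxy : (y : RSphere) ∉ connectedComponentIn Cᶜ (x : RSphere))
    (hxv : (v : RSphere) ∉ connectedComponentIn Cᶜ (x : RSphere)) :
    (v : RSphere) ∈ connectedComponentIn Cᶜ (y : RSphere) := by
  have hxr := h.notMem_range hx
  have hyr := h.notMem_range hy
  have hvr := h.notMem_range hv
  have hclosure {z w : RSphere} (hw : w ∉ C) (hw' : w ∉ connectedComponentIn Cᶜ (x : RSphere))
      (hz : z ∈ closure (connectedComponentIn Cᶜ (x : RSphere))) : z ≠ w := fun e =>
    hw' (closure_connectedComponentIn_inter_subset hx ⟨e ▸ hz, hw⟩)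
  obtain ⟨m, hm⟩ := Complex.exp_eq_one_iff.1 (exp_loopVar h.continuous hxr hyr)
  obtain ⟨n, hn⟩ := Complex.exp_eq_one_iff.1 (exp_loopVar h.continuous hyr hvr)
  have hvar := ((isLogVariation_loopVar h.continuous hxr hyr).zpow n).mul
    ((isLogVariation_loopVar h.continuous hyr hvr).zpow (-m))
  have hvar0 : (n : ℂ) * loopVar γ x y + ((-m : ℤ) : ℂ) * loopVar γ y v = 0 := by
    rw [hm, hn]; push_cast; ring
  rw [hvar0] at hvar
  obtain ⟨g, hgc, hg⟩ := h.exists_continuous_exp_eq_of_isLogVariation_zero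
    (φ := fun z => ratio z x y ^ n * ratio z y v ^ (-m))
    (((continuous_ratio_loop h.continuous hyr).zpow₀ n
      fun t => Or.inl (ratio_loop_ne_zero hxr hyr t)).mul
      ((continuous_ratio_loop h.continuous hvr).zpow₀ (-m)
      fun t => Or.inl (ratio_loop_ne_zero hyr hvr t)))
    (fun t => mul_ne_zero (zpow_ne_zero _ (ratio_loop_ne_zero hxr hyr t))
      (zpow_ne_zero _ (ratio_loop_ne_zero hyr hvr t))) hvar
  have hne (z) (hz : z ∈ closure (connectedComponentIn Cᶜ (x : RSphere))) : ratio z y v ≠ 0 :=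
    ratio_ne_zero (hclosure hy hxy hz) (hclosure hv hxv hz)
  have hn0 : n = 0 := eq_zero_of_ratio_zpow_mul_eq_exp h.isClosed hx hy hxy
    (h := fun z => ratio z y v ^ (-m)) (fun z hz => ((continuousAt_ratio continuousAt_id
      continuousAt_const continuousAt_const (hclosure hv hxv hz)).zpow₀ _
      (Or.inl (hne z hz))).continuousWithinAt)
    (fun z hz => zpow_ne_zero _ (hne z hz)) hgc fun z hz => (hg z hz).symm
  exact h.mem_connectedComponentIn_of_loopVar_eq_zero hy hv (by simp [hn, hn0])

theorem loopVar_eq_of_mem_connectedComponentIn (h : IsOrientedJordanCurve C γ)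
    (hi : OnePoint.infty ∈ C) {y : ℂ} (hy : (y : RSphere) ∉ C) {z w : RSphere} (hz : z ∉ C)
    (hw : w ∈ connectedComponentIn Cᶜ z) :
    loopVar γ (finitePart z) y = loopVar γ (finitePart w) y :=
  loopVar_eq_of_isPreconnected h.continuous (h.notMem_range hy)
    isPreconnected_connectedComponentIn
    (fun _ hv => h.notMem_range (connectedComponentIn_subset _ _ hv))
    (fun hc => connectedComponentIn_subset Cᶜ z hc hi) (mem_connectedComponentIn hz) hw

theorem image_Icc_union (h : IsOrientedJordanCurve C γ) {a b : ℝ} (hab : a ≤ b)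
    (hba : b ≤ a + 1) :
    (fun t : ℝ => γ t) '' Icc a b ∪ (fun t : ℝ => γ t) '' Icc b (a + 1) = C := by
  rw [← image_union, Icc_union_Icc_eq_Icc hab hba]
  refine Subset.antisymm (image_subset_iff.2 fun t _ => h.mem t) fun z hz => ?_
  obtain ⟨t, ht, rfl⟩ := h.exists_eq a hz
  exact ⟨t, Ico_subset_Icc_self ht, rfl⟩

theorem image_Icc_inter_subset (h : IsOrientedJordanCurve C γ) {a b : ℝ} :
    (fun t : ℝ => γ t) '' Icc a b ∩ (fun t : ℝ => γ t) '' Icc b (a + 1) ⊆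
      {γ (a : UnitAddCircle), γ (b : UnitAddCircle)} := by
  rintro _ ⟨⟨s, ⟨has, hsb⟩, rfl⟩, t, ⟨hbt, hta⟩, hst⟩
  obtain ⟨n, hn⟩ := h.eq_iff.1 hst
  have h0 : 0 ≤ n := by exact_mod_cast (by linarith : (0 : ℝ) ≤ n)
  have h1 : n ≤ 1 := by exact_mod_cast (by linarith : (n : ℝ) ≤ 1)
  obtain rfl | rfl : n = 0 ∨ n = 1 := by omega
  · obtain rfl : s = b := by push_cast at hn; linarith
    exact Or.inr rfl
  · obtain rfl : s = a := by push_cast at hn; linarith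
    exact Or.inl rfl

theorem exists_notMem (h : IsOrientedJordanCurve C γ) : ∃ z, z ∉ C := by
  by_contra! hC
  let V : Set RSphere := {γ ((0 : ℝ) : UnitAddCircle), γ ((1 / 2 : ℝ) : UnitAddCircle)}
  have hV : V.Finite := toFinite _
  have hmeets {a b : ℝ} (hab : a < b) (hba : b - a < 1) :
      (Vᶜ ∩ (fun t : ℝ => γ t) '' Icc a b).Nonempty := by
    rw [inter_comm]
    exact (((Icc_infinite hab).image (h.injOn_lift hba)).sdiff hV).nonempty
  have hunion := h.image_Icc_union (a := 0) (b := 1 / 2) (by norm_num) (by norm_num)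
  obtain ⟨z, hzV, hz⟩ := isPreconnected_closed_iff.1 (isPreconnected_compl_of_finite hV) _ _
    (isClosed_image_Icc h.continuous 0 (1 / 2)) (isClosed_image_Icc h.continuous (1 / 2) (0 + 1))
    (fun z _ => hunion.symm ▸ hC z)
    (hmeets (by norm_num) (by norm_num)) (hmeets (by norm_num) (by norm_num))
  exact hzV (h.image_Icc_inter_subset hz)

end IsOrientedJordanCurve

theorem exists_continuousAt_of_eq_off_union {X Y : Type*} [TopologicalSpace X] [TopologicalSpace Y]
    {A B : Set X} (hA : IsClosed A) (hB : IsClosed B) {u v : X → Y}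
    (hu : ∀ z ∉ A, ContinuousAt u z) (hv : ∀ z ∉ B, ContinuousAt v z)
    (huv : ∀ z ∉ A ∪ B, u z = v z) :
    ∃ w : X → Y, (∀ z ∉ A ∩ B, ContinuousAt w z) ∧ EqOn w u Aᶜ ∧ EqOn w v Bᶜ := by
  classical
  have hwu : EqOn (A.piecewise v u) u Aᶜ := piecewise_eqOn_compl A v u
  have hwv : EqOn (A.piecewise v u) v Bᶜ := fun z hzB => by
    by_cases hzA : z ∈ A
    · exact piecewise_eq_of_mem _ _ _ hzA
    · exact (hwu hzA).trans (huv z (not_or.2 ⟨hzA, hzB⟩))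
  refine ⟨A.piecewise v u, fun z hz => ?_, hwu, hwv⟩
  rcases not_and_or.1 hz with hzA | hzB
  · exact (hu z hzA).congr (hwu.eventuallyEq_of_mem (hA.isOpen_compl.mem_nhds hzA)).symm
  · exact (hv z hzB).congr (hwv.eventuallyEq_of_mem (hB.isOpen_compl.mem_nhds hzB)).symm

theorem exp_ne_const_mul_sub_div_sub {a b K : ℂ} (hab : a ≠ b) {G : ℂ → ℂ}
    (hG : ∀ z ∉ ({a, b} : Set ℂ), ContinuousAt G z) :
    ∃ z ∉ ({a, b} : Set ℂ), Complex.exp (G z) ≠ K * ((z - b) / (z - a)) := by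
  by_contra! he
  have hba : b - a ≠ 0 := sub_ne_zero.2 hab.symm
  have hr : 0 < ‖b - a‖ / 2 := by positivity
  have hratio (z) (hz : z ∈ Metric.sphere b (‖b - a‖ / 2)) :
      (z - a) / (b - a) ∈ Complex.slitPlane := by
    have hnorm : ‖(z - b) / (b - a)‖ = 1 / 2 := by
      rw [norm_div, mem_sphere_iff_norm.1 hz, div_div, mul_comm, ← div_div,
        div_self (norm_ne_zero_iff.2 hba)]
    have heq : (z - a) / (b - a) = 1 + (z - b) / (b - a) := by field_simp; ring
    exact heq ▸ Complex.mem_slitPlane_of_norm_lt_one (hnorm ▸ by norm_num)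
  have hza (z) (hz : z ∈ Metric.sphere b (‖b - a‖ / 2)) : z - a ≠ 0 := fun h =>
    Complex.slitPlane_ne_zero (hratio z hz) (by rw [h, zero_div])
  have hmem (z) (hz : z ∈ Metric.sphere b (‖b - a‖ / 2)) : z ∉ ({a, b} : Set ℂ) := by
    rintro (rfl | rfl)
    · exact hza _ hz (sub_self _)
    · exact hr.ne (by simpa using hz)
  have := eq_zero_of_exp_eq_mul_zpow_on_sphere (c := b) (K := K / (b - a)) hr
    (G := fun z => G z + Complex.log ((z - a) / (b - a))) (k := 1)
    (fun z hz => ((hG z (hmem z hz)).add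
      (ContinuousAt.clog (by fun_prop) (hratio z hz))).continuousWithinAt) fun z hz => by
      have := hza z hz
      rw [Complex.exp_add, he z (hmem z hz), Complex.exp_log (div_ne_zero (hza z hz) hba)]
      field_simp
  omega

namespace IsOrientedJordanCurve

variable {C : Set RSphere} {γ : UnitAddCircle → RSphere}

theorem exists_isLogVariation_arc (h : IsOrientedJordanCurve C γ) {a b : ℝ} (hab : a ≤ b) {y : ℂ}
    (hy : (y : RSphere) ∉ C) :
    ∃ L : ℂ → ℂ, ∀ z : ℂ, (z : RSphere) ∉ (fun t : ℝ => γ t) '' Icc a b →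
      IsLogVariation (fun t => ratio (γ t) z y) a b (L z) ∧ ContinuousAt L z := by
  have hexists (z : ℂ) (hz : (z : RSphere) ∉ (fun t : ℝ => γ t) '' Icc a b) :
      ∃ L, IsLogVariation (fun t => ratio (γ t) z y) a b L := by
    refine exists_isLogVariation (continuous_ratio_loop h.continuous
      (h.notMem_range hy)).continuousOn fun t ht => ratio_ne_zero (fun e => hz ?_)
      (fun e => hy (e ▸ h.mem _))
    rw [uIcc_of_le hab] at ht
    exact ⟨t, ht, e⟩
  choose! L hL using hexists
  refine ⟨L, fun z hz => ⟨hL z hz, ?_⟩⟩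
  have hnear : ∀ᶠ w : ℂ in 𝓝 z, (w : RSphere) ∉ (fun t : ℝ => γ t) '' Icc a b :=
    OnePoint.continuous_coe.continuousAt.eventually
      ((isClosed_image_Icc h.continuous a b).isOpen_compl.mem_nhds hz)
  exact continuousAt_of_isLogVariation (Φ := fun z t => ratio (γ t) z y) (a := a) (b := b)
    (fun s _ => continuousAt_ratio (u := fun p : ℂ × ℝ => γ p.2)
      (h.continuous_lift.comp continuous_snd).continuousAt
      continuousAt_fst continuousAt_const fun e => hy (e ▸ h.mem _))
    (hnear.mono fun w hw => hL w hw)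

theorem exists_coe_eq_add (h : IsOrientedJordanCurve C γ) {s r : ℝ}
    (hs : γ (s : UnitAddCircle) = OnePoint.infty) (h0 : 0 < r) (h1 : r < 1) :
    ∃ a : ℂ, γ ((s + r : ℝ) : UnitAddCircle) = a := by
  refine ⟨_, (coe_finitePart fun e => ?_).symm⟩
  obtain ⟨n, hn⟩ := h.eq_iff.1 (e.trans hs.symm)
  have hrn : r = n := by linarith
  have : n = 0 := int_eq_zero_of_abs_cast_lt_one (hrn ▸ abs_lt.2 ⟨by linarith, h1⟩)
  simp [this, h0.ne'] at hrn

theorem exists_log_of_loopVar_eq_zero (h : IsOrientedJordanCurve C γ) {y : ℂ}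
    (hy : (y : RSphere) ∉ C) (hzero : ∀ z : ℂ, (z : RSphere) ∉ C → loopVar γ z y = 0) {s t : ℝ}
    (hst : s ≤ t) (hts : t ≤ s + 1) {a b : ℂ} (ha : γ (s : UnitAddCircle) = a)
    (hb : γ (t : UnitAddCircle) = b) :
    ∃ G : ℂ → ℂ, ∀ z ∉ ({a, b} : Set ℂ), ContinuousAt G z ∧
      Complex.exp (G z) = (a - y) / (b - y) * ((z - b) / (z - a)) := by
  have hay : a - y ≠ 0 := sub_ne_zero.2 fun e => hy (e ▸ ha ▸ h.mem _)
  have hby : b - y ≠ 0 := sub_ne_zero.2 fun e => hy (e ▸ hb ▸ h.mem _)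
  let A : Set ℂ := (↑) ⁻¹' ((fun t : ℝ => γ t) '' Icc s t)
  let B : Set ℂ := (↑) ⁻¹' ((fun t : ℝ => γ t) '' Icc t (s + 1))
  have hAB (z : ℂ) : z ∈ A ∪ B ↔ (z : RSphere) ∈ C := Set.ext_iff.1 (h.image_Icc_union hst hts) z
  have hinter : A ∩ B ⊆ {a, b} := fun z hz => by
    simpa [ha, hb] using h.image_Icc_inter_subset hz
  obtain ⟨LA, hLA⟩ := h.exists_isLogVariation_arc hst hy
  obtain ⟨LB, hLB⟩ := h.exists_isLogVariation_arc hts hy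
  have hsum (z) (hz : z ∉ A ∪ B) : LA z = -LB z := by
    have hzC := (hAB z).not.1 hz
    have hperiod := ((hLA z fun hc => hz (Or.inl hc)).1.trans
      (continuous_ratio_loop h.continuous (h.notMem_range hy))
      (ratio_loop_ne_zero (h.notMem_range hzC) (h.notMem_range hy) ·)
      (hLB z fun hc => hz (Or.inr hc)).1).unique
      (isLogVariation_loopVar_period h.continuous (h.notMem_range hzC) (h.notMem_range hy) s)
    exact eq_neg_of_add_eq_zero_left (hperiod.trans (hzero z hzC))
  obtain ⟨G, hGc, hGA, hGB⟩ := exists_continuousAt_of_eq_off_union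
    ((isClosed_image_Icc h.continuous _ _).preimage OnePoint.continuous_coe)
    ((isClosed_image_Icc h.continuous _ _).preimage OnePoint.continuous_coe)
    (fun z hz => (hLA z hz).2) (fun z hz => (hLB z hz).2.neg) hsum
  refine ⟨G, fun z hz => ⟨hGc z fun hc => hz (hinter hc), ?_⟩⟩
  have hza : a - z ≠ 0 := sub_ne_zero.2 (Ne.symm (not_or.1 hz).1)
  have hzb : b - z ≠ 0 := sub_ne_zero.2 (Ne.symm (not_or.1 hz).2)
  rw [← neg_sub b z, ← neg_sub a z, neg_div_neg_eq]
  rcases not_and_or.1 fun hc => hz (hinter hc) with hzA | hzB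
  · have hexp := (hLA z hzA).1.exp_mul
    rw [ha, hb, ratio_coe, ratio_coe] at hexp
    rw [hGA hzA]
    field_simp at hexp ⊢
    linear_combination hexp
  · have hexp := (hLB z hzB).1.exp_mul
    rw [AddCircle.coe_add, unitAddCircle_coe_one, add_zero, ha, hb, ratio_coe, ratio_coe] at hexp
    rw [hGB hzB, Pi.neg_apply, Complex.exp_neg, inv_eq_iff_eq_inv]
    field_simp at hexp ⊢
    linear_combination hexp

/-- Cut `C` at two finite points `a`, `b`. If all winding differences vanish, the logarithmic
variations along the two arcs glue to a logarithm of a multiple of `(z - b) / (z - a)` on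
`ℂ \ {a, b}`. -/
theorem exists_loopVar_ne_zero (h : IsOrientedJordanCurve C γ) (hi : OnePoint.infty ∈ C) :
    ∃ x y : ℂ, (x : RSphere) ∉ C ∧ (y : RSphere) ∉ C ∧ loopVar γ x y ≠ 0 := by
  by_contra! hzero
  obtain ⟨y, hy⟩ : ∃ y : ℂ, (y : RSphere) ∉ C := by
    obtain ⟨z, hz⟩ := h.exists_notMem
    lift z to ℂ using fun e => hz (e ▸ hi)
    exact ⟨z, hz⟩
  obtain ⟨s₀, -, hs₀⟩ := h.exists_eq 0 hi
  obtain ⟨s, t, hst, hts, ⟨a, ha⟩, ⟨b, hb⟩⟩ : ∃ s t : ℝ, s < t ∧ t < s + 1 ∧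
      (∃ a : ℂ, γ (s : UnitAddCircle) = a) ∧ ∃ b : ℂ, γ (t : UnitAddCircle) = b :=
    ⟨s₀ + 1 / 3, s₀ + 2 / 3, by linarith, by linarith,
      h.exists_coe_eq_add hs₀ (by norm_num) (by norm_num),
      h.exists_coe_eq_add hs₀ (by norm_num) (by norm_num)⟩
  have hab : a ≠ b := fun e => hst.ne <|
    h.injOn_lift (by linarith) ⟨le_rfl, hst.le⟩ ⟨hst.le, le_rfl⟩ (by simp only [ha, hb, e])
  obtain ⟨G, hG⟩ := h.exists_log_of_loopVar_eq_zero hy (fun z hz => hzero z y hz hy)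
    hst.le hts.le ha hb
  obtain ⟨z, hz, hzG⟩ := exp_ne_const_mul_sub_div_sub hab fun z hz => (hG z hz).1
  exact hzG (hG z hz).2

theorem exists_notMem_connectedComponentIn (h : IsOrientedJordanCurve C γ)
    (hi : OnePoint.infty ∈ C) (z : RSphere) :
    ∃ w ∉ C, w ∉ connectedComponentIn Cᶜ z := by
  obtain ⟨x, y, hx, hy, hxy⟩ := h.exists_loopVar_ne_zero hi
  by_contra! hcon
  have hz : z ∉ C := fun hz => by
    have hempty : connectedComponentIn Cᶜ z = ∅ := connectedComponentIn_eq_empty fun hc => hc hz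
    exact notMem_empty _ (hempty ▸ hcon x hx)
  have hxz := h.loopVar_eq_of_mem_connectedComponentIn hi hy hz (hcon x hx)
  have hyz := h.loopVar_eq_of_mem_connectedComponentIn hi hy hz (hcon y hy)
  exact hxy ((hxz.symm.trans hyz).trans (loopVar_self h.continuous (h.notMem_range hy)))

theorem mem_connectedComponentIn_compl_arc (h : IsOrientedJordanCurve C γ) {a b : ℝ}
    (hba : b - a < 1) {x y : RSphere} (hi : OnePoint.infty ∈ C) (hx : x ∉ C) (hy : y ∉ C) :
    y ∈ connectedComponentIn ((fun t : ℝ => γ t) '' Icc a b)ᶜ x := by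
  lift x to ℂ using fun e => hx (e ▸ hi)
  lift y to ℂ using fun e => hy (e ▸ hi)
  by_contra hyU
  have hsub : (fun t : ℝ => γ t) '' Icc a b ⊆ C := image_subset_iff.2 fun t _ => h.mem t
  obtain ⟨g, hgc, hg, -⟩ := exists_continuous_isLogVariation
    (continuous_ratio_loop (x := x) h.continuous (h.notMem_range hy))
    (ratio_loop_ne_zero (h.notMem_range hx) (h.notMem_range hy) ·)
  have hemb : IsClosedEmbedding (fun t : Icc a b => γ ((t : ℝ) : UnitAddCircle)) :=
    (h.continuous_lift.comp continuous_subtype_val).isClosedEmbedding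
      (injOn_iff_injective.1 (h.injOn_lift hba))
  obtain ⟨G, hG⟩ := ContinuousMap.exists_extension' hemb
    (⟨fun t => g t, hgc.comp continuous_subtype_val⟩ : C(Icc a b, ℂ))
  have := eq_zero_of_ratio_zpow_mul_eq_exp (isClosed_image_Icc h.continuous a b)
    (fun hc => hx (hsub hc)) (fun hc => hy (hsub hc)) hyU (h := fun _ => 1)
    continuousOn_const (fun _ _ => one_ne_zero) G.continuous (k := 1) (by
      rintro _ ⟨t, ht, rfl⟩
      have hGt : G (γ t) = g t := congrFun hG ⟨t, ht⟩
      simp [hGt, hg])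
  omega

theorem exists_arc_disjoint_closure (h : IsOrientedJordanCurve C γ) {p : RSphere} (hp : p ∈ C)
    {U : Set RSphere} (hpU : p ∉ closure U) :
    ∃ a b : ℝ, b - a < 1 ∧ C \ (fun t : ℝ => γ t) '' Icc a b ⊆ (closure U)ᶜ := by
  obtain ⟨t₀, -, rfl⟩ := h.exists_eq 0 hp
  obtain ⟨δ, hδ, hδU⟩ := Metric.eventually_nhds_iff.1 <|
    h.continuous_lift.continuousAt.eventually (isClosed_closure.isOpen_compl.mem_nhds hpU)
  refine ⟨t₀ + δ / 2, t₀ + 1 - δ / 2, by linarith, fun z ⟨hzC, hzA⟩ => ?_⟩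
  obtain ⟨t, ⟨ht₁, ht₂⟩, rfl⟩ := h.exists_eq (t₀ - δ / 2) hzC
  have ht : t < t₀ + δ / 2 := by
    by_contra! hle
    exact hzA ⟨t, ⟨hle, by linarith⟩, rfl⟩
  exact hδU (by rw [Real.dist_eq, abs_lt]; constructor <;> linarith)

/-- If `p` were not in the closure of the component, the rest of `C` would be a proper subarc
that separates the sphere. -/
theorem mem_closure_connectedComponentIn (h : IsOrientedJordanCurve C γ)
    (hi : OnePoint.infty ∈ C) {p z : RSphere} (hp : p ∈ C) (hz : z ∉ C) :
    p ∈ closure (connectedComponentIn Cᶜ z) := by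
  by_contra hpU
  obtain ⟨w, hw, hwU⟩ := h.exists_notMem_connectedComponentIn hi z
  obtain ⟨a, b, hab, hC⟩ := h.exists_arc_disjoint_closure hp hpU
  have hzA : z ∉ (fun t : ℝ => γ t) '' Icc a b := fun ⟨t, _, e⟩ => hz (e ▸ h.mem t)
  refine hwU (isPreconnected_connectedComponentIn.subset_left_of_subset_union
    h.isClosed.isOpen_compl.connectedComponentIn isClosed_closure.isOpen_compl
    (disjoint_compl_right_iff_subset.2 subset_closure) (fun v hv => ?_)
    ⟨z, mem_connectedComponentIn hzA, mem_connectedComponentIn hz⟩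
    (h.mem_connectedComponentIn_compl_arc hab hi hz hw))
  by_cases hvC : v ∈ C
  · exact Or.inr (hC ⟨hvC, connectedComponentIn_subset _ _ hv⟩)
  · exact or_iff_not_imp_right.2 fun hvU =>
      closure_connectedComponentIn_inter_subset hz ⟨not_not.1 hvU, hvC⟩

end IsOrientedJordanCurve

/-! ### Rational maps in homogeneous coordinates -/

open Classical in
/-- The point of the sphere with homogeneous coordinates `[a : b]`. -/
noncomputable def homPoint (a b : ℂ) : RSphere :=
  if b = 0 then OnePoint.infty else ((a / b : ℂ) : RSphere)

theorem homPoint_of_ne_zero (a : ℂ) {b : ℂ} (hb : b ≠ 0) :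
    homPoint a b = ((a / b : ℂ) : RSphere) := if_neg hb

@[simp] theorem homPoint_zero (a : ℂ) : homPoint a 0 = OnePoint.infty := if_pos rfl

theorem homPoint_eq_infty_iff {a b : ℂ} : homPoint a b = OnePoint.infty ↔ b = 0 := by
  constructor
  · intro h
    by_contra hb
    rw [homPoint_of_ne_zero a hb] at h
    exact OnePoint.coe_ne_infty _ h
  · rintro rfl
    simp

theorem homPoint_mul_left {c : ℂ} (hc : c ≠ 0) (a b : ℂ) :
    homPoint (c * a) (c * b) = homPoint a b := by
  rcases eq_or_ne b 0 with rfl | hb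
  · simp
  · rw [homPoint_of_ne_zero _ (mul_ne_zero hc hb), homPoint_of_ne_zero _ hb,
      mul_div_mul_left _ _ hc]

theorem sphereInv_homPoint {a b : ℂ} (h : a ≠ 0 ∨ b ≠ 0) :
    sphereInv (homPoint a b) = homPoint b a := by
  rcases eq_or_ne b 0 with rfl | hb
  · simp [homPoint_of_ne_zero 0 (h.resolve_right (by simp))]
  · rcases eq_or_ne a 0 with rfl | ha
    · simp [homPoint_of_ne_zero _ hb]
    · rw [homPoint_of_ne_zero _ hb, homPoint_of_ne_zero _ ha, sphereInv_coe (div_ne_zero ha hb),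
        inv_div]

theorem sphereTranslate_homPoint (v a b : ℂ) :
    sphereTranslate v (homPoint a b) = homPoint (a + v * b) b := by
  rcases eq_or_ne b 0 with rfl | hb
  · simp
  · rw [homPoint_of_ne_zero _ hb, homPoint_of_ne_zero _ hb, sphereTranslate_coe]
    congr 1
    field_simp

/-- `f` is given in homogeneous coordinates by two forms of degree `d` without common zeros, whose
dehomogenizations are `p` and `q`. -/
structure IsRatPair (f : RSphere → RSphere) (d : ℕ) (p q : ℂ[X]) : Prop where
  natDegree_left : p.natDegree ≤ d
  natDegree_right : q.natDegree ≤ d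
  eval_ne_zero : ∀ z, p.eval z ≠ 0 ∨ q.eval z ≠ 0
  coeff_ne_zero : p.coeff d ≠ 0 ∨ q.coeff d ≠ 0
  apply_coe : ∀ z : ℂ, f z = homPoint (p.eval z) (q.eval z)
  apply_infty : f OnePoint.infty = homPoint (p.coeff d) (q.coeff d)

/-- `f` is given by some pair of forms of degree `d` without common zeros. -/
def HasRatPair (f : RSphere → RSphere) (d : ℕ) : Prop := ∃ p q, IsRatPair f d p q

theorem IsRationalMapOfDegree.hasRatPair {f : RSphere → RSphere} {d : ℕ}
    (hf : IsRationalMapOfDegree f d) (hd : 1 ≤ d) : HasRatPair f d := by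
  obtain ⟨p, q, hpq, hdeg, hz, h1, h2⟩ := hf
  refine ⟨p, q, hdeg ▸ le_max_left _ _, hdeg ▸ le_max_right _ _, fun z => ?_, ?_, fun z => ?_, ?_⟩
  · by_contra! h
    obtain ⟨a, b, hab⟩ := hpq
    have := congrArg (Polynomial.eval z) hab
    simp [h.1, h.2] at this
  · rcases max_choice p.natDegree q.natDegree with h | h
    · left
      rw [hdeg, h, coeff_natDegree, Ne, leadingCoeff_eq_zero]
      rintro rfl
      simp at h hdeg
      omega
    · right
      rw [hdeg, h, coeff_natDegree, Ne, leadingCoeff_eq_zero]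
      rintro rfl
      simp at h hdeg
      omega
  · by_cases hq : q.eval z = 0
    · rw [(hz z).2 hq, hq, homPoint_zero]
    · rw [(hz z).1 hq, homPoint_of_ne_zero _ hq]
  · by_cases hq : q.coeff d = 0
    · rw [h2 hq, hq, homPoint_zero]
    · rw [h1 hq, homPoint_of_ne_zero _ hq]

theorem eval_reflect {d : ℕ} {p : ℂ[X]} (hp : p.natDegree ≤ d) {z : ℂ} (hz : z ≠ 0) :
    (p.reflect d).eval z = z ^ d * p.eval z⁻¹ := by
  have : Invertible z⁻¹ := invertibleOfNonzero (inv_ne_zero hz)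
  have h := eval₂_reflect_mul_pow (RingHom.id ℂ) z⁻¹ d p hp
  rw [invOf_eq_inv, inv_inv] at h
  rw [eval, eval, ← h, inv_pow]
  field_simp

theorem eval_reflect_zero (d : ℕ) (p : ℂ[X]) : (p.reflect d).eval 0 = p.coeff d := by
  rw [← coeff_zero_eq_eval_zero, coeff_reflect, revAt_le (Nat.zero_le d), Nat.sub_zero]

theorem coeff_reflect_self (d : ℕ) (p : ℂ[X]) : (p.reflect d).coeff d = p.eval 0 := by
  rw [coeff_reflect, revAt_le le_rfl, Nat.sub_self, coeff_zero_eq_eval_zero]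

theorem coeff_taylor_of_natDegree_le {d : ℕ} {p : ℂ[X]} (hp : p.natDegree ≤ d) (v : ℂ) :
    (taylor v p).coeff d = p.coeff d := by
  rcases hp.lt_or_eq with h | rfl
  · rw [coeff_eq_zero_of_natDegree_lt h, coeff_eq_zero_of_natDegree_lt (by rwa [natDegree_taylor])]
  · have := leadingCoeff_taylor (r := v) (f := p)
    rwa [leadingCoeff, natDegree_taylor] at this

namespace HasRatPair

variable {f : RSphere → RSphere} {d : ℕ}

theorem sphereInv_comp (hf : HasRatPair f d) : HasRatPair (sphereInv ∘ f) d := by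
  obtain ⟨p, q, h⟩ := hf
  refine ⟨q, p, h.natDegree_right, h.natDegree_left, fun z => (h.eval_ne_zero z).symm,
    h.coeff_ne_zero.symm, fun z => ?_, ?_⟩
  · rw [Function.comp_apply, h.apply_coe, sphereInv_homPoint (h.eval_ne_zero z)]
  · rw [Function.comp_apply, h.apply_infty, sphereInv_homPoint h.coeff_ne_zero]

theorem comp_sphereInv (hf : HasRatPair f d) : HasRatPair (f ∘ sphereInv) d := by
  obtain ⟨p, q, h⟩ := hf
  refine ⟨p.reflect d, q.reflect d, natDegree_reflect_le.trans (by simp [h.natDegree_left]),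
    natDegree_reflect_le.trans (by simp [h.natDegree_right]), fun z => ?_, ?_, fun z => ?_, ?_⟩
  · rcases eq_or_ne z 0 with rfl | hz
    · simpa only [eval_reflect_zero] using h.coeff_ne_zero
    · rw [eval_reflect h.natDegree_left hz, eval_reflect h.natDegree_right hz]
      exact (h.eval_ne_zero z⁻¹).imp (mul_ne_zero (pow_ne_zero _ hz))
        (mul_ne_zero (pow_ne_zero _ hz))
  · simpa only [coeff_reflect_self] using h.eval_ne_zero 0
  · rcases eq_or_ne z 0 with rfl | hz
    · simp only [Function.comp_apply, sphereInv_zero, eval_reflect_zero, h.apply_infty]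
    · rw [eval_reflect h.natDegree_left hz, eval_reflect h.natDegree_right hz,
        homPoint_mul_left (pow_ne_zero _ hz), Function.comp_apply, sphereInv_coe hz, h.apply_coe]
  · simp only [Function.comp_apply, sphereInv_infty, coeff_reflect_self, h.apply_coe]

theorem sphereTranslate_comp (hf : HasRatPair f d) (v : ℂ) :
    HasRatPair (sphereTranslate v ∘ f) d := by
  obtain ⟨p, q, h⟩ := hf
  refine ⟨p + Polynomial.C v * q, q, ?_, h.natDegree_right, fun z => ?_, ?_, fun z => ?_, ?_⟩
  · exact (natDegree_add_le _ _).trans (max_le h.natDegree_left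
      ((natDegree_C_mul_le _ _).trans h.natDegree_right))
  · refine or_iff_not_imp_right.2 fun hq => ?_
    rw [eval_add, eval_mul, eval_C, not_not.1 hq, mul_zero, add_zero]
    exact (h.eval_ne_zero z).resolve_right hq
  · refine or_iff_not_imp_right.2 fun hq => ?_
    rw [coeff_add, coeff_C_mul, not_not.1 hq, mul_zero, add_zero]
    exact (h.coeff_ne_zero).resolve_right hq
  · rw [Function.comp_apply, h.apply_coe, sphereTranslate_homPoint]
    simp
  · rw [Function.comp_apply, h.apply_infty, sphereTranslate_homPoint]
    simp

theorem comp_sphereTranslate (hf : HasRatPair f d) (v : ℂ) :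
    HasRatPair (f ∘ sphereTranslate v) d := by
  obtain ⟨p, q, h⟩ := hf
  refine ⟨taylor v p, taylor v q, by rw [natDegree_taylor]; exact h.natDegree_left,
    by rw [natDegree_taylor]; exact h.natDegree_right, fun z => ?_, ?_, fun z => ?_, ?_⟩
  · simpa only [taylor_eval] using h.eval_ne_zero _
  · rw [coeff_taylor_of_natDegree_le h.natDegree_left,
      coeff_taylor_of_natDegree_le h.natDegree_right]
    exact h.coeff_ne_zero
  · rw [Function.comp_apply, sphereTranslate_coe, h.apply_coe, taylor_eval, taylor_eval]
  · rw [coeff_taylor_of_natDegree_le h.natDegree_left,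
      coeff_taylor_of_natDegree_le h.natDegree_right, Function.comp_apply, sphereTranslate_infty,
      h.apply_infty]

theorem coordAt_comp (hf : HasRatPair f d) (v : RSphere) : HasRatPair (coordAt v ∘ f) d := by
  by_cases hv : v = OnePoint.infty
  · simpa [coordAt, hv] using hf
  · have := (hf.sphereTranslate_comp (-finitePart v)).sphereInv_comp
    simpa [coordAt, hv, Function.comp_def] using! this

theorem comp_coordAt_symm (hf : HasRatPair f d) (u : RSphere) :
    HasRatPair (f ∘ (coordAt u).symm) d := by
  by_cases hu : u = OnePoint.infty
  · simpa [coordAt, hu] using! hf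
  · have hsymm : (coordAt u).symm = sphereInv.trans (sphereTranslate (finitePart u)) := by
      ext z
      rw [Homeomorph.symm_apply_eq]
      simp [coordAt, hu, ← sphereTranslate_symm]
    rw [hsymm]
    exact (hf.comp_sphereTranslate (finitePart u)).comp_sphereInv

theorem coordAt_conj (hf : HasRatPair f d) (u v : RSphere) :
    HasRatPair (coordAt v ∘ f ∘ (coordAt u).symm) d :=
  (hf.comp_coordAt_symm u).coordAt_comp v

end HasRatPair

theorem analyticAt_eval_div_eval (p : ℂ[X]) {q : ℂ[X]} {z : ℂ} (hz : q.eval z ≠ 0) :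
    AnalyticAt ℂ (fun w => p.eval w / q.eval w) z :=
  (p.differentiable.analyticAt z).div (q.differentiable.analyticAt z) hz

namespace IsRatPair

variable {f : RSphere → RSphere} {d : ℕ} {p q : ℂ[X]}

theorem eval_ne_zero_of_apply_ne_infty (h : IsRatPair f d p q) {z : ℂ}
    (hz : f z ≠ OnePoint.infty) : q.eval z ≠ 0 := fun hq =>
  hz (by rw [h.apply_coe, hq, homPoint_zero])

theorem eventually_eq (h : IsRatPair f d p q) {z : ℂ} (hz : q.eval z ≠ 0) :
    ∀ᶠ w : ℂ in 𝓝 z, f w = ((p.eval w / q.eval w : ℂ) : RSphere) := by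
  filter_upwards [q.continuous.continuousAt.eventually_ne hz] with w hw
  rw [h.apply_coe, homPoint_of_ne_zero _ hw]

theorem not_eventually_const (h : IsRatPair f d p q) (hd : 1 ≤ d) {z : ℂ} (hz : q.eval z ≠ 0)
    (v : ℂ) : ¬ ∀ᶠ w : ℂ in 𝓝 z, p.eval w / q.eval w = v := by
  intro hev
  have hroot : ∀ᶠ w : ℂ in 𝓝 z, (p - Polynomial.C v * q).eval w = 0 := by
    filter_upwards [hev, q.continuous.continuousAt.eventually_ne hz] with w hw hqw
    rw [div_eq_iff hqw] at hw
    simp [hw]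
  have hpq : p = Polynomial.C v * q :=
    sub_eq_zero.1 (eq_zero_of_infinite_isRoot _ (infinite_of_mem_nhds z hroot))
  have hq0 (w) (hw : q.eval w = 0) : False := by
    simpa [hpq, hw] using h.eval_ne_zero w
  have hdeg : q.degree = 0 := by
    by_contra hne
    obtain ⟨w, hw⟩ := IsAlgClosed.exists_root q hne
    exact hq0 w hw
  have hqd : q.coeff d = 0 := coeff_eq_zero_of_natDegree_lt (by
    rw [natDegree_eq_zero_iff_degree_le_zero.2 hdeg.le]; omega)
  simpa [hpq, hqd] using h.coeff_ne_zero

theorem map_nhds_coe_eq (h : IsRatPair f d p q) (hd : 1 ≤ d) {z : ℂ} (hz : q.eval z ≠ 0) :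
    Filter.map f (𝓝 (z : RSphere)) = 𝓝 (f z) := by
  have hev := h.eventually_eq hz
  have han := analyticAt_eval_div_eval p hz
  have hmap : Filter.map (fun w => p.eval w / q.eval w) (𝓝 z) = 𝓝 (p.eval z / q.eval z) :=
    le_antisymm han.continuousAt (han.eventually_constant_or_nhds_le_map_nhds.resolve_left
      (h.not_eventually_const hd hz _))
  rw [OnePoint.nhds_coe_eq, Filter.map_map, hev.self_of_nhds, OnePoint.nhds_coe_eq, ← hmap,
    Filter.map_map]
  exact Filter.map_congr hev

end IsRatPair

namespace HasRatPair

variable {f : RSphere → RSphere} {d : ℕ}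

theorem map_nhds_eq (hf : HasRatPair f d) (hd : 1 ≤ d) (z : RSphere) :
    Filter.map f (𝓝 z) = 𝓝 (f z) := by
  obtain ⟨u, hu⟩ := exists_ne z
  obtain ⟨v, hv⟩ := exists_ne (f z)
  obtain ⟨w, hw⟩ : ∃ w : ℂ, (w : RSphere) = coordAt u z :=
    ⟨_, coe_finitePart (coordAt_ne_infty hu.symm)⟩
  obtain ⟨p, q, h⟩ := hf.coordAt_conj u v
  have hmap := h.map_nhds_coe_eq hd (z := w) (h.eval_ne_zero_of_apply_ne_infty (by
    simpa [hw] using coordAt_ne_infty hv.symm))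
  rw [hw, ← Filter.map_map, ← Filter.map_map, Homeomorph.map_nhds_eq, Homeomorph.symm_apply_apply,
    Function.comp_apply, Function.comp_apply, Homeomorph.symm_apply_apply,
    ← (coordAt v).map_nhds_eq (f z)] at hmap
  exact Filter.map_injective (coordAt v).injective hmap

theorem continuous (hf : HasRatPair f d) (hd : 1 ≤ d) : Continuous f :=
  continuous_iff_continuousAt.2 fun z => (hf.map_nhds_eq hd z).le

theorem isOpenMap (hf : HasRatPair f d) (hd : 1 ≤ d) : IsOpenMap f :=
  IsOpenMap.of_nhds_le fun z => (hf.map_nhds_eq hd z).ge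

theorem surjective (hf : HasRatPair f d) (hd : 1 ≤ d) : Function.Surjective f := by
  have hclopen : IsClopen (range f) :=
    ⟨(isCompact_range (hf.continuous hd)).isClosed, (hf.isOpenMap hd).isOpen_range⟩
  exact range_eq_univ.1 (hclopen.eq_univ (range_nonempty f))

end HasRatPair

/-! ### Critical points -/

theorem not_eventually_const_of_injOn {X Y : Type*} [TopologicalSpace X] [T1Space X]
    {F : X → Y} {z : X} [(𝓝[≠] z).NeBot] {U : Set X} (hU : U ∈ 𝓝 z) (hinj : InjOn F U) (c : Y) :
    ¬ ∀ᶠ w in 𝓝 z, F w = c := by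
  intro hev
  have hinf := infinite_of_mem_nhds z (Filter.inter_mem hU hev)
  obtain ⟨w, ⟨hwU, hwc⟩, hne⟩ := hinf.exists_notMem_finite (finite_singleton z)
  exact hne (hinj hwU (mem_of_mem_nhds hU) (hwc.trans hev.self_of_nhds.symm))

theorem eventually_deriv_ne_zero_of_not_eventually_const {F : ℂ → ℂ} {z : ℂ}
    (hF : AnalyticAt ℂ F z) (hconst : ¬ ∀ᶠ w in 𝓝 z, F w = F z) :
    ∀ᶠ w in 𝓝[≠] z, deriv F w ≠ 0 := by
  refine hF.deriv.eventually_eq_zero_or_eventually_ne_zero.resolve_left fun hev => hconst ?_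
  obtain ⟨r, hr, hball⟩ := Metric.eventually_nhds_iff_ball.1 (hev.and hF.eventually_analyticAt)
  filter_upwards [Metric.ball_mem_nhds z hr] with w hw
  exact Metric.isOpen_ball.is_const_of_deriv_eq_zero (convex_ball z r).isPreconnected
    (fun v hv => (hball v hv).2.differentiableAt.differentiableWithinAt)
    (fun v hv => (hball v hv).1) hw (Metric.mem_ball_self hr)

/-- The inverse is holomorphic off the image of `z`, hence also there, by removability of the
singularity. -/
theorem deriv_ne_zero_of_injOn {F : ℂ → ℂ} {z : ℂ} (hF : AnalyticAt ℂ F z) {U : Set ℂ}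
    (hU : U ∈ 𝓝 z) (hinj : InjOn F U) : deriv F z ≠ 0 := by
  obtain ⟨r, hr, hball⟩ := Metric.eventually_nhds_iff_ball.1 ((eventually_nhdsWithin_iff.1
    (eventually_deriv_ne_zero_of_not_eventually_const hF
      (not_eventually_const_of_injOn hU hinj _))).and (hF.eventually_analyticAt.and hU))
  have hinjB : InjOn F (Metric.ball z r) := hinj.mono fun w hw => (hball w hw).2.2
  have hopen := (AnalyticOnNhd.is_constant_or_isOpen (fun w hw => (hball w hw).2.1)
    (convex_ball z r).isPreconnected).resolve_left fun ⟨c, hc⟩ =>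
    not_eventually_const_of_injOn hU hinj c
      (Filter.eventually_of_mem (Metric.ball_mem_nhds z hr) hc)
  let e : OpenPartialHomeomorph ℂ ℂ := .ofContinuousOpenRestrict
    (hinjB.toPartialEquiv F (Metric.ball z r))
    (fun w hw => (hball w hw).2.1.continuousAt.continuousWithinAt)
    (fun s hs => by
      rw [domRestrict_eq, image_comp]
      exact hopen _ (Subtype.coe_image_subset _ _)
        (Metric.isOpen_ball.isOpenMap_subtype_val s hs)) Metric.isOpen_ball
  have hz : z ∈ e.source := Metric.mem_ball_self hr
  have hsymm : AnalyticAt ℂ e.symm (e z) := by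
    refine Complex.analyticAt_of_differentiable_on_punctured_nhds_of_continuousAt ?_
      (e.symm.continuousAt (e.map_source hz))
    filter_upwards [self_mem_nhdsWithin,
      nhdsWithin_le_nhds (e.open_target.mem_nhds (e.map_source hz))] with v hvz hv
    have hmem := hball _ (e.map_target hv)
    exact (e.hasDerivAt_symm hv (hmem.1 fun h => hvz ((e.toPartialEquiv.symm_apply_eq hz hv).1 h))
      hmem.2.1.differentiableAt.hasDerivAt).differentiableAt
  intro hzero
  have hFz : HasDerivAt F 0 z := hzero ▸ hF.differentiableAt.hasDerivAt
  exact not_differentiableAt_of_local_left_inverse_hasDerivAt_zero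
    ((e.left_inv hz).symm ▸ hFz) (e.eventually_right_inverse (e.map_source hz))
    hsymm.differentiableAt

theorem IsRatPair.deriv_ne_zero_of_injOn {f : RSphere → RSphere} {d : ℕ} {p q : ℂ[X]}
    (h : IsRatPair f d p q) {z : ℂ} (hz : q.eval z ≠ 0) {U : Set RSphere}
    (hU : U ∈ 𝓝 (z : RSphere)) (hinj : InjOn f U) :
    deriv (fun w => p.eval w / q.eval w) z ≠ 0 := by
  rw [OnePoint.nhds_coe_eq, Filter.mem_map] at hU
  refine _root_.deriv_ne_zero_of_injOn (analyticAt_eval_div_eval p hz)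
    (Filter.inter_mem hU (h.eventually_eq hz)) fun w hw w' hw' e => ?_
  refine OnePoint.coe_injective (hinj hw.1 hw'.1 ?_)
  rw [show f w = _ from hw.2, show f w' = _ from hw'.2]
  exact congrArg OnePoint.some e

theorem HasRatPair.exists_hasStrictDerivAt {f : RSphere → RSphere} {d : ℕ} (hf : HasRatPair f d)
    {z : ℂ} (hz : f z ≠ OnePoint.infty) (hinj : ∃ U ∈ 𝓝 (z : RSphere), InjOn f U) :
    ∃ (F : ℂ → ℂ) (F' : ℂ), F' ≠ 0 ∧ HasStrictDerivAt F F' z ∧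
      ∀ᶠ w : ℂ in 𝓝 z, f w = (F w : RSphere) := by
  obtain ⟨p, q, h⟩ := hf
  obtain ⟨U, hU, hinj⟩ := hinj
  have hq := h.eval_ne_zero_of_apply_ne_infty hz
  exact ⟨_, _, h.deriv_ne_zero_of_injOn hq hU hinj,
    (analyticAt_eval_div_eval p hq).hasStrictDerivAt, h.eventually_eq hq⟩

theorem coeff_wronskian_of_natDegree_le {R : Type*} [CommRing R] {p q : R[X]} {k e : ℕ}
    (hp : p.natDegree ≤ k + 1) (hq : q.natDegree ≤ e) :
    (wronskian q p).coeff (k + e) = (k + 1 - e) * (q.coeff e * p.coeff (k + 1)) := by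
  have hp' : (derivative p).natDegree ≤ k := (natDegree_derivative_le p).trans (by omega)
  rw [wronskian, coeff_sub, add_comm k e, coeff_mul_add_eq_of_natDegree_le hq hp',
    coeff_derivative]
  rcases e with - | m
  · rw [eq_C_of_natDegree_le_zero hq, derivative_C]
    simp
    ring
  · have hq' : (derivative q).natDegree ≤ m := (natDegree_derivative_le q).trans (by omega)
    rw [show m + 1 + k = m + (k + 1) by omega, coeff_mul_add_eq_of_natDegree_le hq' hp,
      coeff_derivative]
    push_cast
    ring

theorem rootMultiplicity_wronskian_lt {K : Type*} [Field K] [CharZero K] {p q : K[X]} {a : K}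
    (hq0 : q ≠ 0) (hq : q.IsRoot a) (hp : ¬ p.IsRoot a) :
    (wronskian q p).rootMultiplicity a < q.rootMultiplicity a := by
  by_contra! hle
  have hdvd : (X - Polynomial.C a) ^ q.rootMultiplicity a ∣ p * derivative q := by
    have : p * derivative q = q * derivative p - wronskian q p := by rw [wronskian]; ring
    rw [this]
    exact dvd_sub ((pow_rootMultiplicity_dvd q a).mul_right _)
      ((pow_dvd_pow _ hle).trans (pow_rootMultiplicity_dvd _ a))
  have hcoprime : IsCoprime ((X - Polynomial.C a) ^ q.rootMultiplicity a) p :=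
    .pow_left (((irreducible_X_sub_C a).coprime_iff_not_dvd).2 (dvd_iff_isRoot.not.2 hp))
  have hq' : derivative q ≠ 0 := fun h0 => hq0 <| by
    rw [eq_C_of_natDegree_eq_zero (derivative_eq_zero.1 h0)] at hq ⊢
    simpa using hq
  have hmult := (le_rootMultiplicity_iff hq').2 (hcoprime.dvd_of_dvd_mul_left hdvd)
  rw [derivative_rootMultiplicity_of_root hq] at hmult
  have := (rootMultiplicity_pos hq0).2 hq
  omega

/-- Otherwise every root of the Wronskian is a root of `q` of larger multiplicity, so that the
Wronskian has degree at most `q.natDegree`. -/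
theorem exists_isRoot_wronskian {K : Type*} [Field K] [CharZero K] [IsAlgClosed K] {p q : K[X]}
    (hpq : ∀ z, p.eval z ≠ 0 ∨ q.eval z ≠ 0) (hq0 : q ≠ 0) (hdeg : q.natDegree < p.natDegree)
    (hd : 2 ≤ p.natDegree) : ∃ a, q.eval a ≠ 0 ∧ (wronskian q p).IsRoot a := by
  by_contra! hroot
  obtain ⟨k, hk⟩ : ∃ k, p.natDegree = k + 1 := ⟨p.natDegree - 1, by omega⟩
  have hp0 : p ≠ 0 := fun h => by simp [h] at hd
  have hcoeff : (wronskian q p).coeff (k + q.natDegree) ≠ 0 := by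
    rw [coeff_wronskian_of_natDegree_le hk.le le_rfl, ← hk]
    refine mul_ne_zero (sub_ne_zero.2 fun hc => ?_)
      (mul_ne_zero (leadingCoeff_ne_zero.2 hq0) (leadingCoeff_ne_zero.2 hp0))
    have : k + 1 = q.natDegree := by exact_mod_cast hc
    omega
  have hroots : (wronskian q p).roots ≤ q.roots := by
    classical
    rw [Multiset.le_iff_count]
    intro a
    rw [count_roots, count_roots]
    by_cases hqa : q.eval a = 0
    · exact (rootMultiplicity_wronskian_lt hq0 hqa ((hpq a).resolve_right (not_not_intro hqa))).le
    · rw [rootMultiplicity_eq_zero (hroot a hqa)]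
      exact Nat.zero_le _
  have hcard := Multiset.card_le_card hroots
  rw [IsAlgClosed.card_roots_eq_natDegree] at hcard
  have := le_natDegree_of_ne_zero hcoeff
  have := q.card_roots'
  omega

theorem IsRatPair.exists_isRoot_wronskian {f : RSphere → RSphere} {d : ℕ} {p q : ℂ[X]}
    (h : IsRatPair f d p q) (hd : 2 ≤ d) (hqd : q.coeff d = 0) :
    ∃ a : ℂ, q.eval a ≠ 0 ∧ (wronskian q p).IsRoot a := by
  have hpd : p.coeff d ≠ 0 := h.coeff_ne_zero.resolve_right (not_not_intro hqd)
  have hp : p.natDegree = d := natDegree_eq_of_le_of_coeff_ne_zero h.natDegree_left hpd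
  have hq0 : q ≠ 0 := by
    rintro rfl
    obtain ⟨w, hw⟩ := IsAlgClosed.exists_root p fun h0 => by
      have := natDegree_eq_zero_iff_degree_le_zero.2 h0.le
      omega
    simpa [hw.eq_zero] using h.eval_ne_zero w
  refine _root_.exists_isRoot_wronskian h.eval_ne_zero hq0 (hp ▸ ?_) (hp ▸ hd)
  refine h.natDegree_right.lt_of_ne fun hq => hq0 (leadingCoeff_eq_zero.1 ?_)
  rw [leadingCoeff, hq, hqd]

theorem isCriticalPoint_homeomorph_iff {f : RSphere → RSphere} (κ κ' : RSphere ≃ₜ RSphere)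
    {c : RSphere} : IsCriticalPoint (κ' ∘ f ∘ κ.symm) (κ c) ↔ IsCriticalPoint f c := by
  refine not_congr ⟨?_, ?_⟩
  · rintro ⟨U, hU, hinj⟩
    refine ⟨κ ⁻¹' U, κ.continuous.continuousAt.preimage_mem_nhds hU, fun x hx y hy e => ?_⟩
    exact κ.injective (hinj hx hy (by simp [e]))
  · rintro ⟨U, hU, hinj⟩
    refine ⟨κ '' U, κ.isOpenMap.image_mem_nhds hU, ?_⟩
    rintro _ ⟨x, hx, rfl⟩ _ ⟨y, hy, rfl⟩ e
    rw [hinj hx hy (by simpa using e)]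

/-- In coordinates that move a preimage of `v` and `v` to `∞`, critical points with values other
than `v` are the roots of a Wronskian that are not poles. -/
theorem HasRatPair.exists_isCriticalPoint {f : RSphere → RSphere} {d : ℕ} (hf : HasRatPair f d)
    (hd : 2 ≤ d) (v : RSphere) : ∃ c, IsCriticalPoint f c ∧ f c ≠ v := by
  obtain ⟨u, hu⟩ := hf.surjective (by omega) v
  obtain ⟨p, q, h⟩ := hf.coordAt_conj u v
  have hinf : (coordAt u).symm OnePoint.infty = u := by
    rw [Homeomorph.symm_apply_eq, coordAt_self]
  have hqd : q.coeff d = 0 := by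
    rw [← homPoint_eq_infty_iff (a := p.coeff d), ← h.apply_infty]
    simp [hinf, hu]
  obtain ⟨a, hqa, hWa⟩ := h.exists_isRoot_wronskian hd hqd
  refine ⟨(coordAt u).symm a, ?_, fun e => hqa ?_⟩
  · rw [← isCriticalPoint_homeomorph_iff (coordAt u) (coordAt v), Homeomorph.apply_symm_apply]
    rintro ⟨U, hU, hinj⟩
    refine h.deriv_ne_zero_of_injOn hqa hU hinj
      (((p.hasDerivAt a).div (q.hasDerivAt a) hqa).deriv.trans ?_)
    have hnum : (derivative p).eval a * q.eval a - p.eval a * (derivative q).eval a = 0 := by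
      rw [← hWa.eq_zero, wronskian, eval_sub, eval_mul, eval_mul]
      ring
    rw [hnum, zero_div]
  · rw [← homPoint_eq_infty_iff (a := p.eval a), ← h.apply_coe]
    simp [e]

theorem nontrivial_postcriticalSet {f : RSphere → RSphere} {d : ℕ} (hf : HasRatPair f d)
    (hd : 2 ≤ d) : (postcriticalSet f).Nontrivial := by
  obtain ⟨c, hc, -⟩ := hf.exists_isCriticalPoint hd OnePoint.infty
  obtain ⟨c', hc', hne⟩ := hf.exists_isCriticalPoint hd (f c)
  exact ⟨f c', ⟨c', hc', 1, le_rfl, rfl⟩, f c, ⟨c, hc, 1, le_rfl, rfl⟩, hne⟩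

/-! ### Arcs of the curve and their orientations -/

theorem exists_continuous_lift_of_injOn {X A Y : Type*} [TopologicalSpace X] [TopologicalSpace A]
    [TopologicalSpace Y] [T2Space Y] {K : Set A} (hK : IsCompact K) {g : A → Y}
    (hg : ContinuousOn g K) (hinj : InjOn g K) {y : X → Y} (hy : Continuous y)
    (hyK : ∀ x, y x ∈ g '' K) :
    ∃ θ : X → A, Continuous θ ∧ (∀ x, θ x ∈ K) ∧ ∀ x, g (θ x) = y x := by
  have : CompactSpace K := isCompact_iff_compactSpace.1 hK
  have hemb : IsClosedEmbedding fun s : K => g s :=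
    (continuousOn_iff_continuous_domRestrict.1 hg).isClosedEmbedding (injOn_iff_injective.1 hinj)
  choose θ hθK hθ using hyK
  have hθc : Continuous fun x => (⟨θ x, hθK x⟩ : K) :=
    hemb.isInducing.continuous_iff.2 (hy.congr fun x => (hθ x).symm)
  exact ⟨θ, continuous_subtype_val.comp hθc, hθK, hθ⟩

theorem exists_Ioo_of_notMem_isClosed {T : Set ℝ} (hT : IsClosed T) {t₀ : ℝ} (ht₀ : t₀ ∉ T)
    (hl : (T ∩ Iic t₀).Nonempty) (hr : (T ∩ Ici t₀).Nonempty) :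
    ∃ a ∈ T, ∃ b ∈ T, t₀ ∈ Ioo a b ∧ ∀ t ∈ Ioo a b, t ∉ T := by
  have hbdA : BddAbove (T ∩ Iic t₀) := ⟨t₀, fun t ht => ht.2⟩
  have hbdB : BddBelow (T ∩ Ici t₀) := ⟨t₀, fun t ht => ht.2⟩
  obtain ⟨haT, hat⟩ := (hT.inter isClosed_Iic).csSup_mem hl hbdA
  obtain ⟨hbT, hbt⟩ := (hT.inter isClosed_Ici).csInf_mem hr hbdB
  refine ⟨_, haT, _, hbT, ⟨lt_of_le_of_ne hat fun e => ht₀ (e ▸ haT),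
    lt_of_le_of_ne hbt fun e => ht₀ (e ▸ hbT)⟩, fun t ht htT => ?_⟩
  rcases le_total t t₀ with hle | hle
  · exact (le_csSup hbdA ⟨htT, hle⟩).not_gt ht.1
  · exact (csInf_le hbdB ⟨htT, hle⟩).not_gt ht.2

theorem not_isLocalMax_of_injOn {θ : ℝ → ℝ} {r : ℝ} {U : Set ℝ} (hU : U ∈ 𝓝 r)
    (hθ : ContinuousOn θ U) (hinj : InjOn θ U) : ¬ IsLocalMax θ r := by
  intro hmax
  obtain ⟨δ, hδ, hδU⟩ := Metric.nhds_basis_closedBall.mem_iff.1 (Filter.inter_mem hU hmax)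
  rw [Real.closedBall_eq_Icc] at hδU
  have hl : r - δ ∈ Icc (r - δ) (r + δ) := ⟨le_rfl, by linarith⟩
  have hm : r ∈ Icc (r - δ) (r + δ) := ⟨by linarith, by linarith⟩
  have hr : r + δ ∈ Icc (r - δ) (r + δ) := ⟨by linarith, le_rfl⟩
  rcases ContinuousOn.strictMonoOn_of_injOn_Icc' (by linarith : r - δ ≤ r + δ)
    (hθ.mono fun u hu => (hδU hu).1) (hinj.mono fun u hu => (hδU hu).1) with hmono | hanti
  · exact (hmono hm hr (by linarith)).not_ge (hδU hr).2
  · exact (hanti hl hm (by linarith)).not_ge (hδU hl).2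

theorem not_isLocalExtr_of_injOn {θ : ℝ → ℝ} {r : ℝ} {U : Set ℝ} (hU : U ∈ 𝓝 r)
    (hθ : ContinuousOn θ U) (hinj : InjOn θ U) : ¬ IsLocalExtr θ r :=
  not_or.2 ⟨fun hmin => not_isLocalMax_of_injOn hU hθ.neg (fun _ hs _ ht e =>
    hinj hs ht (neg_injective e)) hmin.neg, not_isLocalMax_of_injOn hU hθ hinj⟩

theorem injOn_Icc_of_locally_injOn {θ : ℝ → ℝ} {a b : ℝ} (hθ : ContinuousOn θ (Icc a b))
    (hloc : ∀ t ∈ Ioo a b, ∃ U ∈ 𝓝 t, InjOn θ U) : InjOn θ (Icc a b) := by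
  have hne : ∀ s ∈ Icc a b, ∀ t ∈ Icc a b, s < t → θ s ≠ θ t := by
    intro s hs t ht hst e
    obtain ⟨r, hr, hext⟩ := exists_isLocalExtr_Ioo hst (hθ.mono (Icc_subset_Icc hs.1 ht.2)) e
    have hrab : r ∈ Ioo a b := ⟨hs.1.trans_lt hr.1, hr.2.trans_le ht.2⟩
    obtain ⟨U, hU, hinj⟩ := hloc r hrab
    exact not_isLocalExtr_of_injOn (Filter.inter_mem hU (Icc_mem_nhds hrab.1 hrab.2))
      (hθ.mono inter_subset_right) (hinj.mono inter_subset_left) hext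
  intro s hs t ht e
  by_contra hst
  rcases lt_or_gt_of_ne hst with hlt | hlt
  · exact hne s hs t ht hlt e
  · exact hne t ht s hs hlt e.symm

namespace IsOrientedJordanCurve

variable {C : Set RSphere} {γ : UnitAddCircle → RSphere}

theorem exists_Ioo_of_notMem (h : IsOrientedJordanCurve C γ) {W : Set RSphere} (hW : IsClosed W)
    (hWC : W ⊆ C) (hne : W.Nonempty) {t₀ : ℝ} (ht₀ : γ (t₀ : UnitAddCircle) ∉ W) :
    ∃ a b : ℝ, t₀ ∈ Ioo a b ∧ b ≤ a + 1 ∧ γ (a : UnitAddCircle) ∈ W ∧ γ (b : UnitAddCircle) ∈ W ∧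
      ∀ t ∈ Ioo a b, γ (t : UnitAddCircle) ∉ W := by
  obtain ⟨w, hw⟩ := hne
  obtain ⟨s, hs, rfl⟩ := h.exists_eq t₀ (hWC hw)
  obtain ⟨s', hs', e⟩ := h.exists_eq (t₀ - 1) (hWC hw)
  obtain ⟨a, ha, b, hb, hab, hdisj⟩ := exists_Ioo_of_notMem_isClosed
    (hW.preimage h.continuous_lift) ht₀ ⟨s', mem_preimage.2 (e ▸ hw), by
      have := hs'.2
      simp only [mem_Iic]
      linarith⟩ ⟨s, hw, hs.1⟩
  refine ⟨a, b, hab, not_lt.1 fun hlt => hdisj (a + 1) ⟨by linarith, hlt⟩ ?_, ha, hb, hdisj⟩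
  rwa [mem_preimage, unitAddCircle_coe_eq_iff.2 (show ∃ n : ℤ, a + 1 = a + n from ⟨1, by norm_num⟩)]

theorem lt_add_one_of_nontrivial (h : IsOrientedJordanCurve C γ) {W : Set RSphere}
    (hWC : W ⊆ C) (hW : W.Nontrivial) {a b : ℝ} (hba : b ≤ a + 1)
    (hab : ∀ t ∈ Ioo a b, γ (t : UnitAddCircle) ∉ W) : b < a + 1 := by
  refine lt_of_le_of_ne hba fun e => ?_
  have hWa : ∀ w ∈ W, w = γ (a : UnitAddCircle) := fun w hw => by
    obtain ⟨t, ht, rfl⟩ := h.exists_eq a (hWC hw)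
    rcases ht.1.eq_or_lt with rfl | hlt
    · rfl
    · exact absurd hw (hab t ⟨hlt, e ▸ ht.2⟩)
  obtain ⟨w, hw, w', hw', hne⟩ := hW
  exact hne ((hWa w hw).trans (hWa w' hw').symm)

theorem subset_image_Ioo (h : IsOrientedJordanCurve C γ) {W : Set RSphere} {a b t₀ : ℝ}
    (ht₀ : t₀ ∈ Ioo a b) (hba : b ≤ a + 1) (ha : γ (a : UnitAddCircle) ∈ W)
    (hb : γ (b : UnitAddCircle) ∈ W) {s : Set RSphere} (hs : IsPreconnected s) (hsC : s ⊆ C \ W)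
    (hts : γ (t₀ : UnitAddCircle) ∈ s) : s ⊆ (fun t : ℝ => γ t) '' Ioo a b := by
  have hcover : s ⊆ (fun t : ℝ => γ t) '' Icc a b ∪ (fun t : ℝ => γ t) '' Icc b (a + 1) := by
    rw [h.image_Icc_union (ht₀.1.trans ht₀.2).le hba]
    exact fun z hz => (hsC hz).1
  have hcompl : ∀ z ∈ s, z ∉ (fun t : ℝ => γ t) '' Icc b (a + 1) := by
    intro z hz hzB
    obtain ⟨w, hw, hw'⟩ := isPreconnected_closed_iff.1 hs _ _ (isClosed_image_Icc h.continuous a b)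
      (isClosed_image_Icc h.continuous b (a + 1)) hcover
      ⟨_, hts, ⟨t₀, Ioo_subset_Icc_self ht₀, rfl⟩⟩ ⟨z, hz, hzB⟩
    rcases h.image_Icc_inter_subset hw' with e | e
    · exact (hsC hw).2 (e ▸ ha)
    · exact (hsC hw).2 (e ▸ hb)
  intro z hz
  obtain ⟨t, ht, rfl⟩ := (hcover hz).resolve_right (hcompl z hz)
  exact ⟨t, ⟨lt_of_le_of_ne ht.1 fun e => (hsC hz).2 (e ▸ ha),
    lt_of_le_of_ne ht.2 fun e => (hsC hz).2 (e ▸ hb)⟩, rfl⟩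

theorem connectedComponentIn_eq_image_Ioo (h : IsOrientedJordanCurve C γ) {W : Set RSphere}
    {a b t₀ : ℝ} (ht₀ : t₀ ∈ Ioo a b) (hba : b ≤ a + 1) (ha : γ (a : UnitAddCircle) ∈ W)
    (hb : γ (b : UnitAddCircle) ∈ W) (hab : ∀ t ∈ Ioo a b, γ (t : UnitAddCircle) ∉ W) :
    connectedComponentIn (C \ W) (γ (t₀ : UnitAddCircle)) = (fun t : ℝ => γ t) '' Ioo a b := by
  refine (h.subset_image_Ioo ht₀ hba ha hb isPreconnected_connectedComponentIn
    (connectedComponentIn_subset _ _) (mem_connectedComponentIn ⟨h.mem _, hab _ ht₀⟩)).antisymm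
    ((isPreconnected_Ioo.image _ h.continuous_lift.continuousOn).subset_connectedComponentIn
      ⟨t₀, ht₀, rfl⟩ (image_subset_iff.2 fun t ht => ⟨h.mem _, hab t ht⟩))

theorem closure_image_Ioo (h : IsOrientedJordanCurve C γ) {a b : ℝ} (hab : a < b) :
    closure ((fun t : ℝ => γ t) '' Ioo a b) = (fun t : ℝ => γ t) '' Icc a b := by
  refine (closure_minimal (image_mono Ioo_subset_Icc_self)
    (isClosed_image_Icc h.continuous a b)).antisymm ?_
  rw [← closure_Ioo hab.ne]
  exact image_closure_subset_closure_image h.continuous_lift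

theorem exists_continuous_lift_Icc (h : IsOrientedJordanCurve C γ) {P : Set RSphere}
    (hP : IsClosed P) (hPC : P ⊆ C) (hPn : P.Nontrivial) {a b : ℝ} (hab : a < b)
    {y : ℝ → RSphere} (hy : Continuous y) (hyC : ∀ t ∈ Ioo a b, y t ∈ C \ P) :
    ∃ (c e : ℝ) (θ : ℝ → ℝ), e - c < 1 ∧ Continuous θ ∧ (∀ t, θ t ∈ Icc c e) ∧
      ∀ t ∈ Icc a b, γ (θ t : UnitAddCircle) = y t := by
  obtain ⟨t₀, ht₀⟩ := nonempty_Ioo.2 hab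
  obtain ⟨s₀, -, hs₀⟩ := h.exists_eq 0 (hyC t₀ ht₀).1
  obtain ⟨c, e, hce, hec, hc, he, hdisj⟩ := h.exists_Ioo_of_notMem hP hPC hPn.nonempty
    (t₀ := s₀) (hs₀ ▸ (hyC t₀ ht₀).2)
  have hec' : e - c < 1 := by linarith [h.lt_add_one_of_nontrivial hPC hPn hec hdisj]
  have hsub : y '' Icc a b ⊆ (fun t : ℝ => γ t) '' Icc c e := by
    rw [← closure_Ioo hab.ne, ← h.closure_image_Ioo (hce.1.trans hce.2)]
    exact (image_closure_subset_closure_image hy).trans (closure_mono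
      (h.subset_image_Ioo hce hec hc he (isPreconnected_Ioo.image _ hy.continuousOn)
        (image_subset_iff.2 hyC) ⟨t₀, ht₀, hs₀.symm⟩))
  obtain ⟨θ, hθ, hθm, hθy⟩ := exists_continuous_lift_of_injOn isCompact_Icc
    h.continuous_lift.continuousOn (h.injOn_lift hec')
    (hy.comp (continuous_subtype_val.comp (continuous_projIcc (h := hab.le))))
    fun t => hsub (mem_image_of_mem _ (projIcc a b hab.le t).2)
  exact ⟨c, e, θ, hec', hθ, hθm, fun t ht => by
    simpa only [Function.comp_apply, projIcc_of_mem hab.le ht] using hθy t⟩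

theorem exists_int_eq_add (h : IsOrientedJordanCurve C γ) {X : Type*} [TopologicalSpace X]
    [ConnectedSpace X] {ς τ : X → ℝ} (hς : Continuous ς) (hτ : Continuous τ)
    (hςτ : ∀ s, γ (ς s : UnitAddCircle) = γ (τ s : UnitAddCircle)) :
    ∃ n : ℤ, ∀ s, ς s = τ s + n := by
  choose n hn using fun s => h.eq_iff.1 (hςτ s)
  have hnc : Continuous n := Int.isClosedEmbedding_coe_real.isInducing.continuous_iff.2
    ((hς.sub hτ).congr fun s => by
      rw [Function.comp_apply, Pi.sub_apply, hn s, add_sub_cancel_left])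
  obtain ⟨s₀⟩ := (inferInstance : Nonempty X)
  exact ⟨n s₀, fun s => by
    rw [hn s, PreconnectedSpace.constant inferInstance hnc (x := s) (y := s₀)]⟩

theorem mem_curveOrientation_iff (h : IsOrientedJordanCurve C γ) {A : Set RSphere}
    {α : I → RSphere} (hα : ParametrizesArc A α) {ς : I → ℝ} (hς : Continuous ς)
    (hας : ∀ s, α s = γ (ς s : UnitAddCircle)) :
    α ∈ curveOrientation γ A ↔ StrictMono ς := by
  refine ⟨fun ⟨_, τ, hτ, hmono, hατ⟩ => ?_, fun hmono => ⟨hα, ς, hς, hmono, hας⟩⟩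
  obtain ⟨n, hn⟩ := h.exists_int_eq_add hς hτ fun s => (hας s).symm.trans (hατ s)
  intro s t hst
  rw [hn s, hn t]
  exact add_lt_add_left (hmono hst) _

theorem curveOrientation_nonempty (h : IsOrientedJordanCurve C γ) {a b : ℝ} (hab : a < b)
    (hinj : InjOn (fun t : ℝ => γ t) (Icc a b)) :
    (curveOrientation γ ((fun t : ℝ => γ t) '' Icc a b)).Nonempty := by
  let τ : I → ℝ := fun s => (iccHomeoI a b hab).symm s
  have hτ : Continuous τ := continuous_subtype_val.comp (iccHomeoI a b hab).symm.continuous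
  have hmono : StrictMono τ := fun s t hst => by
    simp only [τ, iccHomeoI_symm_apply_coe]
    have : (s : ℝ) < t := hst
    nlinarith
  refine ⟨fun s => γ (τ s), ⟨h.continuous_lift.comp hτ, fun s t hst => hmono.injective
    (hinj ((iccHomeoI a b hab).symm s).2 ((iccHomeoI a b hab).symm t).2 hst), ?_⟩,
    τ, hτ, hmono, fun _ => rfl⟩
  rw [show (fun s => γ (τ s)) = (fun t : ℝ => γ t) ∘ (↑) ∘ (iccHomeoI a b hab).symm from rfl,
    range_comp, (iccHomeoI a b hab).symm.surjective.range_comp, Subtype.range_coe]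

theorem mem_pushOrientation_iff (h : IsOrientedJordanCurve C γ) {g : RSphere → RSphere}
    {A : Set RSphere} (hg : InjOn g A) {β : I → RSphere} (hβ : ParametrizesArc (g '' A) β)
    {τ : I → ℝ} (hτ : Continuous τ) (hτA : ∀ s, γ (τ s : UnitAddCircle) ∈ A)
    (hβτ : ∀ s, β s = g (γ (τ s : UnitAddCircle))) :
    β ∈ pushOrientation γ g A ↔ StrictMono τ := by
  constructor
  · rintro ⟨α, hα, rfl⟩
    exact (h.mem_curveOrientation_iff hα.1 hτ fun s =>
      hg (hα.1.range_eq ▸ mem_range_self s) (hτA s) (hβτ s)).1 hα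
  · intro hmono
    obtain rfl : β = g ∘ fun s => γ (τ s : UnitAddCircle) := funext hβτ
    refine ⟨_, ⟨⟨h.continuous_lift.comp hτ, hβ.injective.of_comp, ?_⟩, τ, hτ, hmono, fun _ => rfl⟩,
      rfl⟩
    exact (hg.image_eq_image_iff (range_subset_iff.2 hτA) Subset.rfl).1
      (by rw [← range_comp, hβ.range_eq])

theorem mem_pullOrientation_iff (h : IsOrientedJordanCurve C γ) {f : RSphere → RSphere}
    {E : Set RSphere} (hf : InjOn f E) {β : I → RSphere} (hβ : ParametrizesArc E β)
    {ς : I → ℝ} (hς : Continuous ς) (hβς : ∀ s, f (β s) = γ (ς s : UnitAddCircle)) :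
    β ∈ pullOrientation γ f E ↔ StrictMono ς := by
  have hmem : ∀ s, β s ∈ E := fun s => hβ.range_eq ▸ mem_range_self s
  refine Iff.trans (and_iff_right hβ) (h.mem_curveOrientation_iff ⟨?_, ?_, ?_⟩ hς hβς)
  · exact (h.continuous_lift.comp hς).congr fun s => (hβς s).symm
  · exact fun s t hst => hβ.injective (hf (hmem s) (hmem t) hst)
  · rw [range_comp, hβ.range_eq]

theorem pullOrientation_ne_oppositeOrientation (h : IsOrientedJordanCurve C γ)
    {f : RSphere → RSphere} {E : Set RSphere} (hne : (pullOrientation γ f E).Nonempty) :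
    pullOrientation γ f E ≠ oppositeOrientation (pullOrientation γ f E) := by
  intro e
  obtain ⟨β, hβ⟩ := hne
  have hβ' : β ∘ unitInterval.symm ∈ pullOrientation γ f E :=
    (e ▸ hβ : β ∈ oppositeOrientation (pullOrientation γ f E))
  obtain ⟨-, -, τ, hτ, hmono, hτβ⟩ := hβ
  have hanti : StrictMono (τ ∘ unitInterval.symm) :=
    (h.mem_curveOrientation_iff hβ'.2.1 (hτ.comp unitInterval.continuous_symm)
      fun s => hτβ (unitInterval.symm s)).1 hβ'.2
  have h01 : (0 : I) < 1 := zero_lt_one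
  refine (hmono h01).not_gt ?_
  simpa only [Function.comp_apply, unitInterval.symm_zero, unitInterval.symm_one] using hanti h01

end IsOrientedJordanCurve

theorem ParametrizesArc.comp_symm {E : Set RSphere} {β : I → RSphere} (hβ : ParametrizesArc E β) :
    ParametrizesArc E (β ∘ unitInterval.symm) :=
  ⟨hβ.continuous.comp unitInterval.continuous_symm,
    hβ.injective.comp unitInterval.symm_bijective.injective, by
    rw [unitInterval.symm_bijective.surjective.range_comp, hβ.range_eq]⟩

theorem ParametrizesArc.of_comp_symm {E : Set RSphere} {β : I → RSphere}
    (hβ : ParametrizesArc E (β ∘ unitInterval.symm)) : ParametrizesArc E β := by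
  simpa only [Function.comp_assoc, unitInterval.symm_involutive.comp_self,
    Function.comp_id] using hβ.comp_symm

theorem ParametrizesArc.comp {g : RSphere → RSphere} {A : Set RSphere} {α : I → RSphere}
    (hα : ParametrizesArc A α) (hg : Continuous g) (hgA : InjOn g A) :
    ParametrizesArc (g '' A) (g ∘ α) :=
  ⟨hg.comp hα.continuous, fun s t hst => hα.injective (hgA (hα.range_eq ▸ mem_range_self s)
    (hα.range_eq ▸ mem_range_self t) hst), by rw [range_comp, hα.range_eq]⟩

/-! ### Crossing a curve -/

theorem eq_zero_of_exp_eq_one_of_norm_lt {z : ℂ} (hz : Complex.exp z = 1)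
    (hn : ‖z‖ < 2 * Real.pi) : z = 0 := by
  obtain ⟨n, rfl⟩ := Complex.exp_eq_one_iff.1 hz
  have hpi : 0 < 2 * Real.pi := Real.two_pi_pos
  have hnorm : ‖(n : ℂ) * (2 * Real.pi * Complex.I)‖ = |(n : ℝ)| * (2 * Real.pi) := by
    simp only [norm_mul, Complex.norm_intCast, Complex.norm_ofNat, Complex.norm_real,
      Real.norm_eq_abs, abs_of_pos Real.pi_pos, Complex.norm_I, mul_one]
  rw [hnorm] at hn
  have hn1 : |(n : ℝ)| < 1 := (mul_lt_iff_lt_one_left hpi).1 hn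
  rw [int_eq_zero_of_abs_cast_lt_one hn1, Int.cast_zero, zero_mul]

theorem eventually_norm_ratio_sub_one_le {c : UnitAddCircle → RSphere} (hc : Continuous c) {P : ℂ}
    {a b : ℝ} (hP : ∀ t ∈ Icc a b, c (t : UnitAddCircle) ≠ P) :
    ∀ᶠ p : ℂ × ℂ in 𝓝 (P, P),
      ∀ t ∈ Icc a b, ‖ratio (c (t : UnitAddCircle)) p.1 p.2 - 1‖ ≤ 1 / 2 := by
  refine isCompact_Icc.eventually_forall_of_forall_eventually fun t ht => ?_
  have hcont : ContinuousAt (fun z : (ℂ × ℂ) × ℝ =>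
      ‖ratio (c (z.2 : UnitAddCircle)) z.1.1 z.1.2 - 1‖) ((P, P), t) :=
    ((continuousAt_ratio (u := fun z : (ℂ × ℂ) × ℝ => c (z.2 : UnitAddCircle))
      ((continuous_comp_coe_unitAddCircle hc).comp continuous_snd).continuousAt
      (by fun_prop) (by fun_prop) (hP t ht)).sub continuousAt_const).norm
  have hself : ratio (c (t : UnitAddCircle)) P P = 1 :=
    mul_right_cancel₀ (ratio_ne_zero (hP t ht) (hP t ht))
      ((ratio_mul_ratio (hP t ht)).trans (one_mul _).symm)
  exact (hcont.eventually_lt_const (by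
    simp only [hself, sub_self, norm_zero]
    norm_num : _ < (1 / 2 : ℝ))).mono fun z hz => hz.le

/- Away from `P`, the ratio is close to `1` and its logarithm hardly varies. -/
theorem eventually_norm_loopVar_sub_le {c : UnitAddCircle → RSphere} (hc : Continuous c) {P : ℂ}
    {l r : ℝ} (hlr : r ≤ l + 1) (hP : ∀ t ∈ Icc r (l + 1), c (t : UnitAddCircle) ≠ P) :
    ∀ᶠ p : ℂ × ℂ in 𝓝 (P, P), (p.1 : RSphere) ∉ range c → (p.2 : RSphere) ∉ range c →
      ∀ L, IsLogVariation (fun t => ratio (c (t : UnitAddCircle)) p.1 p.2) l r L →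
        ‖loopVar c p.1 p.2 - L‖ ≤ 3 / 2 := by
  filter_upwards [eventually_norm_ratio_sub_one_le hc hP] with p hp hu hv L hL
  obtain ⟨M, hM⟩ := exists_isLogVariation (a := r) (b := l + 1)
    (continuous_ratio_loop (x := p.1) hc hv).continuousOn fun t _ => ratio_loop_ne_zero hu hv t
  have hsum : loopVar c p.1 p.2 = L + M := (isLogVariation_loopVar_period hc hu hv l).unique
    (hL.trans (continuous_ratio_loop hc hv) (fun t => ratio_loop_ne_zero hu hv t) hM)
  rw [hsum, add_sub_cancel_left]
  have := hM.norm_le_of_norm_sub_one_le le_rfl (by rwa [uIcc_of_le hlr])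
  linarith

theorem exists_ball_norm_ratio_sub_one_le_of_hasStrictDerivAt {F : ℂ → ℂ} {F' P : ℂ}
    (hF : HasStrictDerivAt F F' P) (hF' : F' ≠ 0) :
    ∃ ρ > 0, ∀ z ∈ Metric.ball P ρ, ∀ u ∈ Metric.ball P ρ, ∀ v ∈ Metric.ball P ρ,
      z ≠ u → z ≠ v → ‖(F z - F u) / (F z - F v) * ((z - u) / (z - v))⁻¹ - 1‖ ≤ 1 / 2 := by
  have hsmall := hF.hasStrictFDerivAt.isLittleO.def (c := ‖F'‖ / 8) (by positivity)
  rw [nhds_prod_eq, Filter.eventually_prod_self_iff'] at hsmall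
  obtain ⟨t, ht, hsmall⟩ := hsmall
  obtain ⟨ρ, hρ, hball⟩ := Metric.mem_nhds_iff.1 ht
  refine ⟨ρ, hρ, fun z hz u hu v hv hzu hzv => ?_⟩
  have hfactor : ∀ w ∈ Metric.ball P ρ, z ≠ w →
      ∃ e : ℂ, ‖e‖ ≤ 1 / 8 ∧ F z - F w = F' * (z - w) * (1 + e) := by
    intro w hw hzw
    have hzw' : z - w ≠ 0 := sub_ne_zero.2 hzw
    refine ⟨(F z - F w - (z - w) * F') / (F' * (z - w)), ?_, by field_simp; ring⟩
    have hle := hsmall z (hball hz) w (hball hw)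
    simp only [ContinuousLinearMap.toSpanSingleton_apply, smul_eq_mul] at hle
    rw [norm_div, norm_mul, div_le_iff₀ (by positivity)]
    linarith
  obtain ⟨e₁, he₁, h₁⟩ := hfactor u hu hzu
  obtain ⟨e₂, he₂, h₂⟩ := hfactor v hv hzv
  have hzu' : z - u ≠ 0 := sub_ne_zero.2 hzu
  have hzv' : z - v ≠ 0 := sub_ne_zero.2 hzv
  have hlow : 7 / 8 ≤ ‖1 + e₂‖ := by
    have := norm_sub_norm_le (1 : ℂ) (-e₂)
    rw [norm_neg, norm_one, sub_neg_eq_add] at this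
    linarith
  have he₂0 : 1 + e₂ ≠ 0 := norm_pos_iff.1 (by linarith)
  have hquot : (F z - F u) / (F z - F v) * ((z - u) / (z - v))⁻¹ - 1 = (e₁ - e₂) / (1 + e₂) := by
    rw [h₁, h₂]
    field_simp
    ring
  rw [hquot, norm_div, div_le_iff₀ (by linarith)]
  linarith [norm_sub_le e₁ e₂]

theorem forall_mem_Icc_ne_of_mem_Ioo {c : UnitAddCircle → RSphere} {P : RSphere} {l t₀ r : ℝ}
    (hP : ∀ t ∈ Ioo t₀ (t₀ + 1), c (t : UnitAddCircle) ≠ P) (hl : l < t₀) (hr : t₀ < r) :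
    ∀ t ∈ Icc r (l + 1), c (t : UnitAddCircle) ≠ P :=
  fun t ht => hP t ⟨hr.trans_le ht.1, by linarith [ht.2]⟩

theorem exists_nhds_eventually_norm_ratio_mul_inv_ratio_sub_one_le
    {c₁ c : UnitAddCircle → RSphere} (hc₁ : Continuous c₁) {F : ℂ → ℂ} {F' P : ℂ}
    (hF : HasStrictDerivAt F F' P) (hF' : F' ≠ 0) {t₀ : ℝ} {θ : ℝ → ℝ}
    (hPt₀ : c₁ (t₀ : UnitAddCircle) = P)
    (hcF : ∀ᶠ t : ℝ in 𝓝 t₀, ∀ w : ℂ, c₁ (t : UnitAddCircle) = w → c (θ t : UnitAddCircle) = F w) :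
    ∃ N ∈ 𝓝 P, ∀ᶠ t : ℝ in 𝓝 t₀, ∀ u ∈ N, ∀ v ∈ N,
      (u : RSphere) ∉ range c₁ → (v : RSphere) ∉ range c₁ →
      ‖ratio (c (θ t : UnitAddCircle)) (F u) (F v) *
        (ratio (c₁ (t : UnitAddCircle)) u v)⁻¹ - 1‖ ≤ 1 / 2 := by
  obtain ⟨ρ, hρ, hball⟩ := exists_ball_norm_ratio_sub_one_le_of_hasStrictDerivAt hF hF'
  have hopen : (↑) '' Metric.ball P ρ ∈ 𝓝 (c₁ (t₀ : UnitAddCircle)) := by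
    rw [hPt₀]
    exact OnePoint.isOpenMap_coe.image_mem_nhds (Metric.ball_mem_nhds P hρ)
  refine ⟨_, Metric.ball_mem_nhds P hρ, ?_⟩
  filter_upwards [hcF, (continuous_comp_coe_unitAddCircle hc₁).continuousAt.eventually hopen]
  rintro t hFt ⟨z, hz, hzt⟩ u hu v hv hu' hv'
  rw [hFt z hzt.symm, ← hzt, ratio_coe, ratio_coe]
  exact hball z hz u hu v hv (fun e => hu' ⟨t, e ▸ hzt.symm⟩) fun e => hv' ⟨t, e ▸ hzt.symm⟩

theorem IsLogVariation.norm_sub_le {φ ψ : ℝ → ℂ} {θ : ℝ → ℝ} {l r : ℝ} {L M : ℂ}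
    (hφ : IsLogVariation φ (θ l) (θ r) L) (hψ : IsLogVariation ψ l r M) (hθ : Continuous θ)
    (hlr : l ≤ r) (hmono : MonotoneOn θ (Icc l r))
    (hle : ∀ t ∈ Icc l r, ‖φ (θ t) * (ψ t)⁻¹ - 1‖ ≤ 1 / 2) : ‖L - M‖ ≤ 3 / 2 := by
  have hmaps : MapsTo θ (uIcc l r) (uIcc (θ l) (θ r)) := by
    rw [uIcc_of_le hlr, uIcc_of_le
      (hmono (left_mem_Icc.2 hlr) (right_mem_Icc.2 hlr) hlr)]
    exact hmono.mapsTo_Icc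
  have := ((hφ.comp hθ.continuousOn hmaps).mul hψ.inv).norm_le_of_norm_sub_one_le le_rfl
    (by rwa [uIcc_of_le hlr])
  rw [sub_eq_add_neg]
  linarith

/- The three errors add up to less than `2 * π`. -/
theorem loopVar_eq_of_norm_sub_le {c c' : UnitAddCircle → RSphere} (hc : Continuous c)
    (hc' : Continuous c') {x y x' y' : ℂ} (hx : (x : RSphere) ∉ range c)
    (hy : (y : RSphere) ∉ range c) (hx' : (x' : RSphere) ∉ range c')
    (hy' : (y' : RSphere) ∉ range c') {L L' : ℂ} (hL : ‖loopVar c x y - L‖ ≤ 3 / 2)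
    (hL' : ‖loopVar c' x' y' - L'‖ ≤ 3 / 2) (hLL' : ‖L' - L‖ ≤ 3 / 2) :
    loopVar c x y = loopVar c' x' y' := by
  have hexp : Complex.exp (loopVar c x y - loopVar c' x' y') = 1 := by
    rw [Complex.exp_sub, exp_loopVar hc hx hy, exp_loopVar hc' hx' hy', div_one]
  refine sub_eq_zero.1 (eq_zero_of_exp_eq_one_of_norm_lt hexp ?_)
  calc ‖loopVar c x y - loopVar c' x' y'‖
      = ‖(loopVar c x y - L) - (L' - L) - (loopVar c' x' y' - L')‖ := by congr 1; ring
    _ ≤ ‖loopVar c x y - L‖ + ‖L' - L‖ + ‖loopVar c' x' y' - L'‖ :=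
        (norm_sub_le _ _).trans (add_le_add (norm_sub_le _ _) le_rfl)
    _ < 2 * Real.pi := by linarith [Real.pi_gt_three]

theorem exists_nhds_loopVar_eq_of_strictMonoOn {c₁ c : UnitAddCircle → RSphere}
    (hc₁ : Continuous c₁) (hc : Continuous c) {F : ℂ → ℂ} {F' P : ℂ}
    (hF : HasStrictDerivAt F F' P) (hF' : F' ≠ 0) {t₀ a b : ℝ} (ht₀ : t₀ ∈ Ioo a b) {θ : ℝ → ℝ}
    (hθ : Continuous θ) (hmono : StrictMonoOn θ (Icc a b)) (hPt₀ : c₁ (t₀ : UnitAddCircle) = P)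
    (hP : ∀ t ∈ Ioo t₀ (t₀ + 1), c₁ (t : UnitAddCircle) ≠ P)
    (hFP : ∀ t ∈ Ioo (θ t₀) (θ t₀ + 1), c (t : UnitAddCircle) ≠ F P)
    (hcF : ∀ᶠ t : ℝ in 𝓝 t₀, ∀ w : ℂ, c₁ (t : UnitAddCircle) = w → c (θ t : UnitAddCircle) = F w) :
    ∃ N ∈ 𝓝 P, ∀ u ∈ N, ∀ v ∈ N, (u : RSphere) ∉ range c₁ → (v : RSphere) ∉ range c₁ →
      (F u : RSphere) ∉ range c → (F v : RSphere) ∉ range c →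
      loopVar c₁ u v = loopVar c (F u) (F v) := by
  obtain ⟨N, hN, hnear⟩ :=
    exists_nhds_eventually_norm_ratio_mul_inv_ratio_sub_one_le hc₁ hF hF' hPt₀ hcF
  obtain ⟨δ, hδ, hδb⟩ := Metric.nhds_basis_closedBall.eventually_iff.1
    (hnear.and ((hθ.continuousAt.eventually (Metric.ball_mem_nhds (θ t₀) one_half_pos)).and
      (Filter.inter_mem (Ioo_mem_nhds ht₀.1 ht₀.2) (Metric.ball_mem_nhds t₀ one_half_pos))))
  rw [Real.closedBall_eq_Icc] at hδb
  set l := t₀ - δ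
  set r := t₀ + δ
  have hlt₀ : l < t₀ := sub_lt_self t₀ hδ
  have ht₀r : t₀ < r := lt_add_of_pos_right t₀ hδ
  have hlr : l ≤ r := (hlt₀.trans ht₀r).le
  obtain ⟨-, hθl, -, hl⟩ := hδb (left_mem_Icc.2 hlr)
  obtain ⟨-, hθr, -, hr⟩ := hδb (right_mem_Icc.2 hlr)
  rw [Real.ball_eq_Ioo, mem_Ioo] at hl hr
  rw [Real.dist_eq, abs_lt] at hθl hθr
  have hmono' : StrictMonoOn θ (Icc l r) :=
    hmono.mono fun t ht => Ioo_subset_Icc_self (hδb ht).2.2.1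
  have hθlt₀ : θ l < θ t₀ := hmono' (left_mem_Icc.2 hlr) ⟨hlt₀.le, ht₀r.le⟩ hlt₀
  have hθt₀r : θ t₀ < θ r := hmono' ⟨hlt₀.le, ht₀r.le⟩ (right_mem_Icc.2 hlr) ht₀r
  have hfar := (eventually_norm_loopVar_sub_le hc₁ (by linarith)
    (forall_mem_Icc_ne_of_mem_Ioo hP hlt₀ ht₀r)).and
    ((hF.hasDerivAt.continuousAt.prodMap hF.hasDerivAt.continuousAt :
      ContinuousAt (Prod.map F F) (P, P)).eventually (eventually_norm_loopVar_sub_le hc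
        (by linarith) (forall_mem_Icc_ne_of_mem_Ioo hFP hθlt₀ hθt₀r)))
  rw [nhds_prod_eq, Filter.eventually_prod_self_iff'] at hfar
  obtain ⟨N', hN', hfar⟩ := hfar
  refine ⟨N ∩ N', Filter.inter_mem hN hN', fun u hu v hv hu' hv' hFu hFv => ?_⟩
  obtain ⟨L₁, hL₁⟩ := exists_isLogVariation (a := l) (b := r)
    (continuous_ratio_loop (x := u) hc₁ hv').continuousOn fun t _ => ratio_loop_ne_zero hu' hv' t
  obtain ⟨L, hL⟩ := exists_isLogVariation (a := θ l) (b := θ r)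
    (continuous_ratio_loop (x := F u) hc hFv).continuousOn fun t _ => ratio_loop_ne_zero hFu hFv t
  exact loopVar_eq_of_norm_sub_le hc₁ hc hu' hv' hFu hFv ((hfar u hu.2 v hv.2).1 hu' hv' L₁ hL₁)
    ((hfar u hu.2 v hv.2).2 hFu hFv L hL) (hL.norm_sub_le hL₁ hθ hlr hmono'.monotoneOn
      fun t ht => (hδb ht).1 u hu.1 v hv.1 hu' hv')

theorem loopVar_comp_neg {c : UnitAddCircle → RSphere} (hc : Continuous c) {x y : ℂ}
    (hx : (x : RSphere) ∉ range c) (hy : (y : RSphere) ∉ range c) :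
    loopVar (fun s => c (-s)) x y = -loopVar c x y := by
  have hneg : range (fun s => c (-s)) = range c := (Equiv.neg UnitAddCircle).surjective.range_comp c
  have hc' : Continuous fun s => c (-s) := hc.comp continuous_neg
  have hmaps : MapsTo (fun t : ℝ => -t) (uIcc 0 1) (uIcc (-0) (-1)) :=
    fun t ht => by
      rw [uIcc_of_le zero_le_one] at ht
      rw [neg_zero, uIcc_of_ge (by norm_num)]
      exact ⟨neg_le_neg ht.2, neg_nonpos.2 ht.1⟩
  have hperiod := isLogVariation_loopVar_period hc hx hy (-1)
  rw [neg_add_cancel, ← neg_zero] at hperiod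
  exact (isLogVariation_loopVar hc' (hneg ▸ hx) (hneg ▸ hy)).unique
    (hperiod.symm.comp continuous_neg.continuousOn hmaps)

theorem exists_nhds_loopVar_eq_of_strictAntiOn {c₁ c : UnitAddCircle → RSphere}
    (hc₁ : Continuous c₁) (hc : Continuous c) {F : ℂ → ℂ} {F' P : ℂ}
    (hF : HasStrictDerivAt F F' P) (hF' : F' ≠ 0) {t₀ a b : ℝ} (ht₀ : t₀ ∈ Ioo a b) {θ : ℝ → ℝ}
    (hθ : Continuous θ) (hanti : StrictAntiOn θ (Icc a b)) (hPt₀ : c₁ (t₀ : UnitAddCircle) = P)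
    (hP : ∀ t ∈ Ioo t₀ (t₀ + 1), c₁ (t : UnitAddCircle) ≠ P)
    (hFP : ∀ t ∈ Ioo (θ t₀) (θ t₀ + 1), c (t : UnitAddCircle) ≠ F P)
    (hcF : ∀ᶠ t : ℝ in 𝓝 t₀, ∀ w : ℂ, c₁ (t : UnitAddCircle) = w → c (θ t : UnitAddCircle) = F w) :
    ∃ N ∈ 𝓝 P, ∀ u ∈ N, ∀ v ∈ N, (u : RSphere) ∉ range c₁ → (v : RSphere) ∉ range c₁ →
      (F u : RSphere) ∉ range c → (F v : RSphere) ∉ range c →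
      loopVar c₁ u v = -loopVar c (F u) (F v) := by
  have hneg : range (fun s => c (-s)) = range c := (Equiv.neg UnitAddCircle).surjective.range_comp c
  have hFP' : ∀ t ∈ Ioo (-θ t₀) (-θ t₀ + 1), c (-(t : UnitAddCircle)) ≠ F P := by
    intro t ht
    have hcoe : ((1 - t : ℝ) : UnitAddCircle) = -(t : UnitAddCircle) := by
      rw [AddCircle.coe_sub, unitAddCircle_coe_one, zero_sub]
    rw [← hcoe]
    exact hFP _ ⟨by linarith [ht.2], by linarith [ht.1]⟩
  obtain ⟨N, hN, hloop⟩ := exists_nhds_loopVar_eq_of_strictMonoOn hc₁ (hc.comp continuous_neg) hF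
    hF' ht₀ hθ.neg hanti.neg hPt₀ hP hFP' (hcF.mono fun t ht w hw => by
      simpa only [Function.comp_apply, Pi.neg_apply, AddCircle.coe_neg, neg_neg] using ht w hw)
  refine ⟨N, hN, fun u hu v hv hu' hv' hFu hFv => ?_⟩
  rw [← loopVar_comp_neg hc hFu hFv]
  exact hloop u hu v hv hu' hv' (hneg.symm ▸ hFu) (hneg.symm ▸ hFv)

theorem exists_nhds_loopVar_eq_mul {c₁ c : UnitAddCircle → RSphere}
    (hc₁ : Continuous c₁) (hc : Continuous c) {F : ℂ → ℂ} {F' P : ℂ}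
    (hF : HasStrictDerivAt F F' P) (hF' : F' ≠ 0) {t₀ a b : ℝ} (ht₀ : t₀ ∈ Ioo a b) {θ : ℝ → ℝ}
    (hθ : Continuous θ) {ε : ℂ}
    (hε : StrictMonoOn θ (Icc a b) ∧ ε = 1 ∨ StrictAntiOn θ (Icc a b) ∧ ε = -1)
    (hPt₀ : c₁ (t₀ : UnitAddCircle) = P)
    (hP : ∀ t ∈ Ioo t₀ (t₀ + 1), c₁ (t : UnitAddCircle) ≠ P)
    (hFP : ∀ t ∈ Ioo (θ t₀) (θ t₀ + 1), c (t : UnitAddCircle) ≠ F P)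
    (hcF : ∀ᶠ t : ℝ in 𝓝 t₀, ∀ w : ℂ, c₁ (t : UnitAddCircle) = w → c (θ t : UnitAddCircle) = F w) :
    ∃ N ∈ 𝓝 P, ∀ u ∈ N, ∀ v ∈ N, (u : RSphere) ∉ range c₁ → (v : RSphere) ∉ range c₁ →
      (F u : RSphere) ∉ range c → (F v : RSphere) ∉ range c →
      loopVar c₁ u v = ε * loopVar c (F u) (F v) := by
  rcases hε with ⟨hmono, rfl⟩ | ⟨hanti, rfl⟩
  · simpa only [one_mul] using
      exists_nhds_loopVar_eq_of_strictMonoOn hc₁ hc hF hF' ht₀ hθ hmono hPt₀ hP hFP hcF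
  · simpa only [neg_one_mul] using
      exists_nhds_loopVar_eq_of_strictAntiOn hc₁ hc hF hF' ht₀ hθ hanti hPt₀ hP hFP hcF

/-! ### Sides of a Jordan curve -/

/-- The winding variation `loopVar` of a loop on the sphere, read in the coordinate in which `q`
is `∞`. It allows loops through `∞`, and is meaningful for `x`, `y` off the loop and `x, y ≠ q`. -/
noncomputable def loopVarAt (q : RSphere) (c : UnitAddCircle → RSphere) (x y : RSphere) : ℂ :=
  loopVar (coordAt q ∘ c) (finitePart (coordAt q x)) (finitePart (coordAt q y))

/-- The side of `C` on which the point `x` lies: its component in the complement of `C`. -/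
abbrev side (C : Set RSphere) (x : RSphere) : Set RSphere := connectedComponentIn Cᶜ x

theorem coe_finitePart_coordAt {q x : RSphere} (hx : x ≠ q) :
    (finitePart (coordAt q x) : RSphere) = coordAt q x :=
  coe_finitePart (coordAt_ne_infty hx)

theorem continuousAt_finitePart_coordAt {q x : RSphere} (hx : x ≠ q) :
    ContinuousAt (fun z => finitePart (coordAt q z)) x :=
  ContinuousAt.comp (g := finitePart) (continuousAt_finitePart (coordAt_ne_infty hx))
    (coordAt q).continuous.continuousAt

theorem coe_finitePart_coordAt_notMem_range {q x : RSphere} {c : UnitAddCircle → RSphere}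
    (hx : x ≠ q) (hxc : x ∉ range c) :
    (finitePart (coordAt q x) : RSphere) ∉ range (coordAt q ∘ c) := by
  rw [coe_finitePart_coordAt hx, range_comp, (coordAt q).injective.mem_set_image]
  exact hxc

theorem side_eq_side_iff {C : Set RSphere} {x y : RSphere} (hy : y ∉ C) :
    side C x = side C y ↔ y ∈ side C x :=
  ⟨fun h => h ▸ mem_connectedComponentIn hy, connectedComponentIn_eq⟩

theorem side_image_eq_side_image_iff {C : Set RSphere} {x y : RSphere} (κ : RSphere ≃ₜ RSphere)
    (hx : x ∉ C) (hy : y ∉ C) :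
    side (κ '' C) (κ x) = side (κ '' C) (κ y) ↔ side C x = side C y := by
  have himage {z} (hz : z ∉ C) : side (κ '' C) (κ z) = κ '' side C z := by
    rw [side, ← image_compl_eq κ.bijective]
    exact (κ.image_connectedComponentIn hz).symm
  rw [himage hx, himage hy, κ.injective.image_injective.eq_iff]

theorem loopVarAt_eq_of_side_eq {q : RSphere} {c : UnitAddCircle → RSphere} (hc : Continuous c)
    (hq : q ∈ range c) {x y v : RSphere} (hx : x ∉ range c) (hy : y ∉ range c)
    (hv : v ∉ range c) (hxy : side (range c) x = side (range c) y) :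
    loopVarAt q c x v = loopVarAt q c y v := by
  refine loopVar_eq_of_isPreconnected ((coordAt q).continuous.comp hc)
    (coe_finitePart_coordAt_notMem_range (ne_of_mem_of_not_mem hq hv).symm hv)
    (s := coordAt q '' side (range c) x)
    (isPreconnected_connectedComponentIn.image _ (coordAt q).continuous.continuousOn) ?_ ?_
    (mem_image_of_mem _ (mem_connectedComponentIn hx))
    (mem_image_of_mem _ ((side_eq_side_iff hy).1 hxy))
  · rintro _ ⟨z, hz, rfl⟩ ⟨t, ht⟩
    exact connectedComponentIn_subset _ _ hz ⟨t, (coordAt q).injective ht⟩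
  · rintro ⟨z, hz, hzi⟩
    rw [← coordAt_self q] at hzi
    exact connectedComponentIn_subset _ _ hz ((coordAt q).injective hzi ▸ hq)

theorem loopVarAt_self {q : RSphere} {c : UnitAddCircle → RSphere} (hc : Continuous c)
    (hq : q ∈ range c) {x : RSphere} (hx : x ∉ range c) : loopVarAt q c x x = 0 :=
  loopVar_self ((coordAt q).continuous.comp hc)
    (coe_finitePart_coordAt_notMem_range (ne_of_mem_of_not_mem hq hx).symm hx)

theorem loopVarAt_sub_loopVarAt {q : RSphere} {c : UnitAddCircle → RSphere} (hc : Continuous c)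
    (hq : q ∈ range c) {x y v : RSphere} (hx : x ∉ range c) (hy : y ∉ range c)
    (hv : v ∉ range c) : loopVarAt q c x v - loopVarAt q c y v = loopVarAt q c x y := by
  have hfin {z} (hz : z ∉ range c) :=
    coe_finitePart_coordAt_notMem_range (ne_of_mem_of_not_mem hq hz).symm hz
  exact sub_eq_of_eq_add
    (loopVar_add ((coordAt q).continuous.comp hc) (hfin hx) (hfin hy) (hfin hv)).symm

namespace IsOrientedJordanCurve

variable {C : Set RSphere} {γ : UnitAddCircle → RSphere} {q x y v : RSphere}

theorem loopVarAt_eq_zero_iff (h : IsOrientedJordanCurve C γ) (hq : q ∈ C) (hx : x ∉ C)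
    (hy : y ∉ C) : loopVarAt q γ x y = 0 ↔ side C x = side C y := by
  have himage {z} (hz : z ∉ C) : (finitePart (coordAt q z) : RSphere) ∉ coordAt q '' C := by
    rw [coe_finitePart_coordAt (ne_of_mem_of_not_mem hq hz).symm,
      (coordAt q).injective.mem_set_image]
    exact hz
  constructor
  · intro h0
    have hmem := (h.comp_homeomorph (coordAt q)).mem_connectedComponentIn_of_loopVar_eq_zero
      (himage hx) (himage hy) h0
    rw [← side_eq_side_iff (himage hy),
      coe_finitePart_coordAt (ne_of_mem_of_not_mem hq hx).symm,
      coe_finitePart_coordAt (ne_of_mem_of_not_mem hq hy).symm] at hmem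
    exact (side_image_eq_side_image_iff _ hx hy).1 hmem
  · intro hxy
    rw [← h.range_eq] at hq hx hy hxy
    rw [loopVarAt_eq_of_side_eq h.continuous hq hx hy hy hxy, loopVarAt_self h.continuous hq hy]

theorem side_eq_of_ne_of_ne (h : IsOrientedJordanCurve C γ) (hx : x ∉ C) (hy : y ∉ C) (hv : v ∉ C)
    (hxy : side C x ≠ side C y) (hxv : side C x ≠ side C v) : side C y = side C v := by
  have hq : γ 0 ∈ C := h.mem 0
  let κ := coordAt (γ 0)
  have hfin {z} (hz : z ∉ C) : (finitePart (κ z) : RSphere) = κ z :=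
    coe_finitePart_coordAt (ne_of_mem_of_not_mem hq hz).symm
  have himage {z} (hz : z ∉ C) : (finitePart (κ z) : RSphere) ∉ κ '' C := by
    rw [hfin hz, κ.injective.mem_set_image]
    exact hz
  have hside {z w} (hz : z ∉ C) (hw : w ∉ C) :
      (finitePart (κ w) : RSphere) ∈ side (κ '' C) (finitePart (κ z)) ↔ side C z = side C w := by
    rw [← side_eq_side_iff (himage hw), hfin hz, hfin hw, side_image_eq_side_image_iff κ hz hw]
  exact (hside hy hv).1 <| (h.comp_homeomorph κ).mem_connectedComponentIn_of_notMem (himage hx)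
    (himage hy) (himage hv) ((hside hx hy).not.2 hxy) ((hside hx hv).not.2 hxv)

theorem side_eq_iff_iff (h : IsOrientedJordanCurve C γ) (hx : x ∉ C) (hy : y ∉ C) (hv : v ∉ C) :
    side C y = side C v ↔ (side C x = side C y ↔ side C x = side C v) := by
  constructor
  · intro hyv
    rw [hyv]
  · intro hiff
    by_cases hxy : side C x = side C y
    · exact hxy.symm.trans (hiff.1 hxy)
    · exact h.side_eq_of_ne_of_ne hx hy hv hxy (hiff.not.1 hxy)

theorem exists_side_ne (h : IsOrientedJordanCurve C γ) (hx : x ∉ C) :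
    ∃ y ∉ C, side C x ≠ side C y := by
  obtain ⟨w, hw, hxw⟩ := (h.comp_homeomorph (coordAt (γ 0))).exists_notMem_connectedComponentIn
    ⟨γ 0, h.mem 0, coordAt_self _⟩ (coordAt (γ 0) x)
  obtain ⟨y, rfl⟩ := (coordAt (γ 0)).surjective w
  have hy : y ∉ C := fun hy => hw (mem_image_of_mem _ hy)
  refine ⟨y, hy, fun hxy => hxw ?_⟩
  rwa [← side_eq_side_iff hw, side_image_eq_side_image_iff _ hx hy]

theorem mem_closure_side (h : IsOrientedJordanCurve C γ) (hq : q ∈ C) (hx : x ∉ C) :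
    q ∈ closure (side C x) := by
  have hmem := (h.comp_homeomorph (coordAt (γ 0))).mem_closure_connectedComponentIn
    ⟨γ 0, h.mem 0, coordAt_self _⟩ (mem_image_of_mem _ hq)
    (((coordAt (γ 0)).injective.mem_set_image).not.2 hx)
  rwa [← image_compl_eq (coordAt _).bijective, ← (coordAt _).image_connectedComponentIn hx,
    ← (coordAt _).image_closure, (coordAt _).injective.mem_set_image] at hmem

end IsOrientedJordanCurve

theorem HasRatPair.exists_hasStrictDerivAt_coordAt {f : RSphere → RSphere} {d : ℕ}
    (hf : HasRatPair f d) {p q : RSphere} (hpq : p ≠ q) (hfpq : f p ≠ q)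
    (hp : ¬ IsCriticalPoint f p) :
    ∃ (F : ℂ → ℂ) (F' : ℂ), F' ≠ 0 ∧ HasStrictDerivAt F F' (finitePart (coordAt q p)) ∧
      ∀ᶠ z in 𝓝 p, coordAt q (f z) = F (finitePart (coordAt q z)) := by
  have hP := coe_finitePart_coordAt hpq
  have hconj (z) : (coordAt q ∘ f ∘ (coordAt q).symm) (coordAt q z) = coordAt q (f z) := by
    simp only [Function.comp_apply, Homeomorph.symm_apply_apply]
  obtain ⟨F, F', hF', hF, hconjF⟩ := (hf.coordAt_conj q q).exists_hasStrictDerivAt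
    (z := finitePart (coordAt q p)) (by rw [hP, hconj]; exact coordAt_ne_infty hfpq)
    (by rw [hP]; exact not_not.1 (mt (isCriticalPoint_homeomorph_iff _ _).1 hp))
  refine ⟨F, F', hF', hF, ?_⟩
  filter_upwards [(continuousAt_finitePart_coordAt hpq).eventually hconjF, isOpen_ne.mem_nhds hpq]
    with z hz hzq
  rw [← hz, coe_finitePart_coordAt hzq, hconj]

theorem HasRatPair.exists_nhds_loopVarAt_eq_mul {f : RSphere → RSphere} {d : ℕ}
    (hf : HasRatPair f d) {c₁ c : UnitAddCircle → RSphere} (hc₁ : Continuous c₁)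
    (hc : Continuous c) {p q : RSphere} (hq₁ : q ∈ range c₁) (hq : q ∈ range c) (hpq : p ≠ q)
    (hfpq : f p ≠ q) (hp : ¬ IsCriticalPoint f p) {t₀ a b : ℝ} (ht₀ : t₀ ∈ Ioo a b) {θ : ℝ → ℝ}
    (hθ : Continuous θ) {ε : ℂ}
    (hε : StrictMonoOn θ (Icc a b) ∧ ε = 1 ∨ StrictAntiOn θ (Icc a b) ∧ ε = -1)
    (hpt₀ : c₁ (t₀ : UnitAddCircle) = p)
    (hc₁p : ∀ t ∈ Ioo t₀ (t₀ + 1), c₁ (t : UnitAddCircle) ≠ p)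
    (hcp : ∀ t ∈ Ioo (θ t₀) (θ t₀ + 1), c (t : UnitAddCircle) ≠ f p)
    (hcf : ∀ t ∈ Icc a b, c (θ t : UnitAddCircle) = f (c₁ (t : UnitAddCircle))) :
    ∃ N ∈ 𝓝 p, ∀ u ∈ N, ∀ v ∈ N, u ∉ range c₁ → v ∉ range c₁ → f u ∉ range c → f v ∉ range c →
      loopVarAt q c₁ u v = ε * loopVarAt q c (f u) (f v) := by
  have hP := coe_finitePart_coordAt hpq
  obtain ⟨F, F', hF', hF, hfF⟩ := hf.exists_hasStrictDerivAt_coordAt hpq hfpq hp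
  have hcF : ∀ᶠ t : ℝ in 𝓝 t₀, ∀ w : ℂ, (coordAt q ∘ c₁) (t : UnitAddCircle) = w →
      (coordAt q ∘ c) (θ t : UnitAddCircle) = F w := by
    filter_upwards [(continuous_comp_coe_unitAddCircle hc₁).continuousAt.eventually (hpt₀ ▸ hfF),
      Ioo_mem_nhds ht₀.1 ht₀.2] with t ht htab w hw
    rw [Function.comp_apply] at hw ⊢
    rw [hcf t (Ioo_subset_Icc_self htab), ht, hw, finitePart_coe]
  obtain ⟨N, hN, hloop⟩ := exists_nhds_loopVar_eq_mul ((coordAt q).continuous.comp hc₁)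
    ((coordAt q).continuous.comp hc) hF hF' ht₀ hθ hε (by rw [hP, ← hpt₀, Function.comp_apply])
    (fun t ht => by rw [hP]; exact (coordAt q).injective.ne (hc₁p t ht))
    (fun t ht => by rw [← hfF.self_of_nhds]; exact (coordAt q).injective.ne (hcp t ht)) hcF
  refine ⟨_, ((continuousAt_finitePart_coordAt hpq).eventually hN).and hfF,
    fun u ⟨huN, hu⟩ v ⟨hvN, hv⟩ hu₁ hv₁ hfu hfv => ?_⟩
  have hnotMem {c : UnitAddCircle → RSphere} (hq : q ∈ range c) {z} (hz : z ∉ range c) :=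
    coe_finitePart_coordAt_notMem_range (ne_of_mem_of_not_mem hq hz).symm hz
  have hFu : F (finitePart (coordAt q u)) = finitePart (coordAt q (f u)) := by
    rw [hu, finitePart_coe]
  have hFv : F (finitePart (coordAt q v)) = finitePart (coordAt q (f v)) := by
    rw [hv, finitePart_coe]
  have hloop' := hloop _ huN _ hvN (hnotMem hq₁ hu₁) (hnotMem hq₁ hv₁)
  rw [hFu, hFv] at hloop'
  exact hloop' (hnotMem hq hfu) (hnotMem hq hfv)

/-! ### Elementary deformations -/

theorem map_mem_postcriticalSet {f : RSphere → RSphere} {x : RSphere}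
    (hx : x ∈ postcriticalSet f) : f x ∈ postcriticalSet f := by
  obtain ⟨c, hc, n, hn, rfl⟩ := hx
  exact ⟨c, hc, n + 1, by omega, Function.iterate_succ_apply' f n c⟩

theorem IsCriticalPoint.map_mem_postcriticalSet {f : RSphere → RSphere} {z : RSphere}
    (hz : IsCriticalPoint f z) : f z ∈ postcriticalSet f :=
  ⟨z, hz, 1, le_rfl, rfl⟩

theorem IsPseudoIsotopyRel.surjective_endMap {P : Set RSphere} {H : RSphere × I → RSphere}
    (h : IsPseudoIsotopyRel P H) : Function.Surjective (endMap H) := by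
  intro y
  have hclosed : IsClosed (Prod.snd '' (H ⁻¹' {y})) :=
    ((isClosed_singleton.preimage h.continuous).isCompact.image continuous_snd).isClosed
  have hsub : Iio (1 : I) ⊆ Prod.snd '' (H ⁻¹' {y}) := fun t ht => by
    obtain ⟨x, hx⟩ := (h.homeo t ht).surjective y
    exact ⟨(x, t), hx, rfl⟩
  have hone : (1 : I) ∈ closure (Iio (1 : I)) := by
    rw [closure_Iio' ⟨0, zero_lt_one⟩]
    exact mem_Iic.2 le_rfl
  obtain ⟨⟨x, t⟩, hx, rfl⟩ := hclosed.closure_subset_iff.2 hsub hone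
  exact ⟨x, hx⟩

/-- The standing assumptions on a rational map `f` of degree `d`, a Jordan curve `C` through its
postcritical points parametrized by `γ`, and an elementary deformation `H` of `C`. -/
structure IsDeformationSetting (f : RSphere → RSphere) (d : ℕ) (C : Set RSphere)
    (γ : UnitAddCircle → RSphere) (H : RSphere × I → RSphere) : Prop where
  rat : HasRatPair f d
  two_le : 2 ≤ d
  finite : (postcriticalSet f).Finite
  curve : IsOrientedJordanCurve C γ
  post_subset : postcriticalSet f ⊆ C
  deformation : IsElementaryDeformation f C H

namespace IsDeformationSetting

variable {f : RSphere → RSphere} {d : ℕ} {C : Set RSphere} {γ : UnitAddCircle → RSphere}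
  {H : RSphere × I → RSphere} {q x y z : RSphere}

theorem continuous_map (S : IsDeformationSetting f d C γ H) : Continuous f :=
  S.rat.continuous (one_le_two.trans S.two_le)

theorem isOpenMap_map (S : IsDeformationSetting f d C γ H) : IsOpenMap f :=
  S.rat.isOpenMap (one_le_two.trans S.two_le)

theorem post_nontrivial (S : IsDeformationSetting f d C γ H) : (postcriticalSet f).Nontrivial :=
  nontrivial_postcriticalSet S.rat S.two_le

theorem post_subset_preimage (S : IsDeformationSetting f d C γ H) :
    postcriticalSet f ⊆ f ⁻¹' C :=
  fun _ hx => S.post_subset (map_mem_postcriticalSet hx)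

theorem continuous_endMap (S : IsDeformationSetting f d C γ H) : Continuous (endMap H) :=
  S.deformation.pseudoIsotopy.continuous.comp (by fun_prop : Continuous fun x => (x, (1 : I)))

theorem surjective_endMap (S : IsDeformationSetting f d C γ H) :
    Function.Surjective (endMap H) :=
  S.deformation.pseudoIsotopy.surjective_endMap

theorem map_endMap_mem (S : IsDeformationSetting f d C γ H) (hz : z ∈ C) : f (endMap H z) ∈ C :=
  S.deformation.image_eq.subset (mem_image_of_mem _ hz)

theorem notMem_of_endMap_notMem (S : IsDeformationSetting f d C γ H)
    (hx : endMap H x ∉ f ⁻¹' C) : x ∉ C :=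
  fun h => hx (S.map_endMap_mem h)

theorem post_subset_vertexPreimages (S : IsDeformationSetting f d C γ H) :
    postcriticalSet f ⊆ vertexPreimages f C H := fun x hx => by
  have hfix : endMap H x = x := S.deformation.pseudoIsotopy.rel x hx 1
  exact ⟨show f (endMap H x) ∈ _ from hfix.symm ▸ map_mem_postcriticalSet hx, S.post_subset hx⟩

theorem notMem_oneVertices (S : IsDeformationSetting f d C γ H) (hz : z ∉ f ⁻¹' C) :
    z ∉ oneVertices f :=
  fun h => hz (S.post_subset h)

theorem finite_oneVertices (S : IsDeformationSetting f d C γ H) : (oneVertices f).Finite := by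
  refine (S.deformation.finite.image (endMap H)).subset fun v hv => ?_
  obtain ⟨z, hz, rfl⟩ := S.deformation.image_eq.superset (S.post_subset hv)
  exact ⟨z, ⟨hv, hz⟩, rfl⟩

theorem injOn_endMap (S : IsDeformationSetting f d C γ H) :
    InjOn (endMap H) (C \ vertexPreimages f C H) := by
  obtain ⟨e, he⟩ := S.deformation.homeo
  intro x hx y hy hxy
  have : e ⟨x, hx⟩ = e ⟨y, hy⟩ := Subtype.ext (by rw [he, he]; exact hxy)
  exact congrArg Subtype.val (e.injective this)

theorem continuous_endLoop (S : IsDeformationSetting f d C γ H) : Continuous (endMap H ∘ γ) :=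
  S.continuous_endMap.comp S.curve.continuous

theorem range_endLoop (S : IsDeformationSetting f d C γ H) : range (endMap H ∘ γ) = f ⁻¹' C := by
  rw [range_comp, S.curve.range_eq, S.deformation.image_eq]

theorem dense_compl_preimage (S : IsDeformationSetting f d C γ H) : Dense (f ⁻¹' C)ᶜ := by
  rw [← preimage_compl]
  obtain ⟨w, hw⟩ := S.curve.exists_notMem
  have hC : Dense Cᶜ := fun z => by
    by_cases hz : z ∈ C
    · exact closure_mono (connectedComponentIn_subset _ _) (S.curve.mem_closure_side hz hw)
    · exact subset_closure hz
  exact hC.preimage S.isOpenMap_map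

theorem homotopy_ne (S : IsDeformationSetting f d C γ H) (hq : q ∈ postcriticalSet f)
    (hx : endMap H x ∉ f ⁻¹' C) (t : I) : H (x, t) ≠ q := by
  intro e
  have hH := S.deformation.pseudoIsotopy
  rcases lt_or_eq_of_le t.2.2 with ht | ht
  · have : x = q := (hH.homeo t ht).injective (e.trans (hH.rel q hq t).symm)
    exact S.notMem_of_endMap_notMem hx (this ▸ S.post_subset hq)
  · obtain rfl : t = 1 := Subtype.ext ht
    exact hx (show H (x, 1) ∈ f ⁻¹' C from e ▸ S.post_subset_preimage hq)

theorem homotopy_notMem_range (S : IsDeformationSetting f d C γ H)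
    (hx : endMap H x ∉ f ⁻¹' C) (t : I) :
    H (x, t) ∉ range fun s : UnitAddCircle => H (γ s, t) := by
  rintro ⟨s, hs⟩
  rcases lt_or_eq_of_le t.2.2 with ht | ht
  · have : γ s = x := (S.deformation.pseudoIsotopy.homeo t ht).injective hs
    exact S.notMem_of_endMap_notMem hx (this ▸ S.curve.mem s)
  · obtain rfl : t = 1 := Subtype.ext ht
    have hs' : endMap H (γ s) = endMap H x := hs
    exact hx (hs' ▸ S.map_endMap_mem (S.curve.mem s))

theorem loopVarAt_endMap (S : IsDeformationSetting f d C γ H) (hq : q ∈ postcriticalSet f)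
    (hx : endMap H x ∉ f ⁻¹' C) (hy : endMap H y ∉ f ⁻¹' C) :
    loopVarAt q (endMap H ∘ γ) (endMap H x) (endMap H y) = loopVarAt q γ x y := by
  have hH := S.deformation.pseudoIsotopy
  have hcont {x} (hx : endMap H x ∉ f ⁻¹' C) :
      Continuous fun t : I => finitePart (coordAt q (H (x, t))) :=
    continuous_iff_continuousAt.2 fun t =>
      ContinuousAt.comp (g := fun z => finitePart (coordAt q z))
        (continuousAt_finitePart_coordAt (S.homotopy_ne hq hx t))
        (hH.continuous.comp (by fun_prop)).continuousAt
  have hnotMem {x} (hx : endMap H x ∉ f ⁻¹' C) (t : I) :=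
    coe_finitePart_coordAt_notMem_range (S.homotopy_ne hq hx t) (S.homotopy_notMem_range hx t)
  have hloop := loopVar_eq_of_homotopy (c := fun t s => coordAt q (H (γ s, t)))
    ((coordAt q).continuous.comp (hH.continuous.comp
      ((S.curve.continuous.comp continuous_snd).prodMk continuous_fst)))
    (hcont hx) (hcont hy) (hnotMem hx) (hnotMem hy)
  simp only [hH.start] at hloop
  exact hloop.symm

end IsDeformationSetting

/-! ### Edges -/

/-- `γ` maps `[a, b]` onto an arc between consecutive points deformed to `1`-vertices, and `θ`
expresses `f ∘ H₁` on this arc in the parameter of `γ`: the `1`-edge `H₁(γ([a, b]))` carries the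
same orientation from `H₁` and from `f` exactly if `θ` is increasing. -/
structure IsEdgeChart (f : RSphere → RSphere) (C : Set RSphere) (γ : UnitAddCircle → RSphere)
    (H : RSphere × I → RSphere) (a b : ℝ) (θ : ℝ → ℝ) : Prop where
  lt : a < b
  left_mem : γ (a : UnitAddCircle) ∈ vertexPreimages f C H
  right_mem : γ (b : UnitAddCircle) ∈ vertexPreimages f C H
  notMem : ∀ t ∈ Ioo a b, γ (t : UnitAddCircle) ∉ vertexPreimages f C H
  injOn : InjOn (fun t : ℝ => f (endMap H (γ (t : UnitAddCircle)))) (Icc a b)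
  continuous : Continuous θ
  eq : ∀ t ∈ Icc a b, γ (θ t : UnitAddCircle) = f (endMap H (γ (t : UnitAddCircle)))

namespace IsEdgeChart

variable {f : RSphere → RSphere} {C : Set RSphere} {γ : UnitAddCircle → RSphere}
  {H : RSphere × I → RSphere} {a b : ℝ} {θ : ℝ → ℝ}

theorem strictMonoOn_or_strictAntiOn (h : IsEdgeChart f C γ H a b θ) :
    StrictMonoOn θ (Icc a b) ∨ StrictAntiOn θ (Icc a b) :=
  h.continuous.continuousOn.strictMonoOn_of_injOn_Icc' h.lt.le fun s hs t ht hst =>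
    h.injOn hs ht (by simp only [← h.eq s hs, ← h.eq t ht, hst])

theorem not_strictMonoOn_iff (h : IsEdgeChart f C γ H a b θ) :
    ¬ StrictMonoOn θ (Icc a b) ↔ StrictAntiOn θ (Icc a b) := by
  refine ⟨h.strictMonoOn_or_strictAntiOn.resolve_left, fun hanti hmono => ?_⟩
  have ha := left_mem_Icc.2 h.lt.le
  have hb := right_mem_Icc.2 h.lt.le
  exact (hanti ha hb h.lt).not_gt (hmono ha hb h.lt)

theorem injOn_lift (h : IsEdgeChart f C γ H a b θ) : InjOn (fun t : ℝ => γ t) (Icc a b) :=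
  InjOn.of_comp (g := fun z => f (endMap H z)) h.injOn

theorem injOn_endMap (h : IsEdgeChart f C γ H a b θ) :
    InjOn (endMap H) ((fun t : ℝ => γ t) '' Icc a b) := by
  rintro _ ⟨s, hs, rfl⟩ _ ⟨t, ht, rfl⟩ hst
  exact congrArg (fun t : ℝ => γ t) (h.injOn hs ht (congrArg f hst))

theorem injOn_map (h : IsEdgeChart f C γ H a b θ) :
    InjOn f (endMap H '' ((fun t : ℝ => γ t) '' Icc a b)) := by
  rintro _ ⟨_, ⟨s, hs, rfl⟩, rfl⟩ _ ⟨_, ⟨t, ht, rfl⟩, rfl⟩ hst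
  exact congrArg (fun t : ℝ => endMap H (γ t)) (h.injOn hs ht hst)

theorem le_add_one (h : IsEdgeChart f C γ H a b θ) : b ≤ a + 1 := by
  by_contra! hab
  have hmem : a + 1 ∈ Icc a b := ⟨by linarith, hab.le⟩
  have : a = a + 1 := h.injOn_lift (left_mem_Icc.2 h.lt.le) hmem
    (congrArg γ (AddCircle.coe_add_period 1 a)).symm
  linarith

end IsEdgeChart

namespace IsDeformationSetting

variable {f : RSphere → RSphere} {d : ℕ} {C : Set RSphere} {γ : UnitAddCircle → RSphere}
  {H : RSphere × I → RSphere} {A : Set RSphere} {a b t₀ : ℝ} {θ : ℝ → ℝ} {β : I → RSphere}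

theorem exists_nhds_injOn_lift (S : IsDeformationSetting f d C γ H)
    (ht₀ : γ (t₀ : UnitAddCircle) ∉ vertexPreimages f C H) :
    ∃ U ∈ 𝓝 t₀, InjOn (fun t : ℝ => f (endMap H (γ t))) U := by
  have hp : ¬ IsCriticalPoint f (endMap H (γ t₀)) := fun hcrit =>
    ht₀ ⟨hcrit.map_mem_postcriticalSet, S.curve.mem _⟩
  obtain ⟨V, hV, hinj⟩ := not_not.1 hp
  refine ⟨_, ((S.continuous_endMap.comp S.curve.continuous_lift).continuousAt.eventually hV).and
    ((S.curve.continuous_lift.continuousAt.eventually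
      (S.deformation.finite.isClosed.isOpen_compl.mem_nhds ht₀)).and
    (Icc_mem_nhds (sub_lt_self t₀ (by norm_num : (0 : ℝ) < 1 / 3))
      (lt_add_of_pos_right t₀ (by norm_num : (0 : ℝ) < 1 / 3)))), ?_⟩
  rintro r ⟨hrV, hrW, hr⟩ s ⟨hsV, hsW, hs⟩ hrs
  exact S.curve.injOn_lift (by linarith) hr hs
    (S.injOn_endMap ⟨S.curve.mem _, hrW⟩ ⟨S.curve.mem _, hsW⟩ (hinj hrV hsV hrs))

theorem exists_isEdgeChart (S : IsDeformationSetting f d C γ H)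
    (ht₀ : γ (t₀ : UnitAddCircle) ∉ vertexPreimages f C H) :
    ∃ a b θ, t₀ ∈ Ioo a b ∧ IsEdgeChart f C γ H a b θ := by
  obtain ⟨a, b, hab, -, ha, hb, hW⟩ := S.curve.exists_Ioo_of_notMem
    S.deformation.finite.isClosed inter_subset_right
    (S.post_nontrivial.nonempty.mono S.post_subset_vertexPreimages) ht₀
  obtain ⟨c, e, θ, hce, hθ, hθce, hθeq⟩ := S.curve.exists_continuous_lift_Icc S.finite.isClosed
    S.post_subset S.post_nontrivial (hab.1.trans hab.2)
    (S.continuous_map.comp (S.continuous_endMap.comp S.curve.continuous_lift))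
    fun t ht => ⟨S.map_endMap_mem (S.curve.mem _), fun hpost => hW t ht ⟨hpost, S.curve.mem _⟩⟩
  have hθinj : InjOn θ (Icc a b) := by
    refine injOn_Icc_of_locally_injOn hθ.continuousOn fun t ht => ?_
    obtain ⟨U, hU, hinj⟩ := S.exists_nhds_injOn_lift (hW t ht)
    refine ⟨U ∩ Icc a b, Filter.inter_mem hU (Icc_mem_nhds ht.1 ht.2), fun r hr s hs hrs => ?_⟩
    have heq := congrArg (fun t : ℝ => γ t) hrs
    simp only [hθeq r hr.2, hθeq s hs.2] at heq
    exact hinj hr.1 hs.1 heq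
  refine ⟨a, b, θ, hab, hab.1.trans hab.2, ha, hb, hW, fun s hs t ht hst => ?_, hθ, hθeq⟩
  refine hθinj hs ht (S.curve.injOn_lift hce (hθce s) (hθce t) ?_)
  simp only [hθeq s hs, hθeq t ht]
  exact hst

theorem exists_notMem_vertexPreimages (S : IsDeformationSetting f d C γ H) :
    ∃ t : ℝ, γ (t : UnitAddCircle) ∉ vertexPreimages f C H := by
  by_contra! hall
  have hfin : ((fun t : ℝ => γ t) '' Icc 0 (1 / 2)).Finite :=
    S.deformation.finite.subset (image_subset_iff.2 fun t _ => hall t)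
  exact Icc_infinite (by norm_num : (0 : ℝ) < 1 / 2)
    (hfin.of_finite_image (S.curve.injOn_lift (by norm_num)))

theorem closure_connectedComponentIn_eq_image_Icc (S : IsDeformationSetting f d C γ H)
    (h : IsEdgeChart f C γ H a b θ) (ht₀ : t₀ ∈ Ioo a b) :
    closure (connectedComponentIn (C \ vertexPreimages f C H) (γ t₀)) =
      (fun t : ℝ => γ t) '' Icc a b := by
  rw [S.curve.connectedComponentIn_eq_image_Ioo ht₀ h.le_add_one h.left_mem h.right_mem h.notMem,
    S.curve.closure_image_Ioo h.lt]

theorem exists_isEdgeChart_of_isDeformedArc (S : IsDeformationSetting f d C γ H)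
    (hA : IsDeformedArc f C H A) :
    ∃ a b θ, IsEdgeChart f C γ H a b θ ∧ A = (fun t : ℝ => γ t) '' Icc a b := by
  obtain ⟨_, ⟨x, hx, rfl⟩, rfl⟩ := hA
  obtain ⟨t, -, rfl⟩ := S.curve.exists_eq 0 hx.1
  obtain ⟨a, b, θ, ht, h⟩ := S.exists_isEdgeChart hx.2
  exact ⟨a, b, θ, h, S.closure_connectedComponentIn_eq_image_Icc h ht⟩

theorem isDeformedArc_image_Icc (S : IsDeformationSetting f d C γ H)
    (h : IsEdgeChart f C γ H a b θ) : IsDeformedArc f C H ((fun t : ℝ => γ t) '' Icc a b) := by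
  obtain ⟨t, ht⟩ := exists_between h.lt
  exact ⟨_, ⟨_, ⟨S.curve.mem _, h.notMem t ht⟩, rfl⟩,
    (S.closure_connectedComponentIn_eq_image_Icc h ht).symm⟩

theorem image_connectedComponentIn (S : IsDeformationSetting f d C γ H) {x : RSphere}
    (hx : x ∈ C \ vertexPreimages f C H) :
    endMap H '' connectedComponentIn (C \ vertexPreimages f C H) x =
      connectedComponentIn (f ⁻¹' C \ oneVertices f) (endMap H x) := by
  obtain ⟨e, he⟩ := S.deformation.homeo
  have himage : e '' connectedComponent ⟨x, hx⟩ = connectedComponent (e ⟨x, hx⟩) := by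
    have := e.image_connectedComponentIn (mem_univ (⟨x, hx⟩ : ↥(C \ vertexPreimages f C H)))
    simpa only [connectedComponentIn_univ, image_univ, e.surjective.range_eq] using this
  rw [← he ⟨x, hx⟩, connectedComponentIn_eq_image (e ⟨x, hx⟩).2, connectedComponentIn_eq_image hx,
    Subtype.coe_eta, ← himage, image_image, image_image]
  exact image_congr fun z _ => (he z).symm

theorem isOneEdge_image (S : IsDeformationSetting f d C γ H) (hA : IsDeformedArc f C H A) :
    IsOneEdge f C (endMap H '' A) := by
  obtain ⟨_, ⟨x, hx, rfl⟩, rfl⟩ := hA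
  obtain ⟨e, he⟩ := S.deformation.homeo
  refine ⟨_, ⟨endMap H x, he ⟨x, hx⟩ ▸ (e ⟨x, hx⟩).2, rfl⟩, ?_⟩
  rw [← S.image_connectedComponentIn hx]
  exact image_closure_of_isCompact isClosed_closure.isCompact S.continuous_endMap.continuousOn

theorem exists_continuous_lift_of_parametrizesArc (S : IsDeformationSetting f d C γ H)
    (h : IsEdgeChart f C γ H a b θ)
    (hβ : ParametrizesArc (endMap H '' ((fun t : ℝ => γ t) '' Icc a b)) β) :
    ∃ τ : I → ℝ, Continuous τ ∧ (∀ s, τ s ∈ Icc a b) ∧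
      ∀ s, endMap H (γ (τ s : UnitAddCircle)) = β s :=
  exists_continuous_lift_of_injOn isCompact_Icc
    (S.continuous_endMap.comp S.curve.continuous_lift).continuousOn
    (InjOn.of_comp h.injOn) hβ.continuous fun s =>
      (image_image (endMap H) (fun t : ℝ => γ t) (Icc a b)).subset
        (hβ.range_eq.subset (mem_range_self s))

theorem mem_pushOrientation_iff_strictMono (S : IsDeformationSetting f d C γ H)
    (h : IsEdgeChart f C γ H a b θ)
    (hβ : ParametrizesArc (endMap H '' ((fun t : ℝ => γ t) '' Icc a b)) β) {τ : I → ℝ}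
    (hτ : Continuous τ) (hτab : ∀ s, τ s ∈ Icc a b)
    (hβτ : ∀ s, endMap H (γ (τ s : UnitAddCircle)) = β s) :
    β ∈ pushOrientation γ (endMap H) ((fun t : ℝ => γ t) '' Icc a b) ↔ StrictMono τ :=
  S.curve.mem_pushOrientation_iff h.injOn_endMap hβ hτ (fun s => mem_image_of_mem _ (hτab s))
    fun s => (hβτ s).symm

theorem mem_pullOrientation_iff_strictMono (S : IsDeformationSetting f d C γ H)
    (h : IsEdgeChart f C γ H a b θ)
    (hβ : ParametrizesArc (endMap H '' ((fun t : ℝ => γ t) '' Icc a b)) β) {τ : I → ℝ}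
    (hτ : Continuous τ) (hτab : ∀ s, τ s ∈ Icc a b)
    (hβτ : ∀ s, endMap H (γ (τ s : UnitAddCircle)) = β s) :
    β ∈ pullOrientation γ f (endMap H '' ((fun t : ℝ => γ t) '' Icc a b)) ↔
      StrictMono (θ ∘ τ) :=
  S.curve.mem_pullOrientation_iff h.injOn_map hβ (h.continuous.comp hτ) fun s => by
    rw [Function.comp_apply, h.eq _ (hτab s), hβτ s]

theorem parametrizesArc_of_mem_pushOrientation (S : IsDeformationSetting f d C γ H)
    (h : IsEdgeChart f C γ H a b θ)
    (hβ : β ∈ pushOrientation γ (endMap H) ((fun t : ℝ => γ t) '' Icc a b)) :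
    ParametrizesArc (endMap H '' ((fun t : ℝ => γ t) '' Icc a b)) β := by
  obtain ⟨α, ⟨hα, -⟩, rfl⟩ := hβ
  exact hα.comp S.continuous_endMap h.injOn_endMap

theorem pushOrientation_eq_of_strictMonoOn (S : IsDeformationSetting f d C γ H)
    (h : IsEdgeChart f C γ H a b θ) (hθ : StrictMonoOn θ (Icc a b)) :
    pushOrientation γ (endMap H) ((fun t : ℝ => γ t) '' Icc a b) =
      pullOrientation γ f (endMap H '' ((fun t : ℝ => γ t) '' Icc a b)) := by
  ext β
  refine (and_iff_right_of_imp (S.parametrizesArc_of_mem_pushOrientation h)).symm.trans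
    (Iff.trans (and_congr_right fun hβ => ?_) (and_iff_right_of_imp And.left))
  obtain ⟨τ, hτ, hτab, hβτ⟩ := S.exists_continuous_lift_of_parametrizesArc h hβ
  rw [S.mem_pushOrientation_iff_strictMono h hβ hτ hτab hβτ,
    S.mem_pullOrientation_iff_strictMono h hβ hτ hτab hβτ]
  simp only [StrictMono, Function.comp_apply, hθ.lt_iff_lt (hτab _) (hτab _)]

theorem pushOrientation_eq_of_strictAntiOn (S : IsDeformationSetting f d C γ H)
    (h : IsEdgeChart f C γ H a b θ) (hθ : StrictAntiOn θ (Icc a b)) :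
    pushOrientation γ (endMap H) ((fun t : ℝ => γ t) '' Icc a b) = oppositeOrientation
      (pullOrientation γ f (endMap H '' ((fun t : ℝ => γ t) '' Icc a b))) := by
  ext β
  refine (and_iff_right_of_imp (S.parametrizesArc_of_mem_pushOrientation h)).symm.trans
    (Iff.trans (and_congr_right fun hβ => ?_)
      (and_iff_right_of_imp fun hβ => hβ.1.of_comp_symm))
  obtain ⟨τ, hτ, hτab, hβτ⟩ := S.exists_continuous_lift_of_parametrizesArc h hβ
  rw [S.mem_pushOrientation_iff_strictMono h hβ hτ hτab hβτ, oppositeOrientation, mem_ofPred_eq,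
    S.mem_pullOrientation_iff_strictMono h hβ.comp_symm
      (hτ.comp unitInterval.continuous_symm) (fun s => hτab _) fun s => hβτ _]
  refine ⟨fun hmono s t hst => ?_, fun hmono s t hst => ?_⟩
  · exact (hθ.lt_iff_gt (hτab _) (hτab _)).2 (hmono (unitInterval.symm_lt_symm.2 hst))
  · have := (hθ.lt_iff_gt (hτab _) (hτab _)).1 (hmono (unitInterval.symm_lt_symm.2 hst))
    simpa only [Function.comp_apply, unitInterval.symm_symm] using this

theorem pullOrientation_nonempty (S : IsDeformationSetting f d C γ H)
    (h : IsEdgeChart f C γ H a b θ) :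
    (pullOrientation γ f (endMap H '' ((fun t : ℝ => γ t) '' Icc a b))).Nonempty := by
  obtain ⟨α, hα⟩ := S.curve.curveOrientation_nonempty h.lt h.injOn_lift
  have hpush : endMap H ∘ α ∈ pushOrientation γ (endMap H) _ := ⟨α, hα, rfl⟩
  rcases h.strictMonoOn_or_strictAntiOn with hθ | hθ
  · exact ⟨_, S.pushOrientation_eq_of_strictMonoOn h hθ ▸ hpush⟩
  · exact ⟨_, S.pushOrientation_eq_of_strictAntiOn h hθ ▸ hpush⟩

theorem pushOrientation_eq_pullOrientation_iff (S : IsDeformationSetting f d C γ H)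
    (h : IsEdgeChart f C γ H a b θ) :
    pushOrientation γ (endMap H) ((fun t : ℝ => γ t) '' Icc a b) =
      pullOrientation γ f (endMap H '' ((fun t : ℝ => γ t) '' Icc a b)) ↔
      StrictMonoOn θ (Icc a b) := by
  refine ⟨fun heq => ?_, S.pushOrientation_eq_of_strictMonoOn h⟩
  by_contra hθ
  exact S.curve.pullOrientation_ne_oppositeOrientation (S.pullOrientation_nonempty h)
    (heq.symm.trans (S.pushOrientation_eq_of_strictAntiOn h (h.not_strictMonoOn_iff.1 hθ)))

theorem pushOrientation_eq_oppositeOrientation_iff (S : IsDeformationSetting f d C γ H)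
    (h : IsEdgeChart f C γ H a b θ) :
    pushOrientation γ (endMap H) ((fun t : ℝ => γ t) '' Icc a b) = oppositeOrientation
      (pullOrientation γ f (endMap H '' ((fun t : ℝ => γ t) '' Icc a b))) ↔
      ¬ StrictMonoOn θ (Icc a b) := by
  refine ⟨fun heq hθ => ?_, fun hθ =>
    S.pushOrientation_eq_of_strictAntiOn h (h.not_strictMonoOn_iff.1 hθ)⟩
  exact S.curve.pullOrientation_ne_oppositeOrientation (S.pullOrientation_nonempty h)
    ((S.pushOrientation_eq_of_strictMonoOn h hθ).symm.trans heq)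

end IsDeformationSetting

/-! ### Comparison of sides -/

theorem iff_of_locally_iff_of_isPreconnected {X : Type*} [TopologicalSpace X] {s D : Set X}
    (hs : IsPreconnected s) (hD : Dense D) (hDs : D ⊆ s) {P : X → Prop}
    (hloc : ∀ z ∈ s, ∃ N ∈ 𝓝 z, ∀ u ∈ N, ∀ v ∈ N, u ∈ D → v ∈ D → (P u ↔ P v)) {u v : X}
    (hu : u ∈ D) (hv : v ∈ D) : P u ↔ P v := by
  have hdisj : Disjoint {z | ∀ᶠ u in 𝓝 z, u ∈ D → P u} {z | ∀ᶠ u in 𝓝 z, u ∈ D → ¬ P u} :=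
    disjoint_left.2 fun z hz hz' => by
      obtain ⟨w, hwD, hw, hw'⟩ := ((mem_closure_iff_frequently.1 (hD z)).and_eventually
        (Filter.Eventually.and hz hz')).exists
      exact hw' hwD (hw hwD)
  have hcover : s ⊆ {z | ∀ᶠ u in 𝓝 z, u ∈ D → P u} ∪ {z | ∀ᶠ u in 𝓝 z, u ∈ D → ¬ P u} := by
    intro z hz
    obtain ⟨N, hN, hNP⟩ := hloc z hz
    by_cases hex : ∃ w ∈ N, w ∈ D ∧ P w
    · obtain ⟨w, hwN, hwD, hw⟩ := hex
      exact Or.inl (Filter.mem_of_superset hN fun r hr hrD => (hNP w hwN r hr hwD hrD).1 hw)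
    · exact Or.inr (Filter.mem_of_superset hN fun r hr hrD hPr => hex ⟨r, hr, hrD, hPr⟩)
  rcases hs.subset_or_subset isOpen_setOfPred_eventually_nhds isOpen_setOfPred_eventually_nhds
    hdisj hcover with hall | hall
  · exact iff_of_true ((hall (hDs hu)).self_of_nhds hu) ((hall (hDs hv)).self_of_nhds hv)
  · exact iff_of_false ((hall (hDs hu)).self_of_nhds hu) ((hall (hDs hv)).self_of_nhds hv)

theorem image_side_preimage {f : RSphere → RSphere} (hfc : Continuous f) (hfo : IsOpenMap f)
    {C : Set RSphere} (hC : IsClosed C) {x : RSphere} (hx : x ∉ f ⁻¹' C) :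
    f '' side (f ⁻¹' C) x = side C (f x) := by
  have hxU : x ∈ side (f ⁻¹' C) x := mem_connectedComponentIn hx
  have hopen : IsOpen (side (f ⁻¹' C) x) := (hC.preimage hfc).isOpen_compl.connectedComponentIn
  refine Subset.antisymm ?_ ?_
  · refine (isPreconnected_connectedComponentIn.image f
      hfc.continuousOn).subset_connectedComponentIn ⟨x, hxU, rfl⟩ (image_subset_iff.2 ?_)
    exact connectedComponentIn_subset _ _
  · -- The image is open, and it is also closed in `Cᶜ`, since the closure of a component of
    -- `(f ⁻¹' C)ᶜ` meets `(f ⁻¹' C)ᶜ` only in that component.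
    refine isPreconnected_connectedComponentIn.subset_left_of_subset_union (hfo _ hopen)
      (v := (f '' closure (side (f ⁻¹' C) x))ᶜ)
      (isClosed_closure.isCompact.image hfc).isClosed.isOpen_compl
      (disjoint_compl_right_iff_subset.2 (image_mono subset_closure)) (fun y hy => ?_)
      ⟨f x, mem_connectedComponentIn hx, x, hxU, rfl⟩
    refine or_iff_not_imp_right.2 fun hyU => ?_
    obtain ⟨z, hz, rfl⟩ := not_not.1 hyU
    have hzC : f z ∈ Cᶜ := connectedComponentIn_subset Cᶜ (f x) hy
    exact ⟨z, closure_connectedComponentIn_inter_subset hx ⟨hz, hzC⟩, rfl⟩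

namespace IsOrientedJordanCurve

variable {C : Set RSphere} {γ : UnitAddCircle → RSphere} {q x x' y y' : RSphere}

theorem side_eq_iff_side_eq_comm (h : IsOrientedJordanCurve C γ) (hx : x ∉ C) (hx' : x' ∉ C)
    (hy : y ∉ C) (hy' : y' ∉ C) :
    (side C x = side C x' ↔ side C y = side C y') ↔
      (side C x = side C y ↔ side C x' = side C y') := by
  rw [h.side_eq_iff_iff hx hy hy', h.side_eq_iff_iff hx hx' hy']
  tauto

theorem side_eq_iff_of_loopVarAt_eq_mul (h : IsOrientedJordanCurve C γ) (hq : q ∈ C)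
    (hx : x ∉ C) (hx' : x' ∉ C) (hy : y ∉ C) (hy' : y' ∉ C) (hne : side C y ≠ side C y') {ε : ℂ}
    (hε : ε = 1 ∨ ε = -1) (hmul : loopVarAt q γ x x' = ε * loopVarAt q γ y y') :
    side C x = side C y ↔ ε = 1 := by
  have hyy' : loopVarAt q γ y y' ≠ 0 := (h.loopVarAt_eq_zero_iff hq hy hy').not.2 hne
  have hq' : q ∈ range γ := by rwa [h.range_eq]
  have hvalue {z} (hz : z ∉ C) : side C z = side C y ∧ loopVarAt q γ z y' = loopVarAt q γ y y' ∨
      side C z ≠ side C y ∧ loopVarAt q γ z y' = 0 := by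
    by_cases hzy : side C z = side C y
    · refine Or.inl ⟨hzy, loopVarAt_eq_of_side_eq h.continuous hq' (h.notMem_range hz)
        (h.notMem_range hy) (h.notMem_range hy') ?_⟩
      rwa [h.range_eq]
    · exact Or.inr ⟨hzy, (h.loopVarAt_eq_zero_iff hq hz hy').2
        (h.side_eq_of_ne_of_ne hy hz hy' (Ne.symm hzy) hne)⟩
  rw [← loopVarAt_sub_loopVarAt h.continuous hq' (h.notMem_range hx) (h.notMem_range hx')
    (h.notMem_range hy')] at hmul
  have hε0 : ε ≠ 0 := by rcases hε with rfl | rfl <;> norm_num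
  rcases hvalue hx with ⟨hxy, hx0⟩ | ⟨hxy, hx0⟩ <;>
    rcases hvalue hx' with ⟨-, hx'0⟩ | ⟨-, hx'0⟩ <;> rw [hx0, hx'0] at hmul
  · exact absurd (hmul.symm.trans (sub_self _)) (mul_ne_zero hε0 hyy')
  · exact iff_of_true hxy (mul_right_cancel₀ hyy' (by linear_combination -hmul))
  · refine iff_of_false hxy fun h1 => ?_
    rw [h1, one_mul, zero_sub] at hmul
    exact hyy' (neg_eq_self.1 hmul)
  · exact absurd (hmul.symm.trans (sub_self _)) (mul_ne_zero hε0 hyy')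

end IsOrientedJordanCurve

namespace IsDeformationSetting

variable {f : RSphere → RSphere} {d : ℕ} {C : Set RSphere} {γ : UnitAddCircle → RSphere}
  {H : RSphere × I → RSphere} {q x y z : RSphere} {a b t₀ : ℝ} {θ : ℝ → ℝ} {ε : ℂ}

theorem side_map_eq (S : IsDeformationSetting f d C γ H) (hx : x ∉ f ⁻¹' C) :
    side C (f x) = f '' side (f ⁻¹' C) x :=
  (image_side_preimage S.continuous_map S.isOpenMap_map S.curve.isClosed hx).symm

theorem side_eq_of_side_endMap_eq (S : IsDeformationSetting f d C γ H)
    (hx : endMap H x ∉ f ⁻¹' C) (hy : endMap H y ∉ f ⁻¹' C)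
    (hxy : side (f ⁻¹' C) (endMap H x) = side (f ⁻¹' C) (endMap H y)) :
    side C x = side C y := by
  obtain ⟨q, hq⟩ := S.post_nontrivial.nonempty
  have hq₁ := S.post_subset_preimage hq
  rw [← S.curve.loopVarAt_eq_zero_iff (S.post_subset hq) (S.notMem_of_endMap_notMem hx)
    (S.notMem_of_endMap_notMem hy), ← S.loopVarAt_endMap hq hx hy]
  rw [← S.range_endLoop] at hx hy hxy hq₁
  rw [loopVarAt_eq_of_side_eq S.continuous_endLoop hq₁ hx hy hy hxy,
    loopVarAt_self S.continuous_endLoop hq₁ hy]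

theorem exists_nhds_loopVarAt_eq_mul (S : IsDeformationSetting f d C γ H)
    (hq : q ∈ postcriticalSet f) (h : IsEdgeChart f C γ H a b θ) (ht₀ : t₀ ∈ Ioo a b)
    (hε : StrictMonoOn θ (Icc a b) ∧ ε = 1 ∨ StrictAntiOn θ (Icc a b) ∧ ε = -1) :
    ∃ N ∈ 𝓝 (endMap H (γ (t₀ : UnitAddCircle))), ∀ x y, endMap H x ∈ N → endMap H y ∈ N →
      endMap H x ∉ f ⁻¹' C → endMap H y ∉ f ⁻¹' C →
      loopVarAt q γ x y = ε * loopVarAt q γ (f (endMap H x)) (f (endMap H y)) := by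
  have hW := h.notMem t₀ ht₀
  have hfp : f (endMap H (γ t₀)) ∉ postcriticalSet f := fun hp => hW ⟨hp, S.curve.mem _⟩
  have hendLoop : ∀ t ∈ Ioo t₀ (t₀ + 1), endMap H (γ t) ≠ endMap H (γ t₀) := fun t ht heq => by
    have htW : γ t ∉ vertexPreimages f C H := fun htW => hfp (show f _ ∈ _ from heq ▸ htW.1)
    exact S.curve.ne_of_mem_Ioo ht (S.injOn_endMap ⟨S.curve.mem _, htW⟩ ⟨S.curve.mem _, hW⟩ heq)
  have hloop : ∀ t ∈ Ioo (θ t₀) (θ t₀ + 1), γ t ≠ f (endMap H (γ t₀)) := fun t ht heq =>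
    S.curve.ne_of_mem_Ioo ht (heq.trans (h.eq t₀ (Ioo_subset_Icc_self ht₀)).symm)
  obtain ⟨N, hN, hvar⟩ := S.rat.exists_nhds_loopVarAt_eq_mul S.continuous_endLoop
    S.curve.continuous (p := endMap H (γ t₀)) (q := q) (S.range_endLoop ▸ S.post_subset_preimage hq)
    (S.curve.range_eq ▸ S.post_subset hq)
    (fun heq => hfp (map_mem_postcriticalSet (heq ▸ hq))) (fun heq => hfp (heq ▸ hq))
    (fun hcrit => hfp hcrit.map_mem_postcriticalSet) ht₀ h.continuous hε rfl hendLoop hloop h.eq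
  refine ⟨N, hN, fun x y hxN hyN hx hy => ?_⟩
  have hvar' := hvar _ hxN _ hyN
  rw [S.range_endLoop, S.curve.range_eq] at hvar'
  rw [← S.loopVarAt_endMap hq hx hy, hvar' hx hy hx hy]

theorem exists_nhds_side_eq_iff_of_isEdgeChart (S : IsDeformationSetting f d C γ H)
    (h : IsEdgeChart f C γ H a b θ) (ht₀ : t₀ ∈ Ioo a b) :
    ∃ N ∈ 𝓝 (endMap H (γ (t₀ : UnitAddCircle))), ∀ x y, endMap H x ∈ N → endMap H y ∈ N →
      endMap H x ∉ f ⁻¹' C → endMap H y ∉ f ⁻¹' C →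
      (side C x = side C y ↔ side C (f (endMap H x)) = side C (f (endMap H y))) := by
  obtain ⟨q, hq⟩ := S.post_nontrivial.nonempty
  obtain ⟨ε, hε, hε0⟩ : ∃ ε : ℂ, (StrictMonoOn θ (Icc a b) ∧ ε = 1 ∨
      StrictAntiOn θ (Icc a b) ∧ ε = -1) ∧ ε ≠ 0 := by
    rcases h.strictMonoOn_or_strictAntiOn with hθ | hθ
    · exact ⟨1, Or.inl ⟨hθ, rfl⟩, one_ne_zero⟩
    · exact ⟨-1, Or.inr ⟨hθ, rfl⟩, neg_ne_zero.2 one_ne_zero⟩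
  obtain ⟨N, hN, hloop⟩ := S.exists_nhds_loopVarAt_eq_mul hq h ht₀ hε
  refine ⟨N, hN, fun x y hxN hyN hx hy => ?_⟩
  rw [← S.curve.loopVarAt_eq_zero_iff (S.post_subset hq) (S.notMem_of_endMap_notMem hx)
    (S.notMem_of_endMap_notMem hy), hloop x y hxN hyN hx hy, mul_eq_zero_iff_left hε0,
    S.curve.loopVarAt_eq_zero_iff (S.post_subset hq) hx hy]

theorem exists_nhds_side_eq_iff (S : IsDeformationSetting f d C γ H) (hz : z ∉ oneVertices f) :
    ∃ N ∈ 𝓝 z, ∀ x y, endMap H x ∈ N → endMap H y ∈ N →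
      endMap H x ∉ f ⁻¹' C → endMap H y ∉ f ⁻¹' C →
      (side C x = side C y ↔ side C (f (endMap H x)) = side C (f (endMap H y))) := by
  by_cases hzC : z ∈ f ⁻¹' C
  · obtain ⟨w, hw, rfl⟩ := S.deformation.image_eq.superset hzC
    obtain ⟨t, -, rfl⟩ := S.curve.exists_eq 0 hw
    obtain ⟨a, b, θ, ht, h⟩ := S.exists_isEdgeChart (t₀ := t) fun htW => hz htW.1
    exact S.exists_nhds_side_eq_iff_of_isEdgeChart h ht
  · refine ⟨side (f ⁻¹' C) z, (S.curve.isClosed.preimage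
      S.continuous_map).isOpen_compl.connectedComponentIn.mem_nhds (mem_connectedComponentIn hzC),
      fun x y hxz hyz hx hy => ?_⟩
    have hxy : side (f ⁻¹' C) (endMap H x) = side (f ⁻¹' C) (endMap H y) :=
      ((side_eq_side_iff hx).2 hxz).symm.trans ((side_eq_side_iff hy).2 hyz)
    refine iff_of_true (S.side_eq_of_side_endMap_eq hx hy hxy) ?_
    rw [S.side_map_eq hx, S.side_map_eq hy, hxy]

theorem side_eq_side_map_iff (S : IsDeformationSetting f d C γ H) (hx : endMap H x ∉ f ⁻¹' C)
    (hy : endMap H y ∉ f ⁻¹' C) :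
    side C x = side C (f (endMap H x)) ↔ side C y = side C (f (endMap H y)) := by
  have hloc {z} (hz : z ∉ oneVertices f) : ∃ N ∈ 𝓝 z, ∀ x y, endMap H x ∈ N → endMap H y ∈ N →
      endMap H x ∉ f ⁻¹' C → endMap H y ∉ f ⁻¹' C →
      (side C x = side C (f (endMap H x)) ↔ side C y = side C (f (endMap H y))) := by
    obtain ⟨N, hN, hside⟩ := S.exists_nhds_side_eq_iff hz
    exact ⟨N, hN, fun x y hxN hyN hx hy => (S.curve.side_eq_iff_side_eq_comm
      (S.notMem_of_endMap_notMem hx) (S.notMem_of_endMap_notMem hy) hx hy).1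
      (hside x y hxN hyN hx hy)⟩
  let g := Function.surjInv S.surjective_endMap
  have hg (u) : endMap H (g u) = u := Function.surjInv_eq S.surjective_endMap u
  have hxg {x} (hx : endMap H x ∉ f ⁻¹' C) : side C x = side C (f (endMap H x)) ↔
      side C (g (endMap H x)) = side C (f (endMap H (g (endMap H x)))) := by
    obtain ⟨N, hN, hside⟩ := hloc (S.notMem_oneVertices hx)
    have hmem := mem_of_mem_nhds hN
    exact hside _ _ hmem ((hg _).symm ▸ hmem) hx ((hg _).symm ▸ hx)
  rw [hxg hx, hxg hy]
  refine iff_of_locally_iff_of_isPreconnected (P := fun u => side C (g u) =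
    side C (f (endMap H (g u)))) (isPreconnected_compl_of_finite S.finite_oneVertices)
    S.dense_compl_preimage (fun u => S.notMem_oneVertices) (fun z hz => ?_) hx hy
  obtain ⟨N, hN, hside⟩ := hloc hz
  refine ⟨N, hN, fun u hu v hv huC hvC => hside _ _ ?_ ?_ ?_ ?_⟩ <;> rwa [hg]

theorem exists_side_eq_side_map_iff (S : IsDeformationSetting f d C γ H)
    (h : IsEdgeChart f C γ H a b θ) :
    ∃ x, endMap H x ∉ f ⁻¹' C ∧
      (side C x = side C (f (endMap H x)) ↔ StrictMonoOn θ (Icc a b)) := by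
  obtain ⟨q, hq⟩ := S.post_nontrivial.nonempty
  obtain ⟨t, ht⟩ := exists_between h.lt
  obtain ⟨ε, hε, hεθ⟩ : ∃ ε : ℂ, (StrictMonoOn θ (Icc a b) ∧ ε = 1 ∨
      StrictAntiOn θ (Icc a b) ∧ ε = -1) ∧ (ε = 1 ↔ StrictMonoOn θ (Icc a b)) := by
    rcases h.strictMonoOn_or_strictAntiOn with hθ | hθ
    · exact ⟨1, Or.inl ⟨hθ, rfl⟩, iff_of_true rfl hθ⟩
    · exact ⟨-1, Or.inr ⟨hθ, rfl⟩, iff_of_false (by norm_num) (h.not_strictMonoOn_iff.2 hθ)⟩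
  obtain ⟨N, hN, hloop⟩ := S.exists_nhds_loopVarAt_eq_mul hq h ht hε
  have hmeet {w} (hw : w ∉ C) : ∃ x, endMap H x ∈ N ∧ endMap H x ∉ f ⁻¹' C ∧
      side C w = side C (f (endMap H x)) := by
    obtain ⟨_, ⟨u, huN, rfl⟩, huw⟩ := mem_closure_iff_nhds.1
      (S.curve.mem_closure_side (S.map_endMap_mem (S.curve.mem _)) hw) _
      (S.isOpenMap_map.image_mem_nhds hN)
    obtain ⟨x, rfl⟩ := S.surjective_endMap u
    exact ⟨x, huN, connectedComponentIn_subset _ _ huw, connectedComponentIn_eq huw⟩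
  obtain ⟨w, hw⟩ := S.curve.exists_notMem
  obtain ⟨w', hw', hne⟩ := S.curve.exists_side_ne hw
  obtain ⟨x, hxN, hx, hwx⟩ := hmeet hw
  obtain ⟨x', hx'N, hx', hwx'⟩ := hmeet hw'
  refine ⟨x, hx, (S.curve.side_eq_iff_of_loopVarAt_eq_mul (S.post_subset hq)
    (S.notMem_of_endMap_notMem hx) (S.notMem_of_endMap_notMem hx') hx hx' (hwx ▸ hwx' ▸ hne)
    (hε.imp And.right And.right) (hloop x x' hxN hx'N hx hx')).trans hεθ⟩

theorem strictMonoOn_iff (S : IsDeformationSetting f d C γ H) (h : IsEdgeChart f C γ H a b θ)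
    (hx : endMap H x ∉ f ⁻¹' C) :
    StrictMonoOn θ (Icc a b) ↔ side C x = side C (f (endMap H x)) := by
  obtain ⟨y, hy, hyθ⟩ := S.exists_side_eq_side_map_iff h
  rw [← hyθ, S.side_eq_side_map_iff hx hy]

theorem isOrientationPreserving_iff (S : IsDeformationSetting f d C γ H)
    (hx : endMap H x ∉ f ⁻¹' C) :
    IsOrientationPreservingDeformation f C γ H ↔ side C x = side C (f (endMap H x)) := by
  constructor
  · intro hH
    obtain ⟨t, ht⟩ := S.exists_notMem_vertexPreimages
    obtain ⟨a, b, θ, -, h⟩ := S.exists_isEdgeChart ht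
    have hA := S.isDeformedArc_image_Icc h
    rw [← S.strictMonoOn_iff h hx, ← S.pushOrientation_eq_pullOrientation_iff h]
    exact hH _ _ (S.isOneEdge_image hA) hA rfl
  · rintro hside E A - hA rfl
    obtain ⟨a, b, θ, h, rfl⟩ := S.exists_isEdgeChart_of_isDeformedArc hA
    rwa [S.pushOrientation_eq_pullOrientation_iff h, S.strictMonoOn_iff h hx]

theorem isOrientationReversing_iff (S : IsDeformationSetting f d C γ H)
    (hx : endMap H x ∉ f ⁻¹' C) :
    IsOrientationReversingDeformation f C γ H ↔ side C x ≠ side C (f (endMap H x)) := by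
  constructor
  · intro hH
    obtain ⟨t, ht⟩ := S.exists_notMem_vertexPreimages
    obtain ⟨a, b, θ, -, h⟩ := S.exists_isEdgeChart ht
    have hA := S.isDeformedArc_image_Icc h
    rw [Ne, ← S.strictMonoOn_iff h hx, ← S.pushOrientation_eq_oppositeOrientation_iff h]
    exact hH _ _ (S.isOneEdge_image hA) hA rfl
  · rintro hside E A - hA rfl
    obtain ⟨a, b, θ, h, rfl⟩ := S.exists_isEdgeChart_of_isDeformedArc hA
    rwa [S.pushOrientation_eq_oppositeOrientation_iff h, S.strictMonoOn_iff h hx]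

end IsDeformationSetting

/-! ### Tiles and their colors -/

theorem IsTile.eq_closure_side {K X : Set RSphere} (hX : IsTile K X) {x : RSphere} (hx : x ∈ X)
    (hxK : x ∉ K) : X = closure (side K x) := by
  obtain ⟨_, ⟨z, hz, rfl⟩, rfl⟩ := hX
  rw [side, connectedComponentIn_eq (closure_connectedComponentIn_inter_subset hz ⟨hx, hxK⟩)]

theorem closure_side_eq_closure_side_iff {K : Set RSphere} {x y : RSphere} (hx : x ∉ K)
    (hy : y ∉ K) : closure (side K x) = closure (side K y) ↔ side K x = side K y := by
  refine ⟨fun heq => (side_eq_side_iff hy).2 ?_, congrArg closure⟩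
  exact closure_connectedComponentIn_inter_subset hx
    ⟨heq ▸ subset_closure (mem_connectedComponentIn hy), hy⟩

theorem zeroTileColor_eq_zeroTileColor_iff {Xw X Y : Set RSphere} :
    zeroTileColor Xw X = zeroTileColor Xw Y ↔ (X = Xw ↔ Y = Xw) := by
  by_cases hX : X = Xw <;> by_cases hY : Y = Xw <;> simp [zeroTileColor, hX, hY]

theorem IsOrientedJordanCurve.zeroTileColor_closure_side_eq_iff {C : Set RSphere}
    {γ : UnitAddCircle → RSphere} (h : IsOrientedJordanCurve C γ) {Xw : Set RSphere}
    (hXw : IsTile C Xw) {x y : RSphere} (hx : x ∉ C) (hy : y ∉ C) :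
    zeroTileColor Xw (closure (side C x)) = zeroTileColor Xw (closure (side C y)) ↔
      side C x = side C y := by
  obtain ⟨_, ⟨w, hw, rfl⟩, rfl⟩ := hXw
  rw [zeroTileColor_eq_zeroTileColor_iff, closure_side_eq_closure_side_iff hx hw,
    closure_side_eq_closure_side_iff hy hw, h.side_eq_iff_iff hw hx hy, eq_comm (a := side C x),
    eq_comm (a := side C y)]

theorem IsDeformationSetting.oneTileColor_eq {f : RSphere → RSphere} {d : ℕ} {C : Set RSphere}
    {γ : UnitAddCircle → RSphere} {H : RSphere × I → RSphere}
    (S : IsDeformationSetting f d C γ H) (Xw : Set RSphere) {X : Set RSphere}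
    (hX : IsTile (f ⁻¹' C) X) {x : RSphere} (hx : x ∈ X) (hxC : x ∉ f ⁻¹' C) :
    oneTileColor f Xw X = zeroTileColor Xw (closure (side C (f x))) := by
  rw [oneTileColor, hX.eq_closure_side hx hxC, S.side_map_eq hxC,
    image_closure_of_isCompact isClosed_closure.isCompact S.continuous_map.continuousOn]

theorem mainTheorem10 (f : RSphere → RSphere) (d : ℕ) (hd : 2 ≤ d)
    (hf : IsRationalMapOfDegree f d) (hpcf : (postcriticalSet f).Finite)
    (C : Set RSphere) (γ : UnitAddCircle → RSphere) (hC : IsOrientedJordanCurve C γ)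
    (hpost : postcriticalSet f ⊆ C)
    (Xw : Set RSphere) (hXw : IsTile C Xw)
    (H : RSphere × unitInterval → RSphere) (hH : IsElementaryDeformation f C H) :
    Xor (IsOrientationPreservingDeformation f C γ H)
      (IsOrientationReversingDeformation f C γ H) ∧
    (∀ x y : RSphere, endMap H x ∉ f ⁻¹' C → endMap H y ∉ f ⁻¹' C →
      ∀ X₀ Y₀ X₁ Y₁ : Set RSphere,
        IsTile C X₀ → x ∈ X₀ → IsTile C Y₀ → y ∈ Y₀ →
        IsTile (f ⁻¹' C) X₁ → endMap H x ∈ X₁ → IsTile (f ⁻¹' C) Y₁ → endMap H y ∈ Y₁ →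
        (zeroTileColor Xw X₀ = zeroTileColor Xw Y₀ ↔
          oneTileColor f Xw X₁ = oneTileColor f Xw Y₁)) ∧
    (∀ x : RSphere, endMap H x ∉ f ⁻¹' C →
      ∀ X₀ X₁ : Set RSphere,
        IsTile C X₀ → x ∈ X₀ → IsTile (f ⁻¹' C) X₁ → endMap H x ∈ X₁ →
        (zeroTileColor Xw X₀ = oneTileColor f Xw X₁ ↔
          IsOrientationPreservingDeformation f C γ H)) := by
  have S : IsDeformationSetting f d C γ H := ⟨hf.hasRatPair (by omega), hd, hpcf, hC, hpost, hH⟩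
  refine ⟨?_, ?_, ?_⟩
  · obtain ⟨u, hu⟩ := S.dense_compl_preimage.nonempty
    obtain ⟨x, rfl⟩ := S.surjective_endMap u
    rw [S.isOrientationPreserving_iff hu, S.isOrientationReversing_iff hu]
    exact (em _).imp (fun h => ⟨h, not_not.2 h⟩) fun h => ⟨h, h⟩
  · intro x y hx hy X₀ Y₀ X₁ Y₁ hX₀ hxX₀ hY₀ hyY₀ hX₁ hxX₁ hY₁ hyY₁
    have hxC := S.notMem_of_endMap_notMem hx
    have hyC := S.notMem_of_endMap_notMem hy
    rw [hX₀.eq_closure_side hxX₀ hxC, hY₀.eq_closure_side hyY₀ hyC,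
      S.oneTileColor_eq Xw hX₁ hxX₁ hx, S.oneTileColor_eq Xw hY₁ hyY₁ hy,
      hC.zeroTileColor_closure_side_eq_iff hXw hxC hyC,
      hC.zeroTileColor_closure_side_eq_iff hXw hx hy, hC.side_eq_iff_side_eq_comm hxC hyC hx hy]
    exact S.side_eq_side_map_iff hx hy
  · intro x hx X₀ X₁ hX₀ hxX₀ hX₁ hxX₁
    have hxC := S.notMem_of_endMap_notMem hx
    rw [hX₀.eq_closure_side hxX₀ hxC, S.oneTileColor_eq Xw hX₁ hxX₁ hx,
      hC.zeroTileColor_closure_side_eq_iff hXw hxC hx, S.isOrientationPreserving_iff hx]
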